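/- Let $R$ be an associative unital ring; modules are left modules, and right $R$-modules are viewed as modules over the opposite ring $R^{\mathrm{op}}$. Let $M$ be an $R$-bimodule, put $M^{\otimes_R 0}=R$ and $M^{\otimes_R(i+1)}=M\otimes_R M^{\otimes_R i}$, and suppose that $M$ is $N$-nilpotent for some integer $N\ge 0$, i.e. $M^{\otimes_R(N+1)}=0$. Let $T_R(M)=\bigoplus_{i\ge 0}M^{\otimes_R i}$ be the tensor ring, with multiplication given by concatenation of tensors. A $T_R(M)$-module is identified with a pair $(X,u)$, where $X$ is an $R$-module and $u\colon M\otimes_R X\to X$ is an $R$-homomorphism (the action of $M$ on $X$). A $T_R(M)^{\mathrm{op}}$-module is identified with a pair $[Y,v]$, where $Y$ is an $R^{\mathrm{op}}$-module and $v\colon Y\to\operatorname{Hom}_{R^{\mathrm{op}}}(M,Y)$ is an $R^{\mathrm{op}}$-homomorphism (so that $y\cdot m=v(y)(m)$). For a class $\mathsf X$ of $R$-modules and a class $\mathsf Y$ of $R^{\mathrm{op}}$-modules let $$\Phi(\mathsf X)=\{(X,u) : u \text{ is a monomorphism and } \operatorname{coker}(u)\in\mathsf X\},\qquad \Psi(\mathsf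 Y)=\{[Y,v] : v \text{ is an epimorphism and } \ker(v)\in\mathsf Y\}.$$ For a ring $S$, an $S$-module is Gorenstein projective (resp. Gorenstein injective, Gorenstein flat) if it is isomorphic to $\ker(C^0\to C^1)$ for some exact sequence $\cdots\to C^{-1}\to C^0\to C^1\to\cdots$ of projective (resp. injective, flat) $S$-modules that remains exact after applying $\operatorname{Hom}_S(-,P)$ for every projective $S$-module $P$ (resp. $\operatorname{Hom}_S(E,-)$ for every injective $S$-module $E$; $E\otimes_S-$ for every injective $S^{\mathrm{op}}$-module $E$). Write $\mathsf{GP}(S)$, $\mathsf{GI}(S)$, $\mathsf{GF}(S)$ for the corresponding classes, and $\operatorname{pd}$, $\operatorname{fd}$ for projective and flat dimension. Consider the condition $$(\mathsf T)\qquad \operatorname{Tor}^R_n(M,M^{\otimes_R i}\otimes_R P)=0\ \text{ for every projective } R\text{-module } P \text{ and all } i\ge 1,\ n\ge 1.$$ Then the following hold. 1. If $M$ satisfies $(\mathsf T)$, $\operatorname{pd}_R M<\infty$ and $\operatorname{fd}_{R^{\mathrm{op}}}M<\infty$, then $\mathsf{GP}(T_R(M))=\Phi(\mathsf{GP}(R))$;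 that is, $(X,u)$ is Gorenstein projective if and only if $u$ is a monomorphism and $\operatorname{coker}(u)$ is a Gorenstein projective $R$-module. 2. If $M$ satisfies $(\mathsf T)$, $\operatorname{fd}_R M<\infty$ and $\operatorname{pd}_{R^{\mathrm{op}}}M<\infty$, then $\mathsf{GI}(T_R(M)^{\mathrm{op}})=\Psi(\mathsf{GI}(R^{\mathrm{op}}))$. 3. If $R$ is right coherent, $M$ is flat as an $R$-module and finitely presented as an $R^{\mathrm{op}}$-module, and $\operatorname{pd}_{R^{\mathrm{op}}}M<\infty$, then $\mathsf{GF}(T_R(M))=\Phi(\mathsf{GF}(R))$. -/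

import Mathlib

universe u

open MulOpposite CategoryTheory
open scoped TensorProduct

noncomputable section

namespace TR

/-! Right `R`-modules are modules over `Rᵐᵒᵖ`; an `R`-bimodule carries commuting structures of
`R`-module and `Rᵐᵒᵖ`-module. -/

/-! ### Tensor product over a not necessarily commutative ring -/

section Tensor

variable (R : Type u) [Ring R]

/-- The subgroup of `A ⊗[ℤ] B` generated by the elements `(a r) ⊗ b - a ⊗ (r b)`. -/
def balancer (A B : Type u) [AddCommGroup A] [Module Rᵐᵒᵖ A] [AddCommGroup B] [Module R B] :
    Submodule ℤ (A ⊗[ℤ] B) :=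
  Submodule.span ℤ {z | ∃ (a : A) (r : R) (b : B), z = (op r • a) ⊗ₜ[ℤ] b - a ⊗ₜ[ℤ] (r • b)}

/-- The tensor product `A ⊗_R B` of a right `R`-module `A` and a left `R`-module `B`. -/
def Tens (A B : Type u) [AddCommGroup A] [Module Rᵐᵒᵖ A] [AddCommGroup B] [Module R B] :
    Type u :=
  (A ⊗[ℤ] B) ⧸ balancer R A B

variable {A A' B B' B'' C : Type u} [AddCommGroup A] [Module Rᵐᵒᵖ A] [AddCommGroup A']
  [Module Rᵐᵒᵖ A'] [AddCommGroup B] [Module R B] [AddCommGroup B'] [Module R B']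
  [AddCommGroup B''] [Module R B''] [AddCommGroup C]

instance : AddCommGroup (Tens R A B) :=
  inferInstanceAs (AddCommGroup ((A ⊗[ℤ] B) ⧸ balancer R A B))

/-- The canonical biadditive map `(a, b) ↦ a ⊗ b`. -/
def tmk : A →+ B →+ Tens R A B :=
  AddMonoidHom.mk' (fun a => AddMonoidHom.mk' (fun b => (balancer R A B).mkQ (a ⊗ₜ[ℤ] b))
    (fun b b' => by rw [TensorProduct.tmul_add, map_add]; rfl))
    (fun a a' => by ext b; simp [TensorProduct.add_tmul]; rfl)

theorem tmk_smul (r : R) (a : A) (b : B) : tmk R (op r • a) b = tmk R a (r • b) := by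
  refine (Submodule.Quotient.eq (balancer R A B)).2 ?_
  exact Submodule.subset_span ⟨a, r, b, rfl⟩

theorem tens_induction {p : Tens R A B → Prop} (z : Tens R A B) (h0 : p 0)
    (hm : ∀ a b, p (tmk R a b)) (ha : ∀ x y, p x → p y → p (x + y)) : p z := by
  obtain ⟨z, rfl⟩ := Submodule.mkQ_surjective (balancer R A B) z
  induction z using TensorProduct.induction_on with
  | zero => rw [map_zero]; exact h0
  | tmul a b => exact hm a b
  | add x y hx hy => rw [map_add]; exact ha _ _ hx hy

theorem tens_hom_ext {f g : Tens R A B →+ C} (h : ∀ a b, f (tmk R a b) = g (tmk R a b)) :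
    f = g := by
  ext z
  induction z using tens_induction R with
  | h0 => simp
  | hm a b => exact h a b
  | ha x y hx hy => rw [map_add, map_add, hx, hy]

/-- The additive map on `A ⊗[ℤ] B` determined by a biadditive map. -/
def zlift (f : A →+ B →+ C) : A ⊗[ℤ] B →ₗ[ℤ] C :=
  TensorProduct.lift (LinearMap.mk₂ ℤ (fun a b => f a b) (fun a a' b => by simp)
    (fun n a b => by simp) (fun a b b' => by simp) (fun n a b => by simp))

/-- The universal property of `A ⊗_R B`: balanced biadditive maps factor through it. -/
def tlift (f : A →+ B →+ C) (hf : ∀ (r : R) a b, f (op r • a) b = f a (r • b)) :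
    Tens R A B →+ C :=
  ((balancer R A B).liftQ (zlift f) (by
      rw [balancer, Submodule.span_le]
      rintro _ ⟨a, r, b, rfl⟩
      refine LinearMap.mem_ker.2 ?_
      rw [map_sub, sub_eq_zero]
      exact hf r a b)).toAddMonoidHom

@[simp]
theorem tlift_tmk (f : A →+ B →+ C) (hf : ∀ (r : R) a b, f (op r • a) b = f a (r • b)) (a : A)
    (b : B) : tlift R f hf (tmk R a b) = f a b :=
  rfl

/-- `A ⊗ f : A ⊗_R B → A ⊗_R B'`. -/
def tmapR (A : Type u) [AddCommGroup A] [Module Rᵐᵒᵖ A] (f : B →ₗ[R] B') :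
    Tens R A B →+ Tens R A B' :=
  tlift R (AddMonoidHom.mk' (fun a => (tmk R a).comp f.toAddMonoidHom) (fun a a' => by ext b; simp))
    (fun r a b => by simp [tmk_smul])

/-- `g ⊗ B : A ⊗_R B → A' ⊗_R B`. -/
def tmapL (g : A →ₗ[Rᵐᵒᵖ] A') (B : Type u) [AddCommGroup B] [Module R B] :
    Tens R A B →+ Tens R A' B :=
  tlift R ((tmk R).comp g.toAddMonoidHom) (fun r a b => by simp [tmk_smul])

@[simp]
theorem tmapR_tmk (f : B →ₗ[R] B') (a : A) (b : B) :
    tmapR R A f (tmk R a b) = tmk R a (f b) :=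
  rfl

@[simp]
theorem tmapL_tmk (g : A →ₗ[Rᵐᵒᵖ] A') (a : A) (b : B) :
    tmapL R g B (tmk R a b) = tmk R (g a) b :=
  rfl

/-- If `A` is an `R`-bimodule, then `A ⊗_R B` is a left `R`-module via `r (a ⊗ b) = (r a) ⊗ b`. -/
instance [Module R A] [SMulCommClass R Rᵐᵒᵖ A] : Module R (Tens R A B) where
  smul r := tmapL R ({ toFun := fun a => r • a
                       map_add' := smul_add r
                       map_smul' := fun s a => smul_comm r s a } : A →ₗ[Rᵐᵒᵖ] A) B
  one_smul z := by
    change tmapL R _ B z = z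
    induction z using tens_induction R with
    | h0 => simp
    | hm a b => simp
    | ha x y hx hy => rw [map_add, hx, hy]
  mul_smul r s z := by
    change tmapL R _ B z = tmapL R _ B (tmapL R _ B z)
    induction z using tens_induction R with
    | h0 => simp
    | hm a b => simp [mul_smul]
    | ha x y hx hy => rw [map_add, hx, hy, map_add, map_add]
  smul_zero r := map_zero _
  smul_add r x y := map_add _ x y
  add_smul r s z := by
    change tmapL R _ B z = tmapL R _ B z + tmapL R _ B z
    induction z using tens_induction R with
    | h0 => simp
    | hm a b => simp [add_smul]
    | ha x y hx hy => rw [map_add, hx, hy, map_add, map_add]; abel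
  zero_smul z := by
    change tmapL R _ B z = 0
    induction z using tens_induction R with
    | h0 => simp
    | hm a b => simp
    | ha x y hx hy => rw [map_add, hx, hy, add_zero]

theorem smul_tmk [Module R A] [SMulCommClass R Rᵐᵒᵖ A] (r : R) (a : A) (b : B) :
    r • tmk R a b = tmk R (r • a) b :=
  rfl

/-- If `B` is an `R`-bimodule, then `A ⊗_R B` is a right `R`-module via `(a ⊗ b) r = a ⊗ (b r)`. -/
@[reducible]
def tensRightModule [Module Rᵐᵒᵖ B] [SMulCommClass R Rᵐᵒᵖ B] : Module Rᵐᵒᵖ (Tens R A B) where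
  smul r := tmapR R A ({ toFun := fun b => r • b
                         map_add' := smul_add r
                         map_smul' := fun s b => (smul_comm s r b).symm } : B →ₗ[R] B)
  one_smul z := by
    change tmapR R A _ z = z
    induction z using tens_induction R with
    | h0 => simp
    | hm a b => simp
    | ha x y hx hy => rw [map_add, hx, hy]
  mul_smul r s z := by
    change tmapR R A _ z = tmapR R A _ (tmapR R A _ z)
    induction z using tens_induction R with
    | h0 => simp
    | hm a b => simp [mul_smul]
    | ha x y hx hy => rw [map_add, hx, hy, map_add, map_add]
  smul_zero r := map_zero _
  smul_add r x y := map_add _ x y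
  add_smul r s z := by
    change tmapR R A _ z = tmapR R A _ z + tmapR R A _ z
    induction z using tens_induction R with
    | h0 => simp
    | hm a b => simp [add_smul]
    | ha x y hx hy => rw [map_add, hx, hy, map_add, map_add]; abel
  zero_smul z := by
    change tmapR R A _ z = 0
    induction z using tens_induction R with
    | h0 => simp
    | hm a b => simp
    | ha x y hx hy => rw [map_add, hx, hy, add_zero]

/-- The functor `A ⊗_R -` from left `R`-modules to abelian groups. -/
def tensFunctor (A : Type u) [AddCommGroup A] [Module Rᵐᵒᵖ A] :
    ModuleCat.{u} R ⥤ AddCommGrpCat.{u} where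
  obj B := AddCommGrpCat.of (Tens R A B)
  map f := AddCommGrpCat.ofHom (tmapR R A f.hom)
  map_id B := by
    ext1
    exact tens_hom_ext R (fun a b => rfl)
  map_comp f g := by
    ext1
    exact tens_hom_ext R (fun a b => rfl)

instance (A : Type u) [AddCommGroup A] [Module Rᵐᵒᵖ A] : (tensFunctor R A).Additive where
  map_add {X Y f g} := by
    ext1
    exact tens_hom_ext R (fun a b => map_add (tmk R a) (f.hom b) (g.hom b))

/-- `Tor_n^R(A, B)`, the `n`-th left derived functor of `A ⊗_R -` at `B`. -/
def Tor (A B : Type u) [AddCommGroup A] [Module Rᵐᵒᵖ A] [AddCommGroup B] [Module R B] (n : ℕ) :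
    AddCommGrpCat.{u} :=
  ((tensFunctor R A).leftDerived n).obj (ModuleCat.of R B)

end Tensor

/-! ### Homological notions -/

section Homological

/-- The left `R`-module `B` is flat: `- ⊗_R B` preserves injections. -/
def IsFlatL (R : Type u) [Ring R] (B : Type u) [AddCommGroup B] [Module R B] : Prop :=
  ∀ (A A' : Type u) [AddCommGroup A] [Module Rᵐᵒᵖ A] [AddCommGroup A'] [Module Rᵐᵒᵖ A']
    (g : A →ₗ[Rᵐᵒᵖ] A'), Function.Injective g → Function.Injective (tmapL R g B)

/-- The right `R`-module `A` is flat: `A ⊗_R -` preserves injections. -/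
def IsFlatR (R : Type u) [Ring R] (A : Type u) [AddCommGroup A] [Module Rᵐᵒᵖ A] : Prop :=
  ∀ (B B' : Type u) [AddCommGroup B] [Module R B] [AddCommGroup B'] [Module R B']
    (f : B →ₗ[R] B'), Function.Injective f → Function.Injective (tmapR R A f)

/-- `X` has a flat resolution `0 → F_n → ⋯ → F_0 → X → 0` by left `R`-modules. -/
def FlatDimLEL (R : Type u) [Ring R] : ℕ → ∀ (X : Type u) [AddCommGroup X] [Module R X], Prop
  | 0, X, _, _ => IsFlatL R X
  | n + 1, X, _, _ => ∃ (F : Type u) (_ : AddCommGroup F) (_ : Module R F) (f : F →ₗ[R] X),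
      IsFlatL R F ∧ Function.Surjective f ∧ FlatDimLEL R n (LinearMap.ker f)

/-- `X` has a flat resolution `0 → F_n → ⋯ → F_0 → X → 0` by right `R`-modules. -/
def FlatDimLER (R : Type u) [Ring R] : ℕ → ∀ (X : Type u) [AddCommGroup X] [Module Rᵐᵒᵖ X], Prop
  | 0, X, _, _ => IsFlatR R X
  | n + 1, X, _, _ => ∃ (F : Type u) (_ : AddCommGroup F) (_ : Module Rᵐᵒᵖ F) (f : F →ₗ[Rᵐᵒᵖ] X),
      IsFlatR R F ∧ Function.Surjective f ∧ FlatDimLER R n (LinearMap.ker f)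

/-- `R` is right coherent: every finitely generated right ideal is finitely presented. -/
def IsRightCoherent (R : Type u) [Ring R] : Prop :=
  ∀ I : Submodule Rᵐᵒᵖ R, I.FG → Module.FinitePresentation Rᵐᵒᵖ I

variable (S : Type u) [Ring S]

/-- A sequence `⋯ → P⁻¹ → P⁰ → P¹ → ⋯` of `S`-modules indexed by `ℤ`. -/
structure Seq where
  X : ℤ → Type u
  [grp : ∀ n, AddCommGroup (X n)]
  [mod : ∀ n, Module S (X n)]
  d : ∀ n, X n →ₗ[S] X (n + 1)

attribute [instance] Seq.grp Seq.mod

variable {S}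

/-- The sequence is an exact complex. -/
def Seq.IsExact (P : Seq S) : Prop :=
  ∀ n, Function.Exact (P.d n) (P.d (n + 1))

/-- An exact sequence of projective modules that stays exact under `Hom(-, Q)` for every
projective module `Q`. -/
def Seq.IsCompleteProjective (P : Seq S) : Prop :=
  P.IsExact ∧ (∀ n, Module.Projective S (P.X n)) ∧
    ∀ (Q : Type u) [AddCommGroup Q] [Module S Q], Module.Projective S Q → ∀ n,
      Function.Exact (fun f : P.X (n + 1 + 1) →ₗ[S] Q => f ∘ₗ P.d (n + 1))
        (fun f : P.X (n + 1) →ₗ[S] Q => f ∘ₗ P.d n)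

/-- An exact sequence of injective modules that stays exact under `Hom(E, -)` for every
injective module `E`. -/
def Seq.IsCompleteInjective (I : Seq S) : Prop :=
  I.IsExact ∧ (∀ n, Module.Injective S (I.X n)) ∧
    ∀ (E : Type u) [AddCommGroup E] [Module S E], Module.Injective S E → ∀ n,
      Function.Exact (fun f : E →ₗ[S] I.X n => I.d n ∘ₗ f)
        (fun f : E →ₗ[S] I.X (n + 1) => I.d (n + 1) ∘ₗ f)

/-- An exact sequence of flat modules that stays exact under `E ⊗_S -` for every injective right
module `E`. -/
def Seq.IsCompleteFlat (F : Seq S) : Prop :=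
  F.IsExact ∧ (∀ n, IsFlatL S (F.X n)) ∧
    ∀ (E : Type u) [AddCommGroup E] [Module Sᵐᵒᵖ E], Module.Injective Sᵐᵒᵖ E → ∀ n,
      Function.Exact (tmapR S E (F.d n)) (tmapR S E (F.d (n + 1)))

variable (S)

/-- Gorenstein projective modules. -/
def GP (X : Type u) [AddCommGroup X] [Module S X] : Prop :=
  ∃ P : Seq S, P.IsCompleteProjective ∧ Nonempty (X ≃ₗ[S] LinearMap.ker (P.d 0))

/-- Gorenstein injective modules. -/
def GI (X : Type u) [AddCommGroup X] [Module S X] : Prop :=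
  ∃ I : Seq S, I.IsCompleteInjective ∧ Nonempty (X ≃ₗ[S] LinearMap.ker (I.d 0))

/-- Gorenstein flat modules. -/
def GF (X : Type u) [AddCommGroup X] [Module S X] : Prop :=
  ∃ F : Seq S, F.IsCompleteFlat ∧ Nonempty (X ≃ₗ[S] LinearMap.ker (F.d 0))

end Homological

/-! ### Tensor powers of a bimodule -/

/-- A bundled `R`-bimodule. -/
structure Bim (R : Type u) [Ring R] where
  carrier : Type u
  [grp : AddCommGroup carrier]
  [left : Module R carrier]
  [right : Module Rᵐᵒᵖ carrier]
  [comm : SMulCommClass R Rᵐᵒᵖ carrier]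

attribute [instance] Bim.grp Bim.left Bim.right Bim.comm

section TensorRing

variable (R : Type u) [Ring R] (M : Type u) [AddCommGroup M] [Module R M] [Module Rᵐᵒᵖ M]
  [SMulCommClass R Rᵐᵒᵖ M]

/-- The bimodule `M ⊗_R B`. -/
def Bim.tensor (B : Bim R) : Bim R :=
  letI : Module Rᵐᵒᵖ (Tens R M B.carrier) := tensRightModule R
  { carrier := Tens R M B.carrier
    comm := ⟨fun r s z => by
      induction z using tens_induction R with
      | h0 => simp
      | hm a b => rfl
      | ha x y hx hy => rw [smul_add, smul_add, smul_add, smul_add, hx, hy]⟩ }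

/-- The bimodule `M^{⊗ i}`: `M^{⊗ 0} = R` and `M^{⊗ (i+1)} = M ⊗_R M^{⊗ i}`. -/
def bimPow : ℕ → Bim R
  | 0 => { carrier := R }
  | i + 1 => Bim.tensor R M (bimPow i)

/-- The underlying type of `M^{⊗ i}`. -/
abbrev TPow (i : ℕ) : Type u := (bimPow R M i).carrier

/-- `M` is `N`-nilpotent: `M^{⊗ (N+1)} = 0`. -/
def IsNilpotentBim (N : ℕ) : Prop := Subsingleton (TPow R M (N + 1))

/-- The condition `Tor_n^R(M, M^{⊗ i} ⊗_R P) = 0` for all `n, i ≥ 1` and all projective `P`. -/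
def CondT : Prop :=
  ∀ (P : Type u) [AddCommGroup P] [Module R P], Module.Projective R P → ∀ i n : ℕ, 1 ≤ i → 1 ≤ n →
    Limits.IsZero (Tor R M (Tens R (TPow R M i) P) n)

variable {R M}

/-- The map `m ⊗ s ↦ m ⊗ s` with values in `M^{⊗ (i+1)}`. -/
def consMap (i : ℕ) : M →+ TPow R M i →+ TPow R M (i + 1) :=
  tmk (A := M) (B := TPow R M i) R

/-- An element of `R`, regarded as an element of `M^{⊗ 0} = R`. -/
def toPow (r : R) : TPow R M 0 := r

theorem pow_succ_induction (i : ℕ) {p : TPow R M (i + 1) → Prop} (z : TPow R M (i + 1)) (h0 : p 0)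
    (hm : ∀ m s, p (consMap i m s)) (ha : ∀ x y, p x → p y → p (x + y)) : p z :=
  tens_induction R (A := M) (B := TPow R M i) (p := p) z h0 hm ha

theorem consMap_smul (i : ℕ) (r : R) (m : M) (s : TPow R M i) :
    consMap i (op r • m) s = consMap i m (r • s) :=
  tmk_smul R r m s

theorem smul_consMap (i : ℕ) (r : R) (m : M) (s : TPow R M i) :
    r • consMap i m s = consMap i (r • m) s :=
  rfl

/-- Given an `R`-linear `u : M ⊗_R X → X`, the maps `M^{⊗ i} → End_ℤ(X)` with `r ↦ (x ↦ r x)` for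
`i = 0` and `m ⊗ s ↦ (x ↦ u (m ⊗ s x))`. -/
def powAct {X : Type u} [AddCommGroup X] [Module R X] (u : Tens R M X →ₗ[R] X) :
    ∀ i, TPow R M i →ₗ[R] (X →+ X)
  | 0 => (show R →ₗ[R] (X →+ X) from
      { toFun := fun r => DistribSMul.toAddMonoidHom X r
        map_add' := fun r s => by ext x; simp [add_smul]
        map_smul' := fun r s => by ext x; simp [mul_smul] })
  | i + 1 => (show Tens R M (TPow R M i) →ₗ[R] (X →+ X) from
      let f : Tens R M (TPow R M i) →+ (X →+ X) := tlift R
        (AddMonoidHom.mk' (fun m => AddMonoidHom.mk'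
            (fun s => (u.toAddMonoidHom.comp (tmk R m)).comp (powAct u i s))
            (fun s t => by ext x; simp))
          (fun m m' => by ext s x; simp))
        (fun r m s => by ext x; simp [tmk_smul])
      { f with
        map_smul' := fun r z => by
          change f (r • z) = r • f z
          induction z using tens_induction R with
          | h0 => simp
          | hm m s =>
            ext x
            change u (tmk R (r • m) (powAct u i s x)) = r • u (tmk R m (powAct u i s x))
            rw [← smul_tmk, map_smul]
          | ha x y hx hy => rw [smul_add, map_add, map_add, hx, hy, smul_add] })

theorem powAct_cons {X : Type u} [AddCommGroup X] [Module R X] (u : Tens R M X →ₗ[R] X) (i : ℕ)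
    (m : M) (s : TPow R M i) (x : X) :
    powAct u (i + 1) (consMap i m s) x = u (tmk R m (powAct u i s x)) :=
  rfl

theorem powAct_zero {X : Type u} [AddCommGroup X] [Module R X] (u : Tens R M X →ₗ[R] X) (r : R)
    (x : X) : powAct u 0 (toPow r) x = r • x :=
  rfl

variable (R M)

/-- The tensor ring `T_R(M) = ⨁ M^{⊗ i}`. -/
def TensorRing : Type u := DirectSum ℕ (fun i => TPow R M i)

namespace TensorRing

instance : AddCommGroup (TensorRing R M) :=
  inferInstanceAs (AddCommGroup (DirectSum ℕ (fun i => TPow R M i)))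

instance : Module R (TensorRing R M) :=
  inferInstanceAs (Module R (DirectSum ℕ (fun i => TPow R M i)))

variable {R M}

/-- The inclusion of the summand `M^{⊗ i}`. -/
def of (i : ℕ) : TPow R M i →ₗ[R] TensorRing R M :=
  DirectSum.lof R ℕ (fun i => TPow R M i) i

/-- Additive maps out of the direct sum. -/
def fold {C : Type u} [AddCommGroup C] (f : ∀ i, TPow R M i →+ C) : TensorRing R M →+ C :=
  DirectSum.toAddMonoid f

@[simp]
theorem fold_of {C : Type u} [AddCommGroup C] (f : ∀ i, TPow R M i →+ C) (i : ℕ)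
    (s : TPow R M i) : fold f (of i s) = f i s :=
  DirectSum.toAddMonoid_of f i s

theorem induction_on {p : TensorRing R M → Prop} (x : TensorRing R M) (h0 : p 0)
    (hof : ∀ i s, p (of i s)) (ha : ∀ x y, p x → p y → p (x + y)) : p x :=
  DirectSum.induction_on x h0 hof ha

variable (R M) in
/-- Multiplication from the left by elements of `M`: the map `M ⊗_R T_R(M) → T_R(M)` that
identifies `M ⊗_R M^{⊗ i}` with `M^{⊗ (i+1)}`. -/
def leftMul : Tens R M (TensorRing R M) →ₗ[R] TensorRing R M :=
  let f : Tens R M (TensorRing R M) →+ TensorRing R M := tlift R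
    (AddMonoidHom.mk' (fun m => fold fun i => (of (i + 1)).toAddMonoidHom.comp (consMap i m))
      (fun m m' => by
        ext x
        induction x using induction_on with
        | h0 => simp
        | hof i s => simp
        | ha x y hx hy => rw [map_add, hx, hy, map_add]))
    (fun r m x => by
      induction x using induction_on with
      | h0 => simp
      | hof i s =>
        rw [← map_smul]
        simp only [AddMonoidHom.mk'_apply, fold_of]
        exact congrArg (of (i + 1)) (tmk_smul R r m s)
      | ha x y hx hy => rw [map_add, hx, hy, smul_add, map_add])
  { f with
    map_smul' := fun r z => by
      change f (r • z) = r • f z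
      induction z using tens_induction R with
      | h0 => simp
      | hm m x =>
        rw [smul_tmk]
        induction x using induction_on with
        | h0 => simp
        | hof i s =>
          simp only [f, tlift_tmk, AddMonoidHom.mk'_apply, fold_of]
          exact map_smul (of (i + 1)) r (consMap i m s)
        | ha x y hx hy => rw [map_add, map_add, hx, hy, map_add, map_add, smul_add]
      | ha x y hx hy => rw [smul_add, map_add, map_add, hx, hy, smul_add] }

theorem leftMul_of (m : M) (i : ℕ) (s : TPow R M i) :
    leftMul R M (tmk R m (of i s)) = of (i + 1) (consMap i m s) :=
  fold_of (fun i => (of (i + 1)).toAddMonoidHom.comp (consMap i m)) i s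

/-- The map `T_R(M) → End_ℤ(X)` determined by an `R`-linear map `u : M ⊗_R X → X`. -/
def act {X : Type u} [AddCommGroup X] [Module R X] (u : Tens R M X →ₗ[R] X) :
    TensorRing R M →+ (X →+ X) :=
  fold fun i => (powAct u i).toAddMonoidHom

theorem act_of {X : Type u} [AddCommGroup X] [Module R X] (u : Tens R M X →ₗ[R] X) (i : ℕ)
    (s : TPow R M i) : act u (of i s) = powAct u i s :=
  fold_of _ i s

theorem act_smul {X : Type u} [AddCommGroup X] [Module R X] (u : Tens R M X →ₗ[R] X) (r : R)
    (t : TensorRing R M) : act u (r • t) = r • act u t := by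
  induction t using induction_on with
  | h0 => simp
  | hof i s => rw [← map_smul, act_of, act_of, map_smul]
  | ha x y hx hy => rw [smul_add, map_add, map_add, hx, hy, smul_add]

theorem act_leftMul {X : Type u} [AddCommGroup X] [Module R X] (u : Tens R M X →ₗ[R] X) (m : M)
    (t : TensorRing R M) (x : X) :
    act u (leftMul R M (tmk R m t)) x = u (tmk R m (act u t x)) := by
  induction t using induction_on with
  | h0 => simp
  | hof i s => rw [leftMul_of, act_of, act_of, powAct_cons]
  | ha a b ha hb => simp only [map_add, AddMonoidHom.add_apply, ha, hb]

theorem act_act {X : Type u} [AddCommGroup X] [Module R X] (u : Tens R M X →ₗ[R] X)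
    (s t : TensorRing R M) (x : X) :
    act u (act (leftMul R M) s t) x = act u s (act u t x) := by
  induction s using induction_on with
  | h0 => simp
  | ha a b ha hb => simp only [map_add, AddMonoidHom.add_apply, ha, hb]
  | hof i s =>
    rw [act_of, act_of]
    induction i with
    | zero =>
      change act u ((show R from s) • t) x = (show R from s) • act u t x
      rw [act_smul]; rfl
    | succ i ih =>
      induction s using pow_succ_induction i with
      | h0 => simp
      | hm m s => rw [powAct_cons, powAct_cons, act_leftMul, ih]
      | ha a b ha hb => simp only [map_add, AddMonoidHom.add_apply, ha, hb]

/-- The inclusion `R → T_R(M)` as the degree `0` summand. -/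
def ofBase (r : R) : TensorRing R M := of 0 (toPow r)

/-- The inclusion `M → T_R(M)`, `m ↦ m ⊗ 1`, into the degree `1` summand. -/
def ofM (m : M) : TensorRing R M := of 1 (consMap 0 m (toPow 1))

theorem act_ofBase {X : Type u} [AddCommGroup X] [Module R X] (u : Tens R M X →ₗ[R] X) (r : R)
    (x : X) : act u (ofBase r) x = r • x := by
  rw [ofBase, act_of, powAct_zero]

theorem act_ofM {X : Type u} [AddCommGroup X] [Module R X] (u : Tens R M X →ₗ[R] X) (m : M)
    (x : X) : act u (ofM m) x = u (tmk R m x) := by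
  rw [ofM, act_of, powAct_cons, powAct_zero, one_smul]

theorem smul_ofBase (r s : R) : r • ofBase (M := M) s = ofBase (r * s) :=
  ((of 0).map_smul r (toPow s)).symm

theorem act_one_right (t : TensorRing R M) : act (leftMul R M) t (ofBase 1) = t := by
  induction t using induction_on with
  | h0 => simp
  | ha a b ha hb => simp only [map_add, AddMonoidHom.add_apply, ha, hb]
  | hof i s =>
    rw [act_of]
    induction i with
    | zero =>
      change (show R from s) • ofBase (M := M) 1 = ofBase (show R from s)
      rw [smul_ofBase, mul_one]
    | succ i ih =>
      induction s using pow_succ_induction i with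
      | h0 => simp
      | hm m s => rw [powAct_cons, ih, leftMul_of]
      | ha a b ha hb => simp only [map_add, AddMonoidHom.add_apply, ha, hb]

/-- The multiplication of `T_R(M)` is concatenation of tensors: `r * t = r t` for `r ∈ R` and
`(m ⊗ s) * t = m ⊗ (s * t)`. -/
instance : Ring (TensorRing R M) where
  mul s t := act (leftMul R M) s t
  one := ofBase 1
  left_distrib a b c := map_add (act (leftMul R M) a) b c
  right_distrib a b c := by
    change act (leftMul R M) (a + b) c = act (leftMul R M) a c + act (leftMul R M) b c
    rw [map_add]; rfl
  zero_mul a := by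
    change act (leftMul R M) 0 a = 0
    rw [map_zero]; rfl
  mul_zero a := map_zero (act (leftMul R M) a)
  mul_assoc a b c := act_act (leftMul R M) a b c
  one_mul a := by
    change act (leftMul R M) (ofBase 1) a = a
    rw [act_ofBase, one_smul]
  mul_one a := act_one_right a
  neg_add_cancel := neg_add_cancel
  zsmul := (· • ·)
  zsmul_zero' := SubNegMonoid.zsmul_zero'
  zsmul_succ' := SubNegMonoid.zsmul_succ'
  zsmul_neg' := SubNegMonoid.zsmul_neg'
  nsmul := (· • ·)
  nsmul_zero := AddMonoid.nsmul_zero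
  nsmul_succ := AddMonoid.nsmul_succ
  sub_eq_add_neg := sub_eq_add_neg

theorem mul_def (s t : TensorRing R M) : s * t = act (leftMul R M) s t := rfl

theorem ofM_mul (m : M) (t : TensorRing R M) : ofM m * t = leftMul R M (tmk R m t) :=
  act_ofM (leftMul R M) m t

theorem ofBase_mul (r : R) (t : TensorRing R M) : ofBase r * t = r • t :=
  act_ofBase (leftMul R M) r t

theorem ofM_add (m m' : M) : ofM (R := R) (m + m') = ofM m + ofM m' := by
  simp [ofM]

theorem ofM_mul_ofBase (m : M) (r : R) : ofM m * ofBase r = ofM (op r • m) := by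
  rw [ofM_mul, ofBase, leftMul_of, ofM, consMap_smul]
  exact congrArg (fun s => of 1 (consMap 0 m (toPow s))) (mul_one r).symm

theorem ofBase_mul_ofM (r : R) (m : M) : ofBase r * ofM m = ofM (r • m) := by
  rw [ofBase_mul, ofM, ofM, ← map_smul, smul_consMap]

theorem of_consMap (i : ℕ) (m : M) (s : TPow R M i) : of (i + 1) (consMap i m s) = ofM m * of i s := by
  rw [ofM_mul, leftMul_of]

variable (R M) in
/-- The inclusion `R → T_R(M)` as a ring homomorphism. -/
def baseHom : R →+* TensorRing R M where
  toFun := ofBase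
  map_one' := rfl
  map_mul' r s := by rw [ofBase_mul, smul_ofBase]
  map_zero' := map_zero (of (R := R) (M := M) 0)
  map_add' r s := map_add (of (R := R) (M := M) 0) (toPow r) (toPow s)

theorem induction_mul {p : TensorRing R M → Prop} (t : TensorRing R M) (hb : ∀ r, p (ofBase r))
    (hm : ∀ m t, p t → p (ofM m * t)) (ha : ∀ x y, p x → p y → p (x + y)) : p t := by
  have h0 : p 0 := by
    have h := hb 0
    rwa [show ofBase (M := M) (0 : R) = 0 from map_zero (baseHom R M)] at h
  induction t using induction_on with
  | h0 => exact h0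
  | ha a b h h' => exact ha a b h h'
  | hof i s =>
    induction i with
    | zero => exact hb s
    | succ i ih =>
      induction s using pow_succ_induction i with
      | h0 => rw [map_zero]; exact h0
      | hm m s => rw [of_consMap]; exact hm m _ (ih s)
      | ha a b h h' => rw [map_add]; exact ha _ _ h h'

end TensorRing

/-! ### Left modules over the tensor ring as pairs -/

/-- A pair `(X, u)`: a left `R`-module `X` with an `R`-linear map `u : M ⊗_R X → X`. -/
structure LPair where
  X : Type u
  [grp : AddCommGroup X]
  [mod : Module R X]
  u : Tens R M X →ₗ[R] X

attribute [instance] LPair.grp LPair.mod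

variable {R M}

/-- The left `T_R(M)`-module `(X, u)`; its underlying group is that of `X`. -/
def LPair.Mod (p : LPair R M) : Type u := p.X

instance (p : LPair R M) : AddCommGroup p.Mod := inferInstanceAs (AddCommGroup p.X)

/-- `T_R(M)` acts on `(X, u)` by `r · x = r x` and `(m ⊗ s) · x = u (m ⊗ (s · x))`. -/
instance (p : LPair R M) : Module (TensorRing R M) p.Mod where
  smul t x := TensorRing.act p.u t x
  one_smul x := (TensorRing.act_ofBase p.u 1 x).trans (one_smul R (show p.X from x))
  mul_smul s t x := TensorRing.act_act p.u s t x
  smul_zero t := map_zero (TensorRing.act p.u t)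
  smul_add t x y := map_add (TensorRing.act p.u t) x y
  add_smul s t x := by
    change TensorRing.act p.u (s + t) x = TensorRing.act p.u s x + TensorRing.act p.u t x
    rw [map_add]; rfl
  zero_smul x := by
    change TensorRing.act p.u 0 x = 0
    rw [map_zero]; rfl

/-- Every left `T_R(M)`-module is given by a pair. -/
theorem exists_lpair (X : Type u) [AddCommGroup X] [Module (TensorRing R M) X] :
    ∃ p : LPair R M, Nonempty (p.Mod ≃ₗ[TensorRing R M] X) := by
  let _ : Module R X := Module.compHom X (TensorRing.baseHom R M)
  have hb : ∀ (r : R) (x : X), r • x = TensorRing.ofBase (M := M) r • x := fun _ _ => rfl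
  let f : Tens R M X →+ X := tlift R
    (AddMonoidHom.mk' (fun m => DistribSMul.toAddMonoidHom X (TensorRing.ofM (R := R) m))
      (fun m m' => by ext x; simp [TensorRing.ofM_add, add_smul]))
    (fun r m x => by
      change TensorRing.ofM (R := R) (op r • m) • x = TensorRing.ofM (R := R) m • r • x
      rw [hb, smul_smul, TensorRing.ofM_mul_ofBase])
  let p : LPair R M :=
    { X := X
      u := { f with
        map_smul' := fun r z => by
          change f (r • z) = r • f z
          induction z using tens_induction R with
          | h0 => simp
          | hm m x =>
            change TensorRing.ofM (R := R) (r • m) • x = r • TensorRing.ofM (R := R) m • x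
            rw [hb, smul_smul, TensorRing.ofBase_mul_ofM]
          | ha x y hx hy => rw [smul_add, map_add, map_add, hx, hy, smul_add] } }
  have h : ∀ (t : TensorRing R M) (x : X), TensorRing.act p.u t x = t • x := by
    intro t
    induction t using TensorRing.induction_mul with
    | hb r => exact fun x => TensorRing.act_ofBase p.u r x
    | hm m t ih =>
      intro x
      rw [TensorRing.ofM_mul, TensorRing.act_leftMul, ih, ← TensorRing.ofM_mul, mul_smul]
      rfl
    | ha a b ha hb =>
      intro x
      rw [map_add, AddMonoidHom.add_apply, ha, hb, add_smul]
  exact ⟨p, ⟨{ AddEquiv.refl X with map_smul' := fun t x => h t x }⟩⟩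

/-- `Φ(𝒳)`: the pairs `(X, u)` with `u` a monomorphism and `coker u` in `𝒳`. -/
def Phi (𝒳 : ∀ (X : Type u) [AddCommGroup X] [Module R X], Prop) : Set (LPair R M) :=
  {p | Function.Injective p.u ∧ 𝒳 (p.X ⧸ LinearMap.range p.u)}

/-! ### Right modules over the tensor ring as pairs -/

variable (R M)

/-- `Hom_{Rᵒᵖ}(M, Y)` as a right `R`-module via `(f r)(m) = f (r m)`. -/
def HomR (Y : Type u) [AddCommGroup Y] [Module Rᵐᵒᵖ Y] : Type u := M →ₗ[Rᵐᵒᵖ] Y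

instance (Y : Type u) [AddCommGroup Y] [Module Rᵐᵒᵖ Y] : AddCommGroup (HomR R M Y) :=
  inferInstanceAs (AddCommGroup (M →ₗ[Rᵐᵒᵖ] Y))

variable {R M} in
/-- The value of `f ∈ Hom_{Rᵒᵖ}(M, Y)` at `m`. -/
def HomR.app {Y : Type u} [AddCommGroup Y] [Module Rᵐᵒᵖ Y] (f : HomR R M Y) : M →ₗ[Rᵐᵒᵖ] Y := f

instance (Y : Type u) [AddCommGroup Y] [Module Rᵐᵒᵖ Y] : Module Rᵐᵒᵖ (HomR R M Y) where
  smul r f := (show M →ₗ[Rᵐᵒᵖ] Y from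
    { toFun := fun m => f.app (r.unop • m)
      map_add' := fun m m' => by rw [smul_add, map_add]
      map_smul' := fun s m => by rw [smul_comm, map_smul]; rfl })
  one_smul f := LinearMap.ext fun m => congrArg f.app (one_smul R m)
  mul_smul r s f := LinearMap.ext fun m => congrArg f.app (mul_smul s.unop r.unop m)
  smul_zero r := rfl
  smul_add r f g := rfl
  add_smul r s f := LinearMap.ext fun m =>
    (congrArg f.app (add_smul r.unop s.unop m)).trans (map_add f.app _ _)
  zero_smul f := LinearMap.ext fun m =>
    (congrArg f.app (zero_smul R m)).trans (map_zero f.app)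

/-- A pair `[Y, v]`: a right `R`-module `Y` with a right `R`-linear map
`v : Y → Hom_{Rᵒᵖ}(M, Y)`. -/
structure RPair where
  Y : Type u
  [grp : AddCommGroup Y]
  [mod : Module Rᵐᵒᵖ Y]
  v : Y →ₗ[Rᵐᵒᵖ] HomR R M Y

attribute [instance] RPair.grp RPair.mod

variable {R M}

namespace RPair

variable (p : RPair R M)

/-- The biadditive map `(m, y) ↦ v(y)(m)`. -/
def ev : M →+ p.Y →+ p.Y :=
  AddMonoidHom.mk' (fun m => AddMonoidHom.mk' (fun y => (p.v y).app m)
      (fun y y' => by rw [map_add]; rfl))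
    (fun m m' => by ext y; exact map_add (p.v y).app m m')

theorem ev_smul_right (r : R) (m : M) (y : p.Y) : p.ev (op r • m) y = op r • p.ev m y :=
  map_smul (p.v y).app (op r) m

theorem ev_smul_left (r : R) (m : M) (y : p.Y) : p.ev (r • m) y = p.ev m (op r • y) := by
  change (p.v y).app (r • m) = (p.v (op r • y)).app m
  rw [p.v.map_smul]; rfl

/-- The maps `M^{⊗ i} → End_ℤ(Y)` with `r ↦ (y ↦ y r)` for `i = 0` and
`m ⊗ s ↦ (y ↦ v(y)(m) · s)`. -/
def powAct : ∀ i, {f : TPow R M i →+ (p.Y →+ p.Y) // ∀ (r : R) s y, f (r • s) y = f s (op r • y)}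
  | 0 => ⟨(show R →+ (p.Y →+ p.Y) from
      AddMonoidHom.mk' (fun r => DistribSMul.toAddMonoidHom p.Y (op r))
        (fun r s => by ext y; simp [add_smul])),
      fun r (s : R) y => by
        change op (r * s) • y = op s • op r • y
        rw [op_mul, mul_smul]⟩
  | i + 1 =>
      let g := powAct i
      let f : Tens R M (TPow R M i) →+ (p.Y →+ p.Y) := tlift R
        (AddMonoidHom.mk' (fun m => AddMonoidHom.mk' (fun s => (g.1 s).comp (p.ev m))
            (fun s t => by ext y; simp))
          (fun m m' => by ext s y; simp))
        (fun r m s => by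
          ext y
          change g.1 s (p.ev (op r • m) y) = g.1 (r • s) (p.ev m y)
          rw [g.2, ev_smul_right])
      ⟨f, fun r z y => by
        change f (r • (show Tens R M (TPow R M i) from z)) y = f z (op r • y)
        induction z using tens_induction R (A := M) (B := TPow R M i) with
        | h0 => rw [smul_zero, map_zero]; rfl
        | hm m s =>
          change g.1 s (p.ev (r • m) y) = g.1 s (p.ev m (op r • y))
          rw [ev_smul_left]
        | ha a b ha hb =>
          rw [smul_add, map_add, map_add, AddMonoidHom.add_apply, AddMonoidHom.add_apply, ha, hb]⟩

/-- The map `T_R(M) → End_ℤ(Y)`, `t ↦ (y ↦ y · t)`, determined by `v`. -/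
def act : TensorRing R M →+ (p.Y →+ p.Y) :=
  TensorRing.fold fun i => (p.powAct i).1

theorem act_of (i : ℕ) (s : TPow R M i) : p.act (TensorRing.of i s) = (p.powAct i).1 s :=
  TensorRing.fold_of _ i s

theorem act_smul (r : R) (t : TensorRing R M) (y : p.Y) :
    p.act (r • t) y = p.act t (op r • y) := by
  induction t using TensorRing.induction_on with
  | h0 => simp
  | hof i s => rw [← map_smul, act_of, act_of, (p.powAct i).2]
  | ha a b ha hb => simp only [smul_add, map_add, AddMonoidHom.add_apply, ha, hb]

theorem act_leftMul (m : M) (t : TensorRing R M) (y : p.Y) :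
    p.act (TensorRing.leftMul R M (tmk R m t)) y = p.act t (p.ev m y) := by
  induction t using TensorRing.induction_on with
  | h0 => simp
  | hof i s => rw [TensorRing.leftMul_of, act_of, act_of]; rfl
  | ha a b ha hb => simp only [map_add, AddMonoidHom.add_apply, ha, hb]

theorem act_mul (s t : TensorRing R M) (y : p.Y) : p.act (s * t) y = p.act t (p.act s y) := by
  rw [TensorRing.mul_def]
  induction s using TensorRing.induction_on generalizing y with
  | h0 => simp
  | ha a b ha hb => simp only [map_add, AddMonoidHom.add_apply, ha, hb]
  | hof i s =>
    rw [TensorRing.act_of, act_of]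
    induction i generalizing y with
    | zero => exact p.act_smul (show R from s) t y
    | succ i ih =>
      induction s using pow_succ_induction i with
      | h0 => simp
      | hm m s =>
        rw [TR.powAct_cons, act_leftMul, ih]; rfl
      | ha a b ha hb => simp only [map_add, AddMonoidHom.add_apply, ha, hb]

theorem act_ofBase (r : R) (y : p.Y) : p.act (TensorRing.ofBase r) y = op r • y := by
  rw [TensorRing.ofBase, act_of]; rfl

theorem act_ofM (m : M) (y : p.Y) : p.act (TensorRing.ofM m) y = (p.v y).app m := by
  rw [TensorRing.ofM, act_of]
  change op (1 : R) • (p.v y).app m = _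
  rw [op_one, one_smul]

/-- The right `T_R(M)`-module `[Y, v]`; its underlying group is that of `Y`. -/
def Mod : Type u := p.Y

instance : AddCommGroup p.Mod := inferInstanceAs (AddCommGroup p.Y)

/-- `T_R(M)` acts on `[Y, v]` by `y · r = y r` and `y · (m ⊗ s) = v(y)(m) · s`. -/
instance : Module (TensorRing R M)ᵐᵒᵖ p.Mod where
  smul t y := p.act t.unop y
  one_smul y := (p.act_ofBase 1 y).trans (one_smul Rᵐᵒᵖ (show p.Y from y))
  mul_smul s t y := p.act_mul t.unop s.unop y
  smul_zero t := map_zero (p.act t.unop)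
  smul_add t x y := map_add (p.act t.unop) x y
  add_smul s t x := by
    change p.act (s.unop + t.unop) x = p.act s.unop x + p.act t.unop x
    rw [map_add]; rfl
  zero_smul x := by
    change p.act 0 x = 0
    rw [map_zero]; rfl

/-- Every right `T_R(M)`-module is given by a pair. -/
theorem exists_rpair (Y : Type u) [AddCommGroup Y] [Module (TensorRing R M)ᵐᵒᵖ Y] :
    ∃ p : RPair R M, Nonempty (p.Mod ≃ₗ[(TensorRing R M)ᵐᵒᵖ] Y) := by
  let _ : Module Rᵐᵒᵖ Y := Module.compHom Y (TensorRing.baseHom R M).op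
  have hb : ∀ (r : R) (y : Y), op r • y = op (TensorRing.ofBase (M := M) r) • y := fun _ _ => rfl
  let v (y : Y) : M →ₗ[Rᵐᵒᵖ] Y :=
    { toFun := fun m => op (TensorRing.ofM (R := R) m) • y
      map_add' := fun m m' => by rw [TensorRing.ofM_add, MulOpposite.op_add, add_smul]
      map_smul' := fun r m => by
        obtain ⟨r, rfl⟩ := op_surjective r
        rw [RingHom.id_apply, hb, smul_smul, ← op_mul, TensorRing.ofM_mul_ofBase] }
  let p : RPair R M :=
    { Y := Y
      v :=
        { toFun := v
          map_add' := fun y y' => LinearMap.ext fun m => smul_add (op (TensorRing.ofM (R := R) m)) y y'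
          map_smul' := fun r y => LinearMap.ext fun m => by
            obtain ⟨r, rfl⟩ := op_surjective r
            change op (TensorRing.ofM (R := R) m) • op r • y = op (TensorRing.ofM (R := R) (r • m)) • y
            rw [hb, smul_smul, ← op_mul, TensorRing.ofBase_mul_ofM] } }
  have h : ∀ (t : TensorRing R M) (y : Y), p.act t y = op t • y := by
    intro t
    induction t using TensorRing.induction_mul with
    | hb r => exact fun y => p.act_ofBase r y
    | hm m t ih =>
      intro y
      rw [TensorRing.ofM_mul, act_leftMul, ih, ← TensorRing.ofM_mul, op_mul, mul_smul]
      rfl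
    | ha a b ha hb =>
      intro y
      rw [map_add, AddMonoidHom.add_apply, ha, hb, MulOpposite.op_add, add_smul]
  exact ⟨p, ⟨{ AddEquiv.refl Y with map_smul' := fun t y => h t.unop y }⟩⟩

end RPair

/-- `Ψ(𝒴)`: the pairs `[Y, v]` with `v` an epimorphism and `ker v` in `𝒴`. -/
def Psi (𝒴 : ∀ (Y : Type u) [AddCommGroup Y] [Module Rᵐᵒᵖ Y], Prop) : Set (RPair R M) :=
  {p | Function.Surjective p.v ∧ 𝒴 (LinearMap.ker p.v)}

end TensorRing

end TR

end

noncomputable section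

namespace TR

/-! ### Vanishing of `Ext` for modules -/

section Ext

/-! Write T for the tensor ring, and let (W, 0) be an R-module on which M acts as zero. Maps (X, u)
→ (W, 0) are maps coker u → W. If u is injective and Tor_n(M, X) = 0 for n ≥ 1, a presentation of
(X, u) by induced modules T ⊗ L induces an exact sequence of cokernels, so Ext_T((X, u), (W, 0)) and
Ext_R(coker u, W) vanish in the same positive degrees (`LPair.ev_triv_iff`). If u is injective and
coker u is acyclic for all powers of M, nilpotency gives (X, u) a finite filtration with layers
(M^{⊗i} ⊗ coker u, 0) (`LPair.ev_of_filtration`). Conversely (W, 0) is the quotient of T ⊗ W by T ⊗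
(M ⊗ W) for suitably acyclic W (`LPair.tens_ind_equiv`). These facts move vanishing of Ext between R
and T.

Complete resolutions are not transported. By `gor_iff`, a module has one exactly when it belongs to
a class whose members satisfy the required Ext vanishing and embed in an allowed module with
cokernel in the class; the left half of the complex comes from free covers. So only single steps
must be carried over.

From R to T: embed coker u in a projective H. The obstruction to lifting this to (X, u) → T ⊗ H lies
in Ext^1(coker u, M^{⊗(i+1)} ⊗ H), which vanishes because these modules have finite projective
dimension. The lift is injective by a Nakayama-type induction, and its cokernel is again of the same
kind (`LPair.exists_embedding`, `LPair.gor_of_cokernel`). From T to R: finite flat dimension of M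
gives vanishing in high degrees, and shifting along the coresolution brings it down to Ext^1((X, u),
(V, 0)) = 0 for injective V, which forces u to be injective, and to Tor_n(M, X) = 0; then cokernels
of the actions give a coresolution over R (`LPair.cokernel_of_gor`).

Tor is handled throughout as Ext into character modules A⁺ = Hom(A, ℚ/ℤ). Gorenstein flat modules
thus fit the same scheme, tested against characters of injective right modules (`gf_iff`). There the
embedding into a flat F is replaced by one into F⁺⁺, flat by coherence; finite presentation of M
gives M ⊗ F⁺⁺ ≅ (M ⊗ F)⁺⁺, which kills the obstruction.

The injective case is dual, with Hom(M, -) for M ⊗ - and ker v for coker u. Every injective right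
module is a summand of L⁺ with L projective, so the characters of T ⊗ L serve as coinduced modules,
and much of the left-hand theory is reused through duality. -/

/-- `0 → A → B → C → 0` is a short exact sequence of modules. -/
structure IsSES {S : Type u} [Ring S] {A B C : Type u} [AddCommGroup A] [Module S A]
    [AddCommGroup B] [Module S B] [AddCommGroup C] [Module S C] (f : A →ₗ[S] B) (g : B →ₗ[S] C) :
    Prop where
  inj : Function.Injective f
  exact : Function.Exact f g
  surj : Function.Surjective g

/-- `Ext^n_S(X, Y) = 0`. -/
def EV (S : Type u) [Ring S] (n : ℕ) (X Y : Type u) [AddCommGroup X] [Module S X]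
    [AddCommGroup Y] [Module S Y] : Prop :=
  Subsingleton (Abelian.Ext (ModuleCat.of S X) (ModuleCat.of S Y) n)

variable {S : Type u} [Ring S] {A B C X Y : Type u} [AddCommGroup A] [Module S A]
  [AddCommGroup B] [Module S B] [AddCommGroup C] [Module S C] [AddCommGroup X] [Module S X]
  [AddCommGroup Y] [Module S Y] {f : A →ₗ[S] B} {g : B →ₗ[S] C}

theorem IsSES.comp_eq_zero (h : IsSES f g) : g ∘ₗ f = 0 :=
  h.exact.linearMap_comp_eq_zero

/-- The short complex in `ModuleCat S` given by a short exact sequence. -/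
abbrev IsSES.cpx (h : IsSES f g) : ShortComplex (ModuleCat.{u} S) :=
  ShortComplex.mk (ModuleCat.ofHom f) (ModuleCat.ofHom g) (by
    rw [← ModuleCat.ofHom_comp, h.comp_eq_zero]; rfl)

theorem IsSES.shortExact (h : IsSES f g) : h.cpx.ShortExact where
  exact := (ShortComplex.ShortExact.moduleCat_exact_iff_function_exact _).2 h.exact
  mono_f := (ModuleCat.mono_iff_injective _).2 h.inj
  epi_g := (ModuleCat.epi_iff_surjective _).2 h.surj

open Abelian

/-- This lemma and the five that follow each read off one place of a long exact sequence. `fst` or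
`snd` names the varying argument of `Ext`; `left`, `mid` or `right` names the term of the short
exact sequence in the conclusion. -/
theorem EV.fst_mid (h : IsSES f g) {n : ℕ} (h1 : EV S n A Y) (h3 : EV S n C Y) : EV S n B Y := by
  refine subsingleton_of_forall_eq 0 fun x => ?_
  obtain ⟨y, rfl⟩ := Ext.contravariant_sequence_exact₂ h.shortExact _ x (h1.elim _ _)
  rw [h3.elim y 0, Ext.comp_zero]

theorem EV.fst_left (h : IsSES f g) {n : ℕ} (h2 : EV S n B Y) (h3 : EV S (n + 1) C Y) :
    EV S n A Y := by
  refine subsingleton_of_forall_eq 0 fun x => ?_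
  obtain ⟨y, rfl⟩ := Ext.contravariant_sequence_exact₁ h.shortExact _ x (add_comm 1 n) (h3.elim _ _)
  rw [h2.elim y 0, Ext.comp_zero]

theorem EV.fst_right (h : IsSES f g) {n : ℕ} (h1 : EV S n A Y) (h2 : EV S (n + 1) B Y) :
    EV S (n + 1) C Y := by
  refine subsingleton_of_forall_eq 0 fun x => ?_
  obtain ⟨y, rfl⟩ := Ext.contravariant_sequence_exact₃ h.shortExact _ x (h2.elim _ _) (add_comm 1 n)
  rw [h1.elim y 0, Ext.comp_zero]

theorem EV.snd_mid (h : IsSES f g) {n : ℕ} (h1 : EV S n X A) (h3 : EV S n X C) : EV S n X B := by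
  refine subsingleton_of_forall_eq 0 fun x => ?_
  obtain ⟨y, rfl⟩ := Ext.covariant_sequence_exact₂ _ h.shortExact x (h3.elim _ _)
  rw [h1.elim y 0, Ext.zero_comp]

theorem EV.snd_right (h : IsSES f g) {n : ℕ} (h2 : EV S n X B) (h1 : EV S (n + 1) X A) :
    EV S n X C := by
  refine subsingleton_of_forall_eq 0 fun x => ?_
  obtain ⟨y, rfl⟩ := Ext.covariant_sequence_exact₃ _ h.shortExact x rfl (h1.elim _ _)
  rw [h2.elim y 0, Ext.zero_comp]

theorem EV.snd_left (h : IsSES f g) {n : ℕ} (h3 : EV S n X C) (h2 : EV S (n + 1) X B) :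
    EV S (n + 1) X A := by
  refine subsingleton_of_forall_eq 0 fun x => ?_
  obtain ⟨y, rfl⟩ := Ext.covariant_sequence_exact₁ _ h.shortExact x (h2.elim _ _) rfl
  rw [h3.elim y 0, Ext.zero_comp]

theorem EV.extend (h : IsSES f g) (h3 : EV S 1 C Y) (φ : A →ₗ[S] Y) :
    ∃ ψ : B →ₗ[S] Y, ψ ∘ₗ f = φ := by
  obtain ⟨y, hy⟩ := Ext.contravariant_sequence_exact₁ h.shortExact (ModuleCat.of S Y)
    (Ext.mk₀ (ModuleCat.ofHom φ)) rfl (h3.elim _ _)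
  obtain ⟨ψ, rfl⟩ := (Ext.mk₀_bijective _ _).2 y
  rw [Ext.mk₀_comp_mk₀] at hy
  exact ⟨ψ.hom, congrArg ModuleCat.Hom.hom ((Ext.mk₀_bijective _ _).1 hy)⟩

theorem EV.lift (h : IsSES f g) (h1 : EV S 1 X A) (φ : X →ₗ[S] C) :
    ∃ ψ : X →ₗ[S] B, g ∘ₗ ψ = φ := by
  obtain ⟨y, hy⟩ := Ext.covariant_sequence_exact₃ (ModuleCat.of S X) h.shortExact
    (Ext.mk₀ (ModuleCat.ofHom φ)) rfl (h1.elim _ _)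
  obtain ⟨ψ, rfl⟩ := (Ext.mk₀_bijective _ _).2 y
  rw [Ext.mk₀_comp_mk₀] at hy
  exact ⟨ψ.hom, congrArg ModuleCat.Hom.hom ((Ext.mk₀_bijective _ _).1 hy)⟩

/-- A class in Ext^1(C, Y) is the image of some φ : A → Y under the connecting map, and the image of
a map that extends over B is zero. Together with `EV.extend` this turns vanishing of Ext^1 into an
extension problem, which adjunctions can carry elsewhere. -/
theorem EV.of_extend (h : IsSES f g) (h2 : EV S 1 B Y)
    (he : ∀ φ : A →ₗ[S] Y, ∃ ψ : B →ₗ[S] Y, ψ ∘ₗ f = φ) : EV S 1 C Y := by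
  refine subsingleton_of_forall_eq 0 fun x => ?_
  obtain ⟨y, rfl⟩ := Ext.contravariant_sequence_exact₃ h.shortExact _ x (h2.elim _ _) (add_comm 1 0)
  obtain ⟨φ, rfl⟩ := (Ext.mk₀_bijective _ _).2 y
  obtain ⟨ψ, hψ⟩ := he φ.hom
  have : φ = h.cpx.f ≫ ModuleCat.ofHom ψ := by ext1; exact hψ.symm
  rw [this, ← Ext.mk₀_comp_mk₀, ← Ext.comp_assoc_of_second_deg_zero, h.shortExact.extClass_comp,
    Ext.zero_comp]

theorem EV.of_lift (h : IsSES f g) (h2 : EV S 1 X B)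
    (he : ∀ φ : X →ₗ[S] C, ∃ ψ : X →ₗ[S] B, g ∘ₗ ψ = φ) : EV S 1 X A := by
  refine subsingleton_of_forall_eq 0 fun x => ?_
  obtain ⟨y, rfl⟩ := Ext.covariant_sequence_exact₁ _ h.shortExact x (h2.elim _ _) (zero_add 1)
  obtain ⟨φ, rfl⟩ := (Ext.mk₀_bijective _ _).2 y
  obtain ⟨ψ, hψ⟩ := he φ.hom
  have : φ = ModuleCat.ofHom ψ ≫ h.cpx.g := by ext1; exact hψ.symm
  rw [this, ← Ext.mk₀_comp_mk₀, Ext.comp_assoc_of_second_deg_zero, h.shortExact.comp_extClass,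
    Ext.comp_zero]

theorem EV.of_projective (hX : Module.Projective S X) (n : ℕ) : EV S (n + 1) X Y :=
  have : Projective (ModuleCat.of S X) := (IsProjective.iff_projective X).1 inferInstance
  Ext.subsingleton_of_projective _ _ n

theorem EV.of_injective (hY : Module.Injective S Y) (n : ℕ) : EV S (n + 1) X Y :=
  have : Injective (ModuleCat.of S Y) := (Module.injective_iff_injective_object S Y).1 hY
  Ext.subsingleton_of_injective _ _ n

/-- `X` is a direct summand of `Y`. -/
def IsRetract (S : Type u) [Ring S] (X Y : Type u) [AddCommGroup X] [Module S X]
    [AddCommGroup Y] [Module S Y] : Prop :=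
  ∃ (i : X →ₗ[S] Y) (r : Y →ₗ[S] X), r ∘ₗ i = LinearMap.id

theorem _root_.LinearEquiv.isRetract (e : X ≃ₗ[S] Y) : IsRetract S X Y :=
  ⟨e, e.symm, by ext; simp⟩

theorem EV.retract_fst (h : IsRetract S A B) {n : ℕ} (hB : EV S n B Y) : EV S n A Y := by
  obtain ⟨i, r, hr⟩ := h
  refine subsingleton_of_forall_eq 0 fun x => ?_
  have : ModuleCat.ofHom i ≫ ModuleCat.ofHom r = 𝟙 _ := by rw [← ModuleCat.ofHom_comp, hr]; rfl
  rw [← x.mk₀_id_comp, ← this, ← Ext.mk₀_comp_mk₀, Ext.comp_assoc_of_second_deg_zero,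
    hB.elim ((Ext.mk₀ _).comp x (zero_add n)) 0, Ext.comp_zero]

theorem EV.retract_snd (h : IsRetract S A B) {n : ℕ} (hB : EV S n X B) : EV S n X A := by
  obtain ⟨i, r, hr⟩ := h
  refine subsingleton_of_forall_eq 0 fun x => ?_
  have : ModuleCat.ofHom i ≫ ModuleCat.ofHom r = 𝟙 _ := by rw [← ModuleCat.ofHom_comp, hr]; rfl
  rw [← x.comp_mk₀_id, ← this, ← Ext.mk₀_comp_mk₀, ← Ext.comp_assoc_of_second_deg_zero,
    hB.elim (x.comp (Ext.mk₀ _) (add_zero n)) 0, Ext.zero_comp]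

theorem EV.of_subsingleton_fst [Subsingleton X] (n : ℕ) : EV S n X Y := by
  refine subsingleton_of_forall_eq 0 fun x => ?_
  have : 𝟙 (ModuleCat.of S X) = 0 := by ext x; exact Subsingleton.elim (α := X) _ _
  rw [← x.mk₀_id_comp, this, Ext.mk₀_zero, Ext.zero_comp]

theorem EV.of_subsingleton_snd [Subsingleton Y] (n : ℕ) : EV S n X Y := by
  refine subsingleton_of_forall_eq 0 fun x => ?_
  have : 𝟙 (ModuleCat.of S Y) = 0 := by ext x; exact Subsingleton.elim (α := Y) _ _
  rw [← x.comp_mk₀_id, this, Ext.mk₀_zero, Ext.comp_zero]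

theorem exists_ev_of_projectiveDimension_lt_top
    (h : projectiveDimension (ModuleCat.of S X) < ⊤) :
    ∃ k : ℕ, ∀ n, k < n → ∀ (Y : Type u) [AddCommGroup Y] [Module S Y], EV S n X Y := by
  obtain ⟨k, hk⟩ := (projectiveDimension_ne_top_iff _).1 h.ne
  exact ⟨k, fun n hn Y _ _ => HasProjectiveDimensionLT.subsingleton _ (k + 1) n hn _⟩

theorem exists_surjective_finsupp (S : Type u) [Ring S] (X : Type u) [AddCommGroup X]
    [Module S X] : ∃ g : (X →₀ S) →ₗ[S] X, Function.Surjective g :=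
  ⟨Finsupp.linearCombination S id, fun x => ⟨Finsupp.single x 1, by simp⟩⟩

theorem IsSES.ker (hg : Function.Surjective g) : IsSES (LinearMap.ker g).subtype g where
  inj := Subtype.val_injective
  exact := LinearMap.exact_subtype_ker_map _
  surj := hg

theorem IsSES.coker (hf : Function.Injective f) : IsSES f (LinearMap.range f).mkQ where
  inj := hf
  exact := LinearMap.exact_map_mkQ_range f
  surj := Submodule.mkQ_surjective _

end Ext

/-! ### Gorenstein modules by dimension shifting -/

section Chain

theorem exists_int_chain {α : Type*} {p : α → Prop} {r : α → α → Prop}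
    (next : ∀ a, p a → ∃ b, p b ∧ r a b) (prev : ∀ a, p a → ∃ b, p b ∧ r b a) (a : α) (ha : p a) :
    ∃ Z : ℤ → α, Z 0 = a ∧ (∀ n, p (Z n)) ∧ ∀ n, r (Z n) (Z (n + 1)) := by
  choose! nx hnx using next
  choose! pv hpv using prev
  have hf : ∀ k, p (nx^[k] a) := fun k => by
    induction k with
    | zero => exact ha
    | succ k ih => rw [Function.iterate_succ_apply']; exact (hnx _ ih).1
  have hg : ∀ k, p (pv^[k] a) := fun k => by
    induction k with
    | zero => exact ha
    | succ k ih => rw [Function.iterate_succ_apply']; exact (hpv _ ih).1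
  let Z : ℤ → α
    | Int.ofNat k => nx^[k] a
    | Int.negSucc k => pv^[k + 1] a
  refine ⟨Z, rfl, ?_, ?_⟩
  · rintro (k | k)
    · exact hf k
    · exact hg (k + 1)
  · rintro (k | k)
    · change r (nx^[k] a) (nx^[k + 1] a)
      rw [Function.iterate_succ_apply']
      exact (hnx _ (hf k)).2
    -- `Int.negSucc k` is -(k+1), so its successor carries the k-th backward iterate; for k = 0 this
    -- is `a`, where the two half-chains meet.
    · have : Z (Int.negSucc k + 1) = pv^[k] a := by cases k <;> rfl
      rw [this]
      change r (pv^[k + 1] a) _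
      rw [Function.iterate_succ_apply']
      exact (hpv _ (hg k)).2

end Chain

/-! ### Relative Gorenstein classes and complete resolutions -/

section Gor

variable (S : Type u) [Ring S]

/-- The members `X` of a class in which every module `G` satisfies `Ext^n(G, W) = 0` for `n ≥ 1`
and `W ∈ 𝒲`, and embeds into a member of `𝒬` with cokernel in the class. -/
def Gor (𝒬 𝒲 : ∀ (X : Type u) [AddCommGroup X] [Module S X], Prop) (X : Type u) [AddCommGroup X]
    [Module S X] : Prop :=
  ∃ 𝒢 : ∀ (X : Type u) [AddCommGroup X] [Module S X], Prop, 𝒢 X ∧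
    ∀ (G : Type u) [AddCommGroup G] [Module S G], 𝒢 G →
      (∀ (W : Type u) [AddCommGroup W] [Module S W], 𝒲 W → ∀ n, EV S (n + 1) G W) ∧
      ∃ (P : Type u) (_ : AddCommGroup P) (_ : Module S P) (G' : Type u) (_ : AddCommGroup G')
        (_ : Module S G') (f : G →ₗ[S] P) (g : P →ₗ[S] G'), IsSES f g ∧ 𝒬 P ∧ 𝒢 G'

/-- The members `X` of a class in which every module `G` satisfies `Ext^n(E, G) = 0` for `n ≥ 1`
and `E` injective, and is a quotient of an injective module with kernel in the class. -/
def GorI (X : Type u) [AddCommGroup X] [Module S X] : Prop :=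
  ∃ 𝒢 : ∀ (X : Type u) [AddCommGroup X] [Module S X], Prop, 𝒢 X ∧
    ∀ (G : Type u) [AddCommGroup G] [Module S G], 𝒢 G →
      (∀ (W : Type u) [AddCommGroup W] [Module S W], Module.Injective S W → ∀ n,
        EV S (n + 1) W G) ∧
      ∃ (P : Type u) (_ : AddCommGroup P) (_ : Module S P) (G' : Type u) (_ : AddCommGroup G')
        (_ : Module S G') (f : G' →ₗ[S] P) (g : P →ₗ[S] G), IsSES f g ∧ Module.Injective S P ∧ 𝒢 G'

variable {S} {𝒬 𝒲 : ∀ (X : Type u) [AddCommGroup X] [Module S X], Prop}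
  {X Y Z : Type u} [AddCommGroup X] [Module S X] [AddCommGroup Y] [Module S Y]
  [AddCommGroup Z] [Module S Z]

theorem Gor.ev (h : Gor S 𝒬 𝒲 X) (hY : 𝒲 Y) (n : ℕ) : EV S (n + 1) X Y :=
  let ⟨_, hX, h⟩ := h
  (h X hX).1 Y hY n

theorem Gor.step (h : Gor S 𝒬 𝒲 X) :
    ∃ (P : Type u) (_ : AddCommGroup P) (_ : Module S P) (G' : Type u) (_ : AddCommGroup G')
      (_ : Module S G') (f : X →ₗ[S] P) (g : P →ₗ[S] G'), IsSES f g ∧ 𝒬 P ∧ Gor S 𝒬 𝒲 G' :=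
  let ⟨𝒢, hX, h⟩ := h
  let ⟨P, i1, i2, G', i3, i4, f, g, hs, hP, hG⟩ := (h X hX).2
  ⟨P, i1, i2, G', i3, i4, f, g, hs, hP, 𝒢, hG, h⟩

/-- Coinduction: `Gor` is the largest class closed under its own step, so one step into it suffices.
The witness is the class of all modules satisfying a single unfolding. -/
theorem Gor.intro {f : X →ₗ[S] Y} {g : Y →ₗ[S] Z} (hs : IsSES f g)
    (hX : ∀ (W : Type u) [AddCommGroup W] [Module S W], 𝒲 W → ∀ n, EV S (n + 1) X W)
    (hY : 𝒬 Y) (hZ : Gor S 𝒬 𝒲 Z) : Gor S 𝒬 𝒲 X := by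
  refine ⟨fun G _ _ => (∀ (W : Type u) [AddCommGroup W] [Module S W], 𝒲 W → ∀ n,
      EV S (n + 1) G W) ∧ ∃ (P : Type u) (_ : AddCommGroup P) (_ : Module S P) (G' : Type u)
        (_ : AddCommGroup G') (_ : Module S G') (f : G →ₗ[S] P) (g : P →ₗ[S] G'),
        IsSES f g ∧ 𝒬 P ∧ Gor S 𝒬 𝒲 G',
    ⟨hX, Y, _, _, Z, _, _, f, g, hs, hY, hZ⟩, ?_⟩
  rintro G _ _ ⟨h1, P, i1, i2, G', i3, i4, f, g, hs, hP, hG⟩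
  exact ⟨h1, P, i1, i2, G', i3, i4, f, g, hs, hP, fun W _ _ hW n => hG.ev hW n, hG.step⟩

theorem IsSES.congr_left {X' : Type u} [AddCommGroup X'] [Module S X'] {f : X →ₗ[S] Y}
    {g : Y →ₗ[S] Z} (hs : IsSES f g) (e : X' ≃ₗ[S] X) :
    IsSES (f ∘ₗ (e : X' →ₗ[S] X)) g where
  inj := hs.inj.comp e.injective
  exact y := by
    rw [hs.exact y]
    exact ⟨fun ⟨x, hx⟩ => ⟨e.symm x, by simpa using hx⟩, fun ⟨x, hx⟩ => ⟨e x, hx⟩⟩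
  surj := hs.surj

theorem IsSES.congr_right {Z' : Type u} [AddCommGroup Z'] [Module S Z'] {f : X →ₗ[S] Y}
    {g : Y →ₗ[S] Z} (hs : IsSES f g) (e : Z ≃ₗ[S] Z') :
    IsSES f ((e : Z →ₗ[S] Z') ∘ₗ g) where
  inj := hs.inj
  exact y := by
    rw [← hs.exact y]
    exact e.map_eq_zero_iff
  surj := e.surjective.comp hs.surj

theorem Gor.congr (h : Gor S 𝒬 𝒲 X) (e : Y ≃ₗ[S] X) : Gor S 𝒬 𝒲 Y := by
  obtain ⟨P, _, _, G', _, _, f, g, hs, hP, hG⟩ := h.step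
  exact Gor.intro (hs.congr_left e) (fun W _ _ hW n => (h.ev hW n).retract_fst e.isRetract) hP hG

/-- Supplies the left half of a complete resolution: the vanishing for `X` is that for `Z` shifted
by one, since `Y` is already orthogonal to `𝒲`. -/
theorem Gor.syzygy {f : X →ₗ[S] Y} {g : Y →ₗ[S] Z} (hs : IsSES f g) (hY : 𝒬 Y)
    (hYW : ∀ (W : Type u) [AddCommGroup W] [Module S W], 𝒲 W → ∀ n, EV S (n + 1) Y W)
    (hZ : Gor S 𝒬 𝒲 Z) : Gor S 𝒬 𝒲 X :=
  Gor.intro hs (fun W _ _ hW n => EV.fst_left hs (hYW W hW n) (hZ.ev hW (n + 1))) hY hZ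

/-- An exact sequence of members of `𝒬` that stays exact under `Hom(-, W)` for `W ∈ 𝒲`. -/
def Seq.IsComplete (P : Seq S) (𝒬 𝒲 : ∀ (X : Type u) [AddCommGroup X] [Module S X], Prop) : Prop :=
  P.IsExact ∧ (∀ n, 𝒬 (P.X n)) ∧
    ∀ (Q : Type u) [AddCommGroup Q] [Module S Q], 𝒲 Q → ∀ n,
      Function.Exact (fun f : P.X (n + 1 + 1) →ₗ[S] Q => f ∘ₗ P.d (n + 1))
        (fun f : P.X (n + 1) →ₗ[S] Q => f ∘ₗ P.d n)

/-- The differential with values in the cycles. -/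
def Seq.toKer (P : Seq S) (h : P.IsExact) (n : ℤ) : P.X n →ₗ[S] LinearMap.ker (P.d (n + 1)) :=
  (P.d n).codRestrict _ fun x => (h n).apply_apply_eq_zero x

theorem Seq.ses (P : Seq S) (h : P.IsExact) (n : ℤ) :
    IsSES (LinearMap.ker (P.d n)).subtype (P.toKer h n) where
  inj := Subtype.val_injective
  exact x := by
    exact ⟨fun hx => ⟨⟨x, congrArg Subtype.val hx⟩, rfl⟩, fun ⟨y, hy⟩ => hy ▸ Subtype.ext y.2⟩
  surj := by
    rintro ⟨x, hx⟩
    obtain ⟨y, rfl⟩ := (h n x).1 hx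
    exact ⟨y, rfl⟩

theorem Seq.IsComplete.ev {P : Seq S} (h : P.IsComplete 𝒬 𝒲)
    (hPW : ∀ (P : Type u) [AddCommGroup P] [Module S P] (W : Type u) [AddCommGroup W] [Module S W],
      𝒬 P → 𝒲 W → ∀ n, EV S (n + 1) P W)
    {W : Type u} [AddCommGroup W] [Module S W] (hW : 𝒲 W) (k : ℕ) (n : ℤ) :
    EV S (k + 1) (LinearMap.ker (P.d n)) W := by
  obtain ⟨hex, hP, hhom⟩ := h
  induction k generalizing n with
  | zero =>
    -- Exactness of Hom at position j+1 extends maps out of ker d_{j+2}, and P_{j+2} modulo that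
    -- kernel is ker d_{j+3}; hence the shift by three.
    obtain ⟨j, rfl⟩ : ∃ j, n = j + 1 + 1 + 1 := ⟨n - 3, by ring⟩
    refine EV.of_extend (P.ses hex (j + 1 + 1)) (hPW _ _ (hP _) hW 0) fun φ => ?_
    obtain ⟨ψ, hψ⟩ := (hhom W hW j (φ ∘ₗ P.toKer hex (j + 1))).1 (by
      ext x
      have : P.toKer hex (j + 1) (P.d j x) = 0 := Subtype.ext ((hex j).apply_apply_eq_zero x)
      simp [this])
    refine ⟨ψ, ?_⟩
    ext x
    obtain ⟨y, rfl⟩ := (P.ses hex (j + 1)).surj x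
    exact LinearMap.congr_fun hψ y
  | succ k ih =>
    obtain ⟨j, rfl⟩ : ∃ j, n = j + 1 := ⟨n - 1, by ring⟩
    exact EV.fst_right (P.ses hex j) (ih j) (hPW _ _ (hP _) hW (k + 1))

/-- The steps of `Gor` build the complex to the right of `X`, free covers build it to the left, and
Hom-exactness is the vanishing of Ext^1 on the cycles. Conversely, the cycles of a complete
resolution form a class of the required kind. -/
theorem gor_iff
    (hPW : ∀ (P : Type u) [AddCommGroup P] [Module S P] (W : Type u) [AddCommGroup W] [Module S W],
      𝒬 P → 𝒲 W → ∀ n, EV S (n + 1) P W)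
    (hproj : ∀ (P : Type u) [AddCommGroup P] [Module S P], Module.Projective S P → 𝒬 P) :
    Gor S 𝒬 𝒲 X ↔ ∃ P : Seq S, P.IsComplete 𝒬 𝒲 ∧ Nonempty (X ≃ₗ[S] LinearMap.ker (P.d 0)) := by
  constructor
  · intro hX
    obtain ⟨Z, hZ0, hZ, hr⟩ := exists_int_chain (α := ModuleCat.{u} S) (p := fun A => Gor S 𝒬 𝒲 A)
      (r := fun A B => ∃ (P : Type u) (_ : AddCommGroup P) (_ : Module S P) (f : A →ₗ[S] P)
        (g : P →ₗ[S] B), IsSES f g ∧ 𝒬 P)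
      (fun A hA => by
        obtain ⟨P, _, _, G', _, _, f, g, hs, hP, hG⟩ := hA.step
        exact ⟨ModuleCat.of S G', hG, P, _, _, f, g, hs, hP⟩)
      (fun A hA => by
        obtain ⟨g, hg⟩ := exists_surjective_finsupp S A
        have hP : 𝒬 (A →₀ S) := hproj _ inferInstance
        exact ⟨ModuleCat.of S (LinearMap.ker g), hA.syzygy (IsSES.ker hg) hP
          (fun W _ _ hW n => hPW _ _ hP hW n), _, _, _, _, g, IsSES.ker hg, hP⟩)
      (ModuleCat.of S X) hX
    choose P i1 i2 f g hs hP using hr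
    -- The n-th short exact sequence is 0 → Z n → P n → Z (n+1) → 0, so the differential is P n → Z
    -- (n+1) → P (n+1).
    let Q : Seq S := { X := P, d := fun n => f (n + 1) ∘ₗ g n }
    refine ⟨Q, ⟨fun n x => ?_, hP, fun W _ _ hW n φ => ⟨fun h => ?_, ?_⟩⟩, ?_⟩
    · change f (n + 1 + 1) (g (n + 1) x) = 0 ↔ ∃ y, f (n + 1) (g n y) = x
      rw [map_eq_zero_iff _ (hs _).inj, (hs (n + 1)).exact x]
      exact ⟨fun ⟨z, hz⟩ => let ⟨y, hy⟩ := (hs n).surj z; ⟨y, by rw [hy, hz]⟩,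
        fun ⟨y, hy⟩ => ⟨_, hy⟩⟩
    · have h1 : ∀ z, φ (f (n + 1) z) = 0 := fun z => by
        obtain ⟨y, rfl⟩ := (hs n).surj z
        exact LinearMap.congr_fun h y
      have h2 : LinearMap.ker (g (n + 1)) ≤ LinearMap.ker φ := fun y hy => by
        obtain ⟨z, rfl⟩ := ((hs (n + 1)).exact y).1 hy
        exact h1 z
      -- `φ` factors through Z (n+2), which embeds in P (n+2) with cokernel Z (n+3); Ext^1 of the
      -- latter vanishes.
      obtain ⟨ψ, hψ⟩ := EV.extend (hs (n + 1 + 1)) ((hZ (n + 1 + 1 + 1)).ev hW 0)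
        ((LinearMap.ker (g (n + 1))).liftQ φ h2 ∘ₗ
          ((g (n + 1)).quotKerEquivOfSurjective (hs (n + 1)).surj).symm.toLinearMap)
      refine ⟨ψ, ?_⟩
      ext y
      refine (LinearMap.congr_fun hψ (g (n + 1) y)).trans ?_
      have : ((g (n + 1)).quotKerEquivOfSurjective (hs (n + 1)).surj).symm (g (n + 1) y) =
        (LinearMap.ker (g (n + 1))).mkQ y := by rw [LinearEquiv.symm_apply_eq]; rfl
      simp [this]
    · rintro ⟨ψ, rfl⟩
      ext x
      change ψ (f (n + 1 + 1) (g (n + 1) (f (n + 1) (g n x)))) = 0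
      rw [(hs (n + 1)).exact.apply_apply_eq_zero, map_zero, map_zero]
    · have e1 : LinearMap.ker (Q.d 0) = LinearMap.range (f 0) := by
        ext x
        change f (0 + 1) (g 0 x) = 0 ↔ _
        rw [map_eq_zero_iff _ (hs _).inj, (hs 0).exact x]
        rfl
      have e2 : Nonempty (X ≃ₗ[S] Z 0) := by rw [hZ0]; exact ⟨LinearEquiv.refl S X⟩
      exact ⟨e2.some ≪≫ₗ LinearEquiv.ofInjective (f 0) (hs 0).inj ≪≫ₗ LinearEquiv.ofEq _ _ e1.symm⟩
  · rintro ⟨P, hP, ⟨e⟩⟩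
    refine Gor.congr ?_ e
    refine ⟨fun G _ _ => ∃ n, Nonempty (G ≃ₗ[S] LinearMap.ker (P.d n)), ⟨0, ⟨LinearEquiv.refl _ _⟩⟩, ?_⟩
    rintro G _ _ ⟨n, ⟨e⟩⟩
    refine ⟨fun W _ _ hW k => (hP.ev hPW hW k n).retract_fst e.isRetract, ?_⟩
    exact ⟨_, _, _, _, _, _, _, _, (P.ses hP.1 n).congr_left e, hP.2.1 n, n + 1, ⟨LinearEquiv.refl _ _⟩⟩

theorem gp_iff : GP S X ↔ Gor S (fun X _ _ => Module.Projective S X)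
    (fun X _ _ => Module.Projective S X) X :=
  (gor_iff (fun _ _ _ _ _ _ hP _ n => EV.of_projective hP n) (fun _ _ _ h => h)).symm

theorem GorI.ev (h : GorI S X) (hY : Module.Injective S Y) (n : ℕ) : EV S (n + 1) Y X :=
  let ⟨_, hX, h⟩ := h
  (h X hX).1 Y hY n

theorem GorI.step (h : GorI S X) :
    ∃ (P : Type u) (_ : AddCommGroup P) (_ : Module S P) (G' : Type u) (_ : AddCommGroup G')
      (_ : Module S G') (f : G' →ₗ[S] P) (g : P →ₗ[S] X),
      IsSES f g ∧ Module.Injective S P ∧ GorI S G' :=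
  let ⟨𝒢, hX, h⟩ := h
  let ⟨P, i1, i2, G', i3, i4, f, g, hs, hP, hG⟩ := (h X hX).2
  ⟨P, i1, i2, G', i3, i4, f, g, hs, hP, 𝒢, hG, h⟩

theorem GorI.intro {f : X →ₗ[S] Y} {g : Y →ₗ[S] Z} (hs : IsSES f g)
    (hZ : ∀ (W : Type u) [AddCommGroup W] [Module S W], Module.Injective S W → ∀ n,
      EV S (n + 1) W Z)
    (hY : Module.Injective S Y) (hX : GorI S X) : GorI S Z := by
  refine ⟨fun G _ _ => (∀ (W : Type u) [AddCommGroup W] [Module S W], Module.Injective S W → ∀ n,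
      EV S (n + 1) W G) ∧ ∃ (P : Type u) (_ : AddCommGroup P) (_ : Module S P) (G' : Type u)
        (_ : AddCommGroup G') (_ : Module S G') (f : G' →ₗ[S] P) (g : P →ₗ[S] G),
        IsSES f g ∧ Module.Injective S P ∧ GorI S G',
    ⟨hZ, Y, _, _, X, _, _, f, g, hs, hY, hX⟩, ?_⟩
  rintro G _ _ ⟨h1, P, i1, i2, G', i3, i4, f, g, hs, hP, hG⟩
  exact ⟨h1, P, i1, i2, G', i3, i4, f, g, hs, hP, fun W _ _ hW n => hG.ev hW n, hG.step⟩

theorem GorI.congr (h : GorI S X) (e : X ≃ₗ[S] Y) : GorI S Y := by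
  obtain ⟨P, _, _, G', _, _, f, g, hs, hP, hG⟩ := h.step
  exact GorI.intro (hs.congr_right e)
    (fun W _ _ hW n => (h.ev hW n).retract_snd e.symm.isRetract) hP hG

theorem GorI.cosyzygy {f : X →ₗ[S] Y} {g : Y →ₗ[S] Z} (hs : IsSES f g)
    (hY : Module.Injective S Y) (hX : GorI S X) : GorI S Z :=
  GorI.intro hs (fun _ _ _ hW n => EV.snd_right hs (EV.of_injective hY n) (hX.ev hW (n + 1))) hY hX

theorem exists_injective_embedding (S : Type u) [Ring S] (X : Type u) [AddCommGroup X]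
    [Module S X] : ∃ (I : Type u) (_ : AddCommGroup I) (_ : Module S I) (f : X →ₗ[S] I),
      Module.Injective S I ∧ Function.Injective f := by
  let J := Injective.under (ModuleCat.of S X)
  refine ⟨J, _, _, (Injective.ι (ModuleCat.of S X)).hom,
    (Module.injective_iff_injective_object S J).2
      (Injective.injective_under (ModuleCat.of S X)),
    (ModuleCat.mono_iff_injective _).1 inferInstance⟩

/-- Hom-exactness lifts a map W → ker d_{n+1} to P_n, which is the case of Ext^1; higher degrees are
reached by moving to the right along the complex. -/
theorem Seq.IsCompleteInjective.ev {P : Seq S} (h : P.IsCompleteInjective)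
    {W : Type u} [AddCommGroup W] [Module S W] (hW : Module.Injective S W) (k : ℕ) (n : ℤ) :
    EV S (k + 1) W (LinearMap.ker (P.d n)) := by
  obtain ⟨hex, hP, hhom⟩ := h
  induction k generalizing n with
  | zero =>
    refine EV.of_lift (P.ses hex n) (EV.of_injective (hP _) 0) fun φ => ?_
    obtain ⟨ψ, hψ⟩ := (hhom W hW n ((LinearMap.ker (P.d (n + 1))).subtype ∘ₗ φ)).1 (by
      ext x
      exact (φ x).2)
    refine ⟨ψ, ?_⟩
    ext x
    exact LinearMap.congr_fun hψ x
  | succ k ih =>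
    exact EV.snd_left (P.ses hex n) (ih (n + 1)) (EV.of_injective (hP _) (k + 1))

/-- Mirror image of `gor_iff`: the steps of `GorI` build the left half, embeddings into injective
modules the right half. -/
theorem gi_iff : GI S X ↔ GorI S X := by
  constructor
  · rintro ⟨P, hP, ⟨e⟩⟩
    refine GorI.congr ?_ e.symm
    refine ⟨fun G _ _ => ∃ n, Nonempty (LinearMap.ker (P.d n) ≃ₗ[S] G), ⟨0, ⟨LinearEquiv.refl _ _⟩⟩, ?_⟩
    rintro G _ _ ⟨n, ⟨e⟩⟩
    obtain ⟨j, rfl⟩ : ∃ j, n = j + 1 := ⟨n - 1, by ring⟩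
    refine ⟨fun W _ _ hW k => (hP.ev hW k _).retract_snd e.symm.isRetract, ?_⟩
    exact ⟨_, _, _, _, _, _, _, _, (P.ses hP.1 j).congr_right e, hP.2.1 j, j, ⟨LinearEquiv.refl _ _⟩⟩
  · intro hX
    obtain ⟨Z, hZ0, hZ, hr⟩ := exists_int_chain (α := ModuleCat.{u} S) (p := fun A => GorI S A)
      (r := fun A B => ∃ (P : Type u) (_ : AddCommGroup P) (_ : Module S P) (f : A →ₗ[S] P)
        (g : P →ₗ[S] B), IsSES f g ∧ Module.Injective S P)
      (fun A hA => by
        obtain ⟨I, _, _, f, hI, hf⟩ := exists_injective_embedding S A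
        exact ⟨ModuleCat.of S _, hA.cosyzygy (IsSES.coker hf) hI, _, _, _, f, _, IsSES.coker hf, hI⟩)
      (fun A hA => by
        obtain ⟨P, _, _, G', _, _, f, g, hs, hP, hG⟩ := hA.step
        exact ⟨ModuleCat.of S G', hG, P, _, _, f, g, hs, hP⟩)
      (ModuleCat.of S X) hX
    choose P i1 i2 f g hs hP using hr
    let Q : Seq S := { X := P, d := fun n => f (n + 1) ∘ₗ g n }
    refine ⟨Q, ⟨fun n x => ?_, hP, fun W _ _ hW n φ => ⟨fun h => ?_, ?_⟩⟩, ?_⟩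
    · change f (n + 1 + 1) (g (n + 1) x) = 0 ↔ ∃ y, f (n + 1) (g n y) = x
      rw [map_eq_zero_iff _ (hs _).inj, (hs (n + 1)).exact x]
      exact ⟨fun ⟨z, hz⟩ => let ⟨y, hy⟩ := (hs n).surj z; ⟨y, by rw [hy, hz]⟩,
        fun ⟨y, hy⟩ => ⟨_, hy⟩⟩
    · have h1 : ∀ x, φ x ∈ LinearMap.range (f (n + 1)) := fun x => by
        refine ((hs (n + 1)).exact _).1 ((hs (n + 1 + 1)).inj ?_)
        rw [map_zero]
        exact LinearMap.congr_fun h x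
      obtain ⟨ψ, hψ⟩ := EV.lift (hs n) ((hZ n).ev hW 0)
        ((LinearEquiv.ofInjective (f (n + 1)) (hs (n + 1)).inj).symm.toLinearMap ∘ₗ
          φ.codRestrict _ h1)
      refine ⟨ψ, ?_⟩
      ext y
      change f (n + 1) (g n (ψ y)) = φ y
      rw [show g n (ψ y) = _ from LinearMap.congr_fun hψ y]
      exact congrArg Subtype.val
        ((LinearEquiv.ofInjective (f (n + 1)) (hs (n + 1)).inj).apply_symm_apply ⟨φ y, h1 y⟩)
    · rintro ⟨ψ, rfl⟩
      ext x
      change f (n + 1 + 1) (g (n + 1) (f (n + 1) (g n (ψ x)))) = 0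
      rw [(hs (n + 1)).exact.apply_apply_eq_zero, map_zero]
    · have e1 : LinearMap.ker (Q.d 0) = LinearMap.range (f 0) := by
        ext x
        change f (0 + 1) (g 0 x) = 0 ↔ _
        rw [map_eq_zero_iff _ (hs _).inj, (hs 0).exact x]
        rfl
      have e2 : Nonempty (X ≃ₗ[S] Z 0) := by rw [hZ0]; exact ⟨LinearEquiv.refl S X⟩
      exact ⟨e2.some ≪≫ₗ LinearEquiv.ofInjective (f 0) (hs 0).inj ≪≫ₗ LinearEquiv.ofEq _ _ e1.symm⟩

end Gor

/-! ### Character modules -/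

section Ch

/-- The character module `Hom_ℤ(A, ℚ/ℤ)`. It is a left module if `A` is a right module, and a right
module if `A` is a left module. -/
def Ch (A : Type u) [AddCommGroup A] : Type u := A →+ AddCircle (1 : ℚ)

section basic

variable (A : Type u) [AddCommGroup A]

instance : AddCommGroup (Ch A) := inferInstanceAs (AddCommGroup (A →+ AddCircle (1 : ℚ)))

instance : FunLike (Ch A) A (AddCircle (1 : ℚ)) :=
  inferInstanceAs (FunLike (A →+ AddCircle (1 : ℚ)) A (AddCircle (1 : ℚ)))

instance : AddMonoidHomClass (Ch A) A (AddCircle (1 : ℚ)) :=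
  inferInstanceAs (AddMonoidHomClass (A →+ AddCircle (1 : ℚ)) A (AddCircle (1 : ℚ)))

variable {A}

@[ext]
theorem Ch.ext {c d : Ch A} (h : ∀ a, c a = d a) : c = d := DFunLike.ext c d h

theorem Ch.exists_ne_zero {a : A} (ha : a ≠ 0) : ∃ c : Ch A, c a ≠ 0 :=
  CharacterModule.exists_character_apply_ne_zero_of_ne_zero ha

theorem Ch.extend {B : Type u} [AddCommGroup B] (f : A →+ B) (hf : Function.Injective f)
    (c : A →+ AddCircle (1 : ℚ)) : ∃ d : B →+ AddCircle (1 : ℚ), d.comp f = c :=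
  (Module.Baer.of_divisible _).extension_property_addMonoidHom _ hf c

theorem Ch.injective_of_extend {B : Type u} [AddCommGroup B] (f : A →+ B)
    (h : ∀ c : A →+ AddCircle (1 : ℚ), ∃ d : B →+ AddCircle (1 : ℚ), d.comp f = c) :
    Function.Injective f := by
  refine (injective_iff_map_eq_zero f).2 fun a ha => ?_
  by_contra hne
  obtain ⟨c, hc⟩ := Ch.exists_ne_zero hne
  obtain ⟨d, hd⟩ := h c
  exact hc ((DFunLike.congr_fun hd a).symm.trans (by simp [ha]))

/-- If b lies in the kernel of g but not in the image of f, a character of the quotient by that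
image is nonzero at b. It kills f, hence factors through g, hence vanishes at b. -/
theorem Ch.exact_of_factor {B C : Type u} [AddCommGroup B] [AddCommGroup C] (f : A →+ B)
    (g : B →+ C) (hgf : g.comp f = 0)
    (h : ∀ c : B →+ AddCircle (1 : ℚ), c.comp f = 0 →
      ∃ d : C →+ AddCircle (1 : ℚ), d.comp g = c) :
    Function.Exact f g := by
  refine fun b => ⟨fun hb => ?_, ?_⟩
  · by_contra hne
    have : (QuotientAddGroup.mk' f.range b) ≠ 0 := fun h =>
      hne ((QuotientAddGroup.eq_zero_iff b).1 h)
    obtain ⟨c, hc⟩ := Ch.exists_ne_zero this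
    obtain ⟨d, hd⟩ := h (AddMonoidHom.comp (show _ →+ AddCircle (1 : ℚ) from c)
      (QuotientAddGroup.mk' f.range)) (by
        ext a
        have : (QuotientAddGroup.mk' f.range (f a)) = 0 :=
          (QuotientAddGroup.eq_zero_iff _).2 ⟨a, rfl⟩
        change c (QuotientAddGroup.mk' f.range (f a)) = 0
        rw [this, map_zero])
    refine hc ((DFunLike.congr_fun hd b).symm.trans ?_)
    rw [AddMonoidHom.comp_apply, hb, map_zero]
  · rintro ⟨a, rfl⟩
    exact DFunLike.congr_fun hgf a

theorem Ch.factor {B C : Type u} [AddCommGroup B] [AddCommGroup C] {f : A →+ B}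
    {g : B →+ C} (h : Function.Exact f g) (hg : Function.Surjective g)
    (c : B →+ AddCircle (1 : ℚ)) (hc : ∀ a, c (f a) = 0) :
    ∃ d : C →+ AddCircle (1 : ℚ), d.comp g = c := by
  refine ⟨AddMonoidHom.liftOfSurjective g hg ⟨c, fun b hb => ?_⟩,
    AddMonoidHom.liftOfRightInverse_comp _ _ _ _⟩
  obtain ⟨a, rfl⟩ := (h b).1 hb
  exact hc a

end basic

variable {R : Type u} [Ring R] {A A' A'' B B' B'' : Type u} [AddCommGroup A] [Module Rᵐᵒᵖ A]
  [AddCommGroup A'] [Module Rᵐᵒᵖ A'] [AddCommGroup A''] [Module Rᵐᵒᵖ A'']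
  [AddCommGroup B] [Module R B] [AddCommGroup B'] [Module R B'] [AddCommGroup B''] [Module R B'']

instance : Module R (Ch A) where
  smul r c := AddMonoidHom.comp (show A →+ _ from c) (DistribSMul.toAddMonoidHom A (op r))
  one_smul c := by ext a; exact congrArg c (one_smul Rᵐᵒᵖ a)
  mul_smul r s c := by ext a; exact congrArg c (mul_smul (op s) (op r) a)
  smul_zero r := rfl
  smul_add r c d := rfl
  add_smul r s c := by
    ext a
    exact (congrArg c (add_smul (op r) (op s) a)).trans (map_add c _ _)
  zero_smul c := by
    ext a
    exact (congrArg c (zero_smul Rᵐᵒᵖ a)).trans (map_zero c)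

instance : Module Rᵐᵒᵖ (Ch B) where
  smul r c := AddMonoidHom.comp (show B →+ _ from c) (DistribSMul.toAddMonoidHom B r.unop)
  one_smul c := by ext a; exact congrArg c (one_smul R a)
  mul_smul r s c := by ext a; exact congrArg c (mul_smul s.unop r.unop a)
  smul_zero r := rfl
  smul_add r c d := rfl
  add_smul r s c := by
    ext a
    exact (congrArg c (add_smul r.unop s.unop a)).trans (map_add c _ _)
  zero_smul c := by
    ext a
    exact (congrArg c (zero_smul R a)).trans (map_zero c)

/-- The left linear map dual to a right linear map. -/
def lCh (f : A →ₗ[Rᵐᵒᵖ] A') : Ch A' →ₗ[R] Ch A where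
  toFun c := AddMonoidHom.comp (show A' →+ _ from c) f.toAddMonoidHom
  map_add' c d := rfl
  map_smul' r c := by ext a; exact congrArg c (map_smul f (op r) a).symm

/-- The right linear map dual to a left linear map. -/
def rCh (f : B →ₗ[R] B') : Ch B' →ₗ[Rᵐᵒᵖ] Ch B where
  toFun c := AddMonoidHom.comp (show B' →+ _ from c) f.toAddMonoidHom
  map_add' c d := rfl
  map_smul' r c := by ext a; exact congrArg c (map_smul f r.unop a).symm

theorem IsSES.lCh {f : A →ₗ[Rᵐᵒᵖ] A'} {g : A' →ₗ[Rᵐᵒᵖ] A''} (h : IsSES f g) :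
    IsSES (lCh g) (lCh f) where
  inj c d hcd := by
    ext x
    obtain ⟨y, rfl⟩ := h.surj x
    exact DFunLike.congr_fun hcd y
  exact c := by
    constructor
    · intro hc
      exact Ch.factor (f := f.toAddMonoidHom) (g := g.toAddMonoidHom) h.exact h.surj c
        (DFunLike.congr_fun hc)
    · rintro ⟨d, rfl⟩
      ext x
      exact (congrArg d (h.exact.apply_apply_eq_zero x)).trans (map_zero d)
  surj c := Ch.extend f.toAddMonoidHom h.inj c

theorem IsSES.rCh {f : B →ₗ[R] B'} {g : B' →ₗ[R] B''} (h : IsSES f g) :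
    IsSES (rCh g) (rCh f) where
  inj c d hcd := by
    ext x
    obtain ⟨y, rfl⟩ := h.surj x
    exact DFunLike.congr_fun hcd y
  exact c := by
    constructor
    · intro hc
      exact Ch.factor (f := f.toAddMonoidHom) (g := g.toAddMonoidHom) h.exact h.surj c
        (DFunLike.congr_fun hc)
    · rintro ⟨d, rfl⟩
      ext x
      exact (congrArg d (h.exact.apply_apply_eq_zero x)).trans (map_zero d)
  surj c := Ch.extend f.toAddMonoidHom h.inj c

/-- The natural map to the double character module. -/
def toBidual : A →ₗ[Rᵐᵒᵖ] Ch (Ch A) where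
  toFun a := AddMonoidHom.mk' (fun c : Ch A => c a) (fun _ _ => rfl)
  map_add' a a' := by ext c; exact map_add c a a'
  map_smul' r a := rfl

theorem toBidual_injective : Function.Injective (toBidual (R := R) (A := A)) := by
  refine (injective_iff_map_eq_zero _).2 fun a ha => ?_
  by_contra hne
  obtain ⟨c, hc⟩ := Ch.exists_ne_zero hne
  exact hc (DFunLike.congr_fun ha c)

/-- Interchanging the arguments of a linear map with values in a character module. -/
def flipR (φ : B →ₗ[R] Ch A) : A →ₗ[Rᵐᵒᵖ] Ch B where
  toFun a := AddMonoidHom.mk' (fun b => φ b a) (fun b b' => by rw [map_add]; rfl)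
  map_add' a a' := by ext b; exact map_add (φ b) a a'
  map_smul' r a := by
    ext b
    change φ b (r • a) = φ (r.unop • b) a
    rw [φ.map_smul]; rfl

/-- Interchanging the arguments of a linear map with values in a character module. -/
def flipL (φ : A →ₗ[Rᵐᵒᵖ] Ch B) : B →ₗ[R] Ch A where
  toFun b := AddMonoidHom.mk' (fun a => φ a b) (fun b b' => by rw [map_add]; rfl)
  map_add' a a' := by ext b; exact map_add (φ b) a a'
  map_smul' r b := by
    ext a
    change φ a (r • b) = φ (op r • a) b
    rw [φ.map_smul]; rfl

/-- The character of `A ⊗_R B` given by a linear map `B → Ch A`. -/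
def tensChar (φ : B →ₗ[R] Ch A) : Tens R A B →+ AddCircle (1 : ℚ) :=
  ((balancer R A B).liftQ (TensorProduct.liftAddHom (R := ℤ)
    (AddMonoidHom.mk' (fun a => (AddMonoidHom.mk' (fun b => φ b a)
        (fun b b' => by rw [map_add]; rfl) : B →+ AddCircle (1 : ℚ)))
      (fun a a' => by ext b; exact map_add (φ b) a a'))
    (fun r a b => by simp; rfl)).toIntLinearMap (by
      rw [balancer, Submodule.span_le]
      rintro _ ⟨a, r, b, rfl⟩
      refine LinearMap.mem_ker.2 ?_
      rw [map_sub, sub_eq_zero]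
      change φ b (op r • a) = φ (r • b) a
      rw [φ.map_smul]; rfl)).toAddMonoidHom

/-- The linear map `B → Ch A` given by a character of `A ⊗_R B`. -/
def charTens (c : Tens R A B →+ AddCircle (1 : ℚ)) : B →ₗ[R] Ch A where
  toFun b := AddMonoidHom.mk' (fun a => c (tmk R a b)) (fun a a' => by simp)
  map_add' b b' := by ext a; exact (congrArg c (map_add (tmk R a) b b')).trans (map_add c _ _)
  map_smul' r b := by ext a; exact congrArg c (tmk_smul R r a b).symm

theorem tens_char_ext {c d : Tens R A B →+ AddCircle (1 : ℚ)}
    (h : ∀ a b, c (tmk R a b) = d (tmk R a b)) : c = d := by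
  ext z
  induction z using tens_induction R with
  | h0 => simp
  | hm a b => exact h a b
  | ha x y hx hy => rw [map_add, map_add, hx, hy]

/-- Characters of A ⊗ B are linear maps B → Ch A, and ℚ/ℤ is an injective cogenerator. In this way
statements about tensor products become statements about maps into character modules. -/
theorem tmapR_injective_iff (f : B →ₗ[R] B') : Function.Injective (tmapR R A f) ↔
    ∀ φ : B →ₗ[R] Ch A, ∃ ψ : B' →ₗ[R] Ch A, ψ ∘ₗ f = φ := by
  constructor
  · intro h φ
    obtain ⟨d, hd⟩ := Ch.extend _ h (tensChar φ)
    refine ⟨charTens d, ?_⟩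
    ext b a
    exact DFunLike.congr_fun hd (tmk R a b)
  · intro h
    refine Ch.injective_of_extend _ fun c => ?_
    obtain ⟨ψ, hψ⟩ := h (charTens c)
    refine ⟨tensChar ψ, tens_char_ext fun a b => ?_⟩
    exact DFunLike.congr_fun (LinearMap.congr_fun hψ b) a

theorem tmapL_injective_iff (g : A →ₗ[Rᵐᵒᵖ] A') : Function.Injective (tmapL R g B) ↔
    ∀ φ : A →ₗ[Rᵐᵒᵖ] Ch B, ∃ ψ : A' →ₗ[Rᵐᵒᵖ] Ch B, ψ ∘ₗ g = φ := by
  constructor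
  · intro h φ
    obtain ⟨d, hd⟩ := Ch.extend _ h (tensChar (flipL φ))
    refine ⟨flipR (charTens d), ?_⟩
    ext a b
    exact DFunLike.congr_fun hd (tmk R a b)
  · intro h
    refine Ch.injective_of_extend _ fun c => ?_
    obtain ⟨ψ, hψ⟩ := h (flipR (charTens c))
    refine ⟨tensChar (flipL ψ), tens_char_ext fun a b => ?_⟩
    exact DFunLike.congr_fun (LinearMap.congr_fun hψ a) b

/-- Lambek's criterion, a direct reading of `tmapL_injective_iff`. -/
theorem isFlatL_iff : IsFlatL R B ↔ Module.Injective Rᵐᵒᵖ (Ch B) := by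
  constructor
  · intro h
    refine ⟨fun X Y _ _ _ _ f hf g => ?_⟩
    obtain ⟨ψ, hψ⟩ := (tmapL_injective_iff f).1 (h X Y f hf) g
    exact ⟨ψ, LinearMap.congr_fun hψ⟩
  · intro h X Y _ _ _ _ f hf
    refine (tmapL_injective_iff f).2 fun φ => ?_
    obtain ⟨ψ, hψ⟩ := h.out f hf φ
    exact ⟨ψ, LinearMap.ext hψ⟩

theorem isFlatR_iff : IsFlatR R A ↔ Module.Injective R (Ch A) := by
  constructor
  · intro h
    refine ⟨fun X Y _ _ _ _ f hf g => ?_⟩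
    obtain ⟨ψ, hψ⟩ := (tmapR_injective_iff f).1 (h X Y f hf) g
    exact ⟨ψ, LinearMap.congr_fun hψ⟩
  · intro h X Y _ _ _ _ f hf
    refine (tmapR_injective_iff f).2 fun φ => ?_
    obtain ⟨ψ, hψ⟩ := h.out f hf φ
    exact ⟨ψ, LinearMap.ext hψ⟩

theorem injective_ch_of_projective (hB : Module.Projective R B) : Module.Injective Rᵐᵒᵖ (Ch B) := by
  refine ⟨fun X Y _ _ _ _ f hf g => ?_⟩
  obtain ⟨ψ, hψ⟩ := Module.projective_lifting_property (lCh f) (flipL g)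
    (Ch.extend f.toAddMonoidHom hf)
  refine ⟨flipR ψ, fun x => ?_⟩
  ext b
  exact DFunLike.congr_fun (LinearMap.congr_fun hψ b) x

theorem isFlatL_of_projective (hB : Module.Projective R B) : IsFlatL R B :=
  isFlatL_iff.2 (injective_ch_of_projective hB)

/-- `Tor` is balanced, in terms of the groups `Ext` into character modules. -/
theorem ev_ch_iff (n : ℕ) : EV R (n + 1) B (Ch A) ↔ EV Rᵐᵒᵖ (n + 1) A (Ch B) := by
  induction n generalizing B with
  | zero =>
    obtain ⟨g, hg⟩ := exists_surjective_finsupp R B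
    have hs := IsSES.ker hg
    constructor
    · intro h
      -- Extending a map ker g → Ch A over the free module is adjoint to lifting a map A → Ch (ker
      -- g) to the dual of the free module, and that dual is injective.
      refine EV.of_lift hs.rCh (EV.of_injective (injective_ch_of_projective inferInstance) 0)
        fun φ => ?_
      obtain ⟨ψ, hψ⟩ := EV.extend hs h (flipL φ)
      refine ⟨flipR ψ, ?_⟩
      ext a b
      exact DFunLike.congr_fun (LinearMap.congr_fun hψ b) a
    · intro h
      refine EV.of_extend hs (EV.of_projective inferInstance 0) fun φ => ?_
      obtain ⟨ψ, hψ⟩ := EV.lift hs.rCh h (flipR φ)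
      refine ⟨flipL ψ, ?_⟩
      ext b a
      exact DFunLike.congr_fun (LinearMap.congr_fun hψ a) b
  | succ n ih =>
    obtain ⟨g, hg⟩ := exists_surjective_finsupp R B
    have hs := IsSES.ker hg
    have hI : Module.Injective Rᵐᵒᵖ (Ch (B →₀ R)) := injective_ch_of_projective inferInstance
    constructor
    · intro h
      exact EV.snd_left hs.rCh (ih.1 (EV.fst_left hs (EV.of_projective inferInstance n) h))
        (EV.of_injective hI _)
    · intro h
      exact EV.fst_right hs (ih.2 (EV.snd_right hs.rCh (EV.of_injective hI n) h))
        (EV.of_projective inferInstance _)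

theorem IsFlatL.ev (h : IsFlatL R B) (n : ℕ) : EV R (n + 1) B (Ch A) :=
  (ev_ch_iff n).2 (EV.of_injective (isFlatL_iff.1 h) n)

/-- Characters turn a flat resolution of `A` of length k into an injective coresolution of `Ch A` of
length k. -/
theorem FlatDimLER.ev {k : ℕ} (h : FlatDimLER R k A) {n : ℕ} (hn : k ≤ n) :
    EV R (n + 1) B (Ch A) := by
  induction k generalizing A n with
  | zero => exact EV.of_injective (isFlatR_iff.1 h) n
  | succ k ih =>
    obtain ⟨F, _, _, f, hF, hf, hk⟩ := h
    obtain ⟨n, rfl⟩ : ∃ m, n = m + 1 := ⟨n - 1, by omega⟩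
    exact EV.snd_left (IsSES.ker hf).lCh (ih hk (by omega))
      (EV.of_injective (isFlatR_iff.1 hF) (n + 1))

theorem FlatDimLEL.ev {k : ℕ} (h : FlatDimLEL R k B) {n : ℕ} (hn : k ≤ n) :
    EV Rᵐᵒᵖ (n + 1) A (Ch B) := by
  induction k generalizing B n with
  | zero => exact EV.of_injective (isFlatL_iff.1 h) n
  | succ k ih =>
    obtain ⟨F, _, _, f, hF, hf, hk⟩ := h
    obtain ⟨n, rfl⟩ : ∃ m, n = m + 1 := ⟨n - 1, by omega⟩
    exact EV.snd_left (IsSES.ker hf).rCh (ih hk (by omega))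
      (EV.of_injective (isFlatL_iff.1 hF) (n + 1))

/-! ### Exactness of tensor products -/

theorem tmapR_surjective {g : B →ₗ[R] B'} (hg : Function.Surjective g) :
    Function.Surjective (tmapR R A g) := fun z => by
  induction z using tens_induction R with
  | h0 => exact ⟨0, map_zero _⟩
  | hm a b => obtain ⟨b, rfl⟩ := hg b; exact ⟨tmk R a b, rfl⟩
  | ha x y hx hy =>
    obtain ⟨x, rfl⟩ := hx
    obtain ⟨y, rfl⟩ := hy
    exact ⟨x + y, map_add _ x y⟩

/-- A linear map that vanishes on the kernel of a surjection factors through it. -/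
theorem exists_factor {S : Type u} [Ring S] {X Y Z W : Type u} [AddCommGroup X] [Module S X]
    [AddCommGroup Y] [Module S Y] [AddCommGroup Z] [Module S Z] [AddCommGroup W] [Module S W]
    {f : X →ₗ[S] Y} {g : Y →ₗ[S] Z} (h : Function.Exact f g) (hg : Function.Surjective g)
    (φ : Y →ₗ[S] W) (hφ : ∀ x, φ (f x) = 0) : ∃ ψ : Z →ₗ[S] W, ψ ∘ₗ g = φ := by
  have h2 : LinearMap.ker g ≤ LinearMap.ker φ := fun y hy => by
    obtain ⟨x, rfl⟩ := (h y).1 hy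
    exact hφ x
  refine ⟨(LinearMap.ker g).liftQ φ h2 ∘ₗ (g.quotKerEquivOfSurjective hg).symm.toLinearMap, ?_⟩
  ext y
  have : (g.quotKerEquivOfSurjective hg).symm (g y) = (LinearMap.ker g).mkQ y := by
    rw [LinearEquiv.symm_apply_eq]; rfl
  simp [this]

theorem tmapR_exact {f : B →ₗ[R] B'} {g : B' →ₗ[R] B''} (h : Function.Exact f g)
    (hg : Function.Surjective g) : Function.Exact (tmapR R A f) (tmapR R A g) := by
  refine Ch.exact_of_factor _ _ (tens_hom_ext R fun a b => ?_) fun c hc => ?_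
  · change tmk R a (g (f b)) = 0
    rw [h.apply_apply_eq_zero, map_zero]
  · obtain ⟨ψ, hψ⟩ := exists_factor h hg (charTens c) (fun b => by
      ext a
      exact DFunLike.congr_fun hc (tmk R a b))
    refine ⟨tensChar ψ, tens_char_ext fun a b => ?_⟩
    exact DFunLike.congr_fun (LinearMap.congr_fun hψ b) a

theorem tmapR_injective_of_ev {f : B →ₗ[R] B'} {g : B' →ₗ[R] B''} (h : IsSES f g)
    (hB : EV R 1 B'' (Ch A)) : Function.Injective (tmapR R A f) :=
  (tmapR_injective_iff f).2 fun φ => EV.extend h hB φ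

end Ch

/-! ### Vanishing of `Tor` -/

section TorVanishing

variable {R : Type u} [Ring R] {A : Type u} [AddCommGroup A] [Module Rᵐᵒᵖ A]

theorem tmapR_comp_apply {B B' B'' : Type u} [AddCommGroup B] [Module R B] [AddCommGroup B']
    [Module R B'] [AddCommGroup B''] [Module R B''] (g : B' →ₗ[R] B'') (f : B →ₗ[R] B')
    (z : Tens R A B) : tmapR R A (g ∘ₗ f) z = tmapR R A g (tmapR R A f z) :=
  DFunLike.congr_fun (tens_hom_ext R (f := tmapR R A (g ∘ₗ f))
    (g := (tmapR R A g).comp (tmapR R A f)) fun _ _ => rfl) z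

/-- Higher degrees reduce to lower ones by truncating the resolution at ker ε. In degree one,
exactness of A ⊗ P at its second place makes A ⊗ ker ε → A ⊗ P 0 injective, which is an extension
property by `tmapR_injective_iff`. -/
theorem ev_of_resolution (P : ℕ → ModuleCat.{u} R) (d : ∀ n, P (n + 1) →ₗ[R] P n)
    {B : Type u} [AddCommGroup B] [Module R B] (ε : P 0 →ₗ[R] B) (hε : Function.Surjective ε)
    (h0 : Function.Exact (d 0) ε) (h : ∀ n, Function.Exact (d (n + 1)) (d n))
    (hP : ∀ n, Module.Projective R (P n))
    (ht : ∀ n, Function.Exact (tmapR R A (d (n + 1))) (tmapR R A (d n))) (n : ℕ) :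
    EV R (n + 1) B (Ch A) := by
  induction n generalizing P B with
  | zero =>
    let δ : P 1 →ₗ[R] LinearMap.ker ε := (d 0).codRestrict _ h0.apply_apply_eq_zero
    have hδ : Function.Surjective δ := by
      rintro ⟨x, hx⟩
      obtain ⟨y, rfl⟩ := (h0 x).1 hx
      exact ⟨y, rfl⟩
    have hi : Function.Injective (tmapR R A (LinearMap.ker ε).subtype) := by
      refine (injective_iff_map_eq_zero _).2 fun z hz => ?_
      obtain ⟨z, rfl⟩ := tmapR_surjective (A := A) hδ z
      rw [← tmapR_comp_apply] at hz
      -- The element comes from A ⊗ P 1; exactness there lifts it to A ⊗ P 2, and the composite P 2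
      -- → P 1 → ker ε is zero.
      obtain ⟨w, rfl⟩ := (ht 0 z).1 hz
      rw [← tmapR_comp_apply, show δ ∘ₗ d (0 + 1) = 0 from
        LinearMap.ext fun x => Subtype.ext ((h 0).apply_apply_eq_zero x)]
      exact DFunLike.congr_fun (tens_hom_ext R (f := tmapR R A (0 : _ →ₗ[R] LinearMap.ker ε))
        (g := 0) fun a b => map_zero (tmk R a)) w
    exact EV.of_extend (IsSES.ker hε) (EV.of_projective (hP 0) 0) ((tmapR_injective_iff _).1 hi)
  | succ n ih =>
    refine EV.fst_right (IsSES.ker hε) ?_ (EV.of_projective (hP 0) (n + 1))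
    let δ : P 1 →ₗ[R] LinearMap.ker ε := (d 0).codRestrict _ h0.apply_apply_eq_zero
    refine ih (fun n => P (n + 1)) (fun n => d (n + 1)) δ ?_ ?_ (fun n => h (n + 1))
      (fun n => hP (n + 1)) (fun n => ht (n + 1))
    · rintro ⟨x, hx⟩
      obtain ⟨y, rfl⟩ := (h0 x).1 hx
      exact ⟨y, rfl⟩
    · intro x
      rw [← h 0 x]
      exact ⟨fun hx => congrArg Subtype.val hx, fun hx => Subtype.ext hx⟩

/-- The bridge from the derived functor in `CondT` to Ext into a character module. Only this
direction is needed, because acyclicity is expressed through `EV` from here on. -/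
theorem ev_of_tor {B : Type u} [AddCommGroup B] [Module R B]
    (h : ∀ n, 1 ≤ n → Limits.IsZero (Tor R A B n)) (n : ℕ) : EV R (n + 1) B (Ch A) := by
  let P := projectiveResolution (ModuleCat.of R B)
  refine ev_of_resolution (fun n => P.complex.X n) (fun n => (P.complex.d (n + 1) n).hom)
    (P.π.f 0).hom ?_ ?_ ?_ ?_ ?_ n
  · exact (ModuleCat.epi_iff_surjective _).1 inferInstance
  · exact (ShortComplex.ShortExact.moduleCat_exact_iff_function_exact _).1 P.exact₀
  · intro n
    exact (ShortComplex.ShortExact.moduleCat_exact_iff_function_exact _).1 (P.exact_succ n)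
  · intro n
    exact (IsProjective.iff_projective _).2 (P.projective n)
  · intro n
    have h1 := (h (n + 1) (by omega)).of_iso (P.isoLeftDerivedObj (tensFunctor R A) (n + 1)).symm
    have h2 : (((tensFunctor R A).mapHomologicalComplex _).obj P.complex).ExactAt (n + 1) :=
      (HomologicalComplex.exactAt_iff_isZero_homology _ _).2 h1
    rw [HomologicalComplex.exactAt_iff' _ (n + 2) (n + 1) n (by simp) (by simp)] at h2
    exact (ShortComplex.ab_exact_iff_function_exact _).1 h2

end TorVanishing

/-! ### Left modules over the tensor ring -/

section Left

variable {R : Type u} [Ring R] {M : Type u} [AddCommGroup M] [Module R M] [Module Rᵐᵒᵖ M]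
  [SMulCommClass R Rᵐᵒᵖ M]

section Tmap

variable {B B' B'' : Type u} [AddCommGroup B] [Module R B] [AddCommGroup B'] [Module R B']
  [AddCommGroup B''] [Module R B'']

variable (M) in
/-- `M ⊗ f` as an `R`-linear map. -/
def tM (f : B →ₗ[R] B') : Tens R M B →ₗ[R] Tens R M B' :=
  { tmapR R M f with
    map_smul' := fun r z => by
      change tmapR R M f (r • z) = r • tmapR R M f z
      induction z using tens_induction R with
      | h0 => simp
      | hm a b => rfl
      | ha x y hx hy => rw [smul_add, map_add, map_add, smul_add, hx, hy] }

theorem tens_linearMap_ext {f g : Tens R M B →ₗ[R] B'}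
    (h : ∀ m b, f (tmk R m b) = g (tmk R m b)) : f = g :=
  LinearMap.toAddMonoidHom_injective (tens_hom_ext R h)

theorem tM_comp (g : B' →ₗ[R] B'') (f : B →ₗ[R] B') : tM M (g ∘ₗ f) = tM M g ∘ₗ tM M f :=
  tens_linearMap_ext fun _ _ => rfl

theorem tM_id : tM M (LinearMap.id : B →ₗ[R] B) = LinearMap.id :=
  tens_linearMap_ext fun _ _ => rfl

/-- Linear equivalences are preserved by `M ⊗ -`. -/
def tMEquiv (e : B ≃ₗ[R] B') : Tens R M B ≃ₗ[R] Tens R M B' :=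
  LinearEquiv.ofLinearMap (tM M e) (tM M e.symm) (by rw [← tM_comp]; simp [tM_id])
    (by rw [← tM_comp]; simp [tM_id])

theorem IsRetract.tM (h : IsRetract R B B') : IsRetract R (Tens R M B) (Tens R M B') := by
  obtain ⟨i, r, hr⟩ := h
  exact ⟨TR.tM M i, TR.tM M r, by rw [← tM_comp, hr, tM_id]⟩

theorem IsSES.tM {f : B →ₗ[R] B'} {g : B' →ₗ[R] B''} (h : IsSES f g)
    (hB : EV R 1 B'' (Ch M)) : IsSES (TR.tM M f) (TR.tM M g) where
  inj := tmapR_injective_of_ev h hB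
  exact := tmapR_exact h.exact h.surj
  surj := tmapR_surjective h.surj

end Tmap

/-! ### The cokernel of the action, and modules with zero action -/

namespace LPair

variable {p q s : LPair R M}

/-- The `R`-linear map underlying a `T_R(M)`-linear map. -/
def res (φ : p.Mod →ₗ[TensorRing R M] q.Mod) : p.X →ₗ[R] q.X where
  toFun x := φ x
  map_add' := φ.map_add
  map_smul' r x :=
    (congrArg φ (TensorRing.act_ofBase p.u r x).symm).trans
      ((φ.map_smul (TensorRing.ofBase (M := M) r) x).trans (TensorRing.act_ofBase q.u r (φ x)))

theorem res_u (φ : p.Mod →ₗ[TensorRing R M] q.Mod) (z : Tens R M p.X) :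
    res φ (p.u z) = q.u (tM M (res φ) z) := by
  induction z using tens_induction R with
  | h0 => simp
  | hm m x =>
    exact (congrArg φ (TensorRing.act_ofM p.u m x).symm).trans
      ((φ.map_smul (TensorRing.ofM (R := R) m) x).trans (TensorRing.act_ofM q.u m (φ x)))
  | ha x y hx hy => simp only [map_add, hx, hy]

/-- An `R`-linear map that is compatible with the actions of `M` is `T_R(M)`-linear. -/
def ofRes (f : p.X →ₗ[R] q.X) (h : ∀ m x, f (p.u (tmk R m x)) = q.u (tmk R m (f x))) :
    p.Mod →ₗ[TensorRing R M] q.Mod where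
  toFun x := f x
  map_add' := f.map_add
  map_smul' t x := by
    have key : ∀ (t : TensorRing R M) (x : p.X),
        f (TensorRing.act p.u t x) = TensorRing.act q.u t (f x) := by
      intro t
      induction t using TensorRing.induction_mul with
      | hb r => intro x; rw [TensorRing.act_ofBase, TensorRing.act_ofBase, map_smul]
      | hm m t ih =>
        intro x
        rw [TensorRing.ofM_mul, TensorRing.act_leftMul, TensorRing.act_leftMul, h, ih]
      | ha a b ha hb =>
        intro x
        simp only [map_add, AddMonoidHom.add_apply, ha, hb]
    exact key t x

theorem ses_res {φ : p.Mod →ₗ[TensorRing R M] q.Mod} {ψ : q.Mod →ₗ[TensorRing R M] s.Mod}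
    (h : IsSES φ ψ) : IsSES (res φ) (res ψ) :=
  ⟨h.inj, h.exact, h.surj⟩

/-- The cokernel of `u`. -/
abbrev C (p : LPair R M) : Type u := p.X ⧸ LinearMap.range p.u

/-- The map induced on the cokernels of the actions. -/
def cMap (φ : p.Mod →ₗ[TensorRing R M] q.Mod) : p.C →ₗ[R] q.C :=
  Submodule.mapQ _ _ (res φ) (by
    rintro _ ⟨z, rfl⟩
    exact ⟨_, (res_u φ z).symm⟩)

@[simp]
theorem cMap_mkQ (φ : p.Mod →ₗ[TensorRing R M] q.Mod) (x : p.X) :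
    cMap φ ((LinearMap.range p.u).mkQ x) = (LinearMap.range q.u).mkQ (res φ x) := rfl

theorem cMap_surjective {ψ : q.Mod →ₗ[TensorRing R M] s.Mod} (h : Function.Surjective ψ) :
    Function.Surjective (cMap ψ) := by
  intro y
  obtain ⟨y, rfl⟩ := Submodule.mkQ_surjective _ y
  obtain ⟨x, rfl⟩ := h y
  exact ⟨(LinearMap.range q.u).mkQ x, rfl⟩

theorem mkQ_eq_zero {x : p.X} : (LinearMap.range p.u).mkQ x = 0 ↔ ∃ z, p.u z = x := by
  rw [← LinearMap.mem_ker, Submodule.ker_mkQ]; rfl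

/-- The cokernel of u is R ⊗_T X, where R is T modulo its positive part, so right exactness is to be
expected; the chase avoids making that identification. -/
theorem cMap_exact {φ : p.Mod →ₗ[TensorRing R M] q.Mod} {ψ : q.Mod →ₗ[TensorRing R M] s.Mod}
    (h : IsSES φ ψ) : Function.Exact (cMap φ) (cMap ψ) := by
  have hr := ses_res h
  intro y
  constructor
  · intro hy
    obtain ⟨y, rfl⟩ := Submodule.mkQ_surjective _ y
    rw [cMap_mkQ, mkQ_eq_zero] at hy
    obtain ⟨z, hz⟩ := hy
    obtain ⟨z, rfl⟩ := tmapR_surjective (A := M) hr.surj z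
    have : res ψ (y - q.u z) = 0 := by
      rw [map_sub, res_u, ← hz, sub_eq_zero]; rfl
    obtain ⟨x, hx⟩ := (hr.exact _).1 this
    refine ⟨(LinearMap.range p.u).mkQ x, ?_⟩
    rw [cMap_mkQ, hx, map_sub, mkQ_eq_zero.2 ⟨z, rfl⟩, sub_zero]
  · rintro ⟨x, rfl⟩
    obtain ⟨x, rfl⟩ := Submodule.mkQ_surjective _ x
    rw [cMap_mkQ, cMap_mkQ, hr.exact.apply_apply_eq_zero, map_zero]

/-- By the snake lemma, ker s.u maps onto the kernel of p.C → q.C. -/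
theorem cMap_injective {φ : p.Mod →ₗ[TensorRing R M] q.Mod} {ψ : q.Mod →ₗ[TensorRing R M] s.Mod}
    (h : IsSES φ ψ) (hs : Function.Injective s.u) : Function.Injective (cMap φ) := by
  have hr := ses_res h
  refine (injective_iff_map_eq_zero _).2 fun x hx => ?_
  obtain ⟨x, rfl⟩ := Submodule.mkQ_surjective _ x
  rw [cMap_mkQ, mkQ_eq_zero] at hx
  obtain ⟨z, hz⟩ := hx
  have h1 : tM M (res ψ) z = 0 := hs (by
    rw [← res_u, hz, map_zero, hr.exact.apply_apply_eq_zero x])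
  obtain ⟨w, rfl⟩ := (tmapR_exact (A := M) hr.exact hr.surj z).1 h1
  exact mkQ_eq_zero.2 ⟨w, hr.inj ((res_u φ w).trans hz)⟩

theorem ses_cMap {φ : p.Mod →ₗ[TensorRing R M] q.Mod} {ψ : q.Mod →ₗ[TensorRing R M] s.Mod}
    (h : IsSES φ ψ) (hs : Function.Injective s.u) : IsSES (cMap φ) (cMap ψ) :=
  ⟨cMap_injective h hs, cMap_exact h, cMap_surjective h.surj⟩

/-- The same snake read the other way: when `q.u` is injective, ker s.u embeds in the kernel of p.C
→ q.C. -/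
theorem u_injective_right {φ : p.Mod →ₗ[TensorRing R M] q.Mod}
    {ψ : q.Mod →ₗ[TensorRing R M] s.Mod} (h : IsSES φ ψ) (hq : Function.Injective q.u)
    (hc : Function.Injective (cMap φ)) : Function.Injective s.u := by
  have hr := ses_res h
  refine (injective_iff_map_eq_zero _).2 fun z hz => ?_
  obtain ⟨z, rfl⟩ := tmapR_surjective (A := M) hr.surj z
  have h1 : res ψ (q.u z) = 0 := (res_u ψ z).trans hz
  obtain ⟨x, hx⟩ := (hr.exact _).1 h1
  have h2 : (LinearMap.range p.u).mkQ x = 0 := hc (by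
    rw [cMap_mkQ, map_zero]
    exact mkQ_eq_zero.2 ⟨z, hx.symm⟩)
  obtain ⟨w, rfl⟩ := mkQ_eq_zero.1 h2
  have h3 : tM M (res φ) w = z := hq ((res_u φ w).symm.trans hx)
  rw [← h3]
  exact (tmapR_exact (A := M) hr.exact hr.surj).apply_apply_eq_zero w

theorem u_injective_left {φ : p.Mod →ₗ[TensorRing R M] q.Mod}
    (hq : Function.Injective q.u) (h : Function.Injective (tM M (res φ))) :
    Function.Injective p.u := by
  intro z w hzw
  refine h (hq ?_)
  rw [← res_u, ← res_u, hzw]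

variable (R M) in
/-- The module `W` on which `M` acts as zero. -/
abbrev triv (W : Type u) [AddCommGroup W] [Module R W] : LPair R M where
  X := W
  u := 0

/-- Maps from `coker u` to `W` are maps from `(X, u)` to `(W, 0)`. -/
def toTriv {W : Type u} [AddCommGroup W] [Module R W] (χ : p.C →ₗ[R] W) :
    p.Mod →ₗ[TensorRing R M] (triv R M W).Mod :=
  ofRes (q := triv R M W) (χ ∘ₗ (LinearMap.range p.u).mkQ) fun m x => by
    change χ ((LinearMap.range p.u).mkQ _) = 0
    rw [mkQ_eq_zero.2 ⟨_, rfl⟩, map_zero]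

theorem exists_toTriv {W : Type u} [AddCommGroup W] [Module R W]
    (φ : p.Mod →ₗ[TensorRing R M] (triv R M W).Mod) : ∃ χ : p.C →ₗ[R] W, toTriv χ = φ := by
  refine ⟨(LinearMap.range p.u).liftQ (res (q := triv R M W) φ) ?_, rfl⟩
  rintro _ ⟨z, rfl⟩
  exact res_u (q := triv R M W) φ z

theorem toTriv_comp {W : Type u} [AddCommGroup W] [Module R W] (χ : q.C →ₗ[R] W)
    (φ : p.Mod →ₗ[TensorRing R M] q.Mod) : toTriv χ ∘ₗ φ = toTriv (χ ∘ₗ cMap φ) := rfl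

theorem toTriv_injective {W : Type u} [AddCommGroup W] [Module R W] {χ χ' : p.C →ₗ[R] W}
    (h : toTriv χ = toTriv χ') : χ = χ' := by
  ext x
  exact LinearMap.congr_fun h x

end LPair
end Left

section Induced

variable {R : Type u} [Ring R] {M : Type u} [AddCommGroup M] [Module R M] [Module Rᵐᵒᵖ M]
  [SMulCommClass R Rᵐᵒᵖ M]

/-! ### Induced modules -/

/-- `T_R(M)` as a right `R`-module. -/
instance : Module Rᵐᵒᵖ (TensorRing R M) :=
  Module.compHom (TensorRing R M) (TensorRing.baseHom R M).op

theorem TensorRing.op_smul_eq (r : R) (t : TensorRing R M) : op r • t = t * ofBase r := rfl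

theorem TensorRing.smul_eq (r : R) (t : TensorRing R M) : r • t = ofBase r * t :=
  (ofBase_mul r t).symm

instance : SMulCommClass R Rᵐᵒᵖ (TensorRing R M) where
  smul_comm r s t := by
    obtain ⟨s, rfl⟩ := op_surjective s
    rw [TensorRing.op_smul_eq, TensorRing.op_smul_eq, TensorRing.smul_eq, TensorRing.smul_eq,
      mul_assoc]

/-- Left multiplication by `t` on `T_R(M)`, as a right `R`-linear map. -/
def mulLeftR (t : TensorRing R M) : TensorRing R M →ₗ[Rᵐᵒᵖ] TensorRing R M where
  toFun s := t * s
  map_add' := mul_add t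
  map_smul' r s := by
    obtain ⟨r, rfl⟩ := op_surjective r
    rw [RingHom.id_apply, TensorRing.op_smul_eq, TensorRing.op_smul_eq, mul_assoc]

variable {W : Type u} [AddCommGroup W] [Module R W]

namespace LPair

variable (R M W) in
/-- The additive map `M ⊗ (T ⊗ W) → T ⊗ W`, `m ⊗ (t ⊗ w) ↦ (m t) ⊗ w`. -/
def indU : Tens R M (Tens R (TensorRing R M) W) →+ Tens R (TensorRing R M) W :=
  tlift R (AddMonoidHom.mk' (fun m => tmapL R (mulLeftR (TensorRing.ofM m)) W) (fun m m' =>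
      tens_hom_ext R fun t w => by
        change tmk R (TensorRing.ofM (m + m') * t) w = tmk R (TensorRing.ofM m * t) w +
          tmk R (TensorRing.ofM m' * t) w
        rw [TensorRing.ofM_add, add_mul, map_add, AddMonoidHom.add_apply]))
    (fun r m z => by
      induction z using tens_induction R with
      | h0 => simp
      | hm t w =>
        change tmk R (TensorRing.ofM (op r • m) * t) w = tmk R (TensorRing.ofM m * (r • t)) w
        rw [← TensorRing.ofM_mul_ofBase, mul_assoc, TensorRing.smul_eq]
      | ha x y hx hy => rw [smul_add, map_add, map_add, hx, hy])

theorem indU_tmk (m : M) (t : TensorRing R M) (w : W) :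
    indU R M W (tmk R m (tmk R t w)) = tmk R (TensorRing.ofM m * t) w := rfl

theorem indU_smul (r : R) (z : Tens R M (Tens R (TensorRing R M) W)) :
    indU R M W (r • z) = r • indU R M W z := by
  induction z using tens_induction R with
  | h0 => simp
  | hm m z =>
    rw [smul_tmk]
    induction z using tens_induction R with
    | h0 => simp
    | hm t w =>
      rw [indU_tmk, indU_tmk, smul_tmk, TensorRing.smul_eq, ← mul_assoc, TensorRing.ofBase_mul_ofM]
    | ha x y hx hy => simp only [map_add, hx, hy, smul_add]
  | ha x y hx hy => rw [smul_add, map_add, map_add, hx, hy, smul_add]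

variable (R M W) in
/-- The unit `w ↦ 1 ⊗ w`. -/
def indUnit : W →ₗ[R] Tens R (TensorRing R M) W where
  toFun w := tmk R (1 : TensorRing R M) w
  map_add' w w' := map_add _ w w'
  map_smul' r w := by
    change tmk R (1 : TensorRing R M) (r • w) = tmk R (r • (1 : TensorRing R M)) w
    rw [← tmk_smul, TensorRing.op_smul_eq, TensorRing.smul_eq, one_mul, mul_one]

/-- The counit part: projection to degree `0`. -/
def degZero : TensorRing R M →+ R :=
  TensorRing.fold fun i => match i with
    | 0 => AddMonoidHom.id R
    | _ + 1 => 0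

theorem degZero_ofBase (r : R) : degZero (TensorRing.ofBase (M := M) r) = r :=
  TensorRing.fold_of _ 0 r

theorem degZero_ofM_mul (m : M) (t : TensorRing R M) : degZero (TensorRing.ofM m * t) = 0 := by
  rw [TensorRing.ofM_mul]
  induction t using TensorRing.induction_on with
  | h0 => simp
  | hof i s => rw [TensorRing.leftMul_of]; exact TensorRing.fold_of _ (i + 1) _
  | ha x y hx hy => rw [map_add, map_add, map_add, hx, hy, add_zero]

theorem degZero_smul (r : R) (t : TensorRing R M) : degZero (r • t) = r * degZero t := by
  induction t using TensorRing.induction_mul with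
  | hb s => rw [TensorRing.smul_ofBase, degZero_ofBase, degZero_ofBase]
  | hm m t ih =>
    rw [TensorRing.smul_eq, ← mul_assoc, TensorRing.ofBase_mul_ofM, degZero_ofM_mul,
      degZero_ofM_mul, mul_zero]
  | ha x y hx hy => rw [smul_add, map_add, map_add, hx, hy, mul_add]

theorem degZero_op_smul (r : R) (t : TensorRing R M) : degZero (op r • t) = degZero t * r := by
  induction t using TensorRing.induction_mul with
  | hb s =>
    rw [TensorRing.op_smul_eq, TensorRing.ofBase_mul, TensorRing.smul_ofBase, degZero_ofBase,
      degZero_ofBase]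
  | hm m t ih =>
    rw [TensorRing.op_smul_eq, mul_assoc, degZero_ofM_mul, degZero_ofM_mul, zero_mul]
  | ha x y hx hy => rw [smul_add, map_add, map_add, hx, hy, add_mul]

variable (R M W) in
/-- The additive map `T ⊗ W → W` killing the positive degrees. -/
def indEps : Tens R (TensorRing R M) W →+ W :=
  tlift R (A := TensorRing R M) (AddMonoidHom.mk' (fun t => DistribSMul.toAddMonoidHom W (degZero t))
      (fun t t' => by ext w; simp [add_smul]))
    (fun r t w => by
      change degZero (op r • t) • w = degZero t • r • w
      rw [degZero_op_smul, mul_smul])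

theorem indEps_tmk (t : TensorRing R M) (w : W) : indEps R M W (tmk R t w) = degZero t • w := rfl

theorem indEps_smul (r : R) (z : Tens R (TensorRing R M) W) : indEps R M W (r • z) = r • indEps R M W z := by
  induction z using tens_induction R with
  | h0 => simp
  | hm t w => rw [smul_tmk, indEps_tmk, indEps_tmk, degZero_smul, mul_smul]
  | ha x y hx hy =>
    rw [smul_add, map_add, map_add, hx, hy, smul_add]

variable (R M W) in
/-- The `R`-linear map `T ⊗ W → W` killing the positive degrees. -/
def indCounit : Tens R (TensorRing R M) W →ₗ[R] W :=
  { indEps R M W with map_smul' := indEps_smul }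

theorem indCounit_unit (w : W) : indCounit R M W (indUnit R M W w) = w := by
  change degZero (TensorRing.ofBase (M := M) (1 : R)) • w = w
  rw [degZero_ofBase, one_smul]

theorem indCounit_u (z : Tens R M (Tens R (TensorRing R M) W)) : indCounit R M W (indU R M W z) = 0 := by
  induction z using tens_induction R with
  | h0 => simp
  | hm m z =>
    induction z using tens_induction R (A := TensorRing R M) (B := W) with
    | h0 => simp
    | hm t w =>
      change degZero (TensorRing.ofM m * t) • w = 0
      rw [degZero_ofM_mul, zero_smul]
    | ha x y hx hy => simp only [map_add, hx, hy, add_zero]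
  | ha x y hx hy => simp only [map_add, hx, hy, add_zero]

/-- The map `M^{⊗ i} → Hom(W, M ⊗ (T ⊗ W))` splitting off the first tensor factor. -/
def splitPow : ∀ i, TPow R M i →+ (W →+ Tens R M (Tens R (TensorRing R M) W))
  | 0 => 0
  | i + 1 => (show Tens R M (TPow R M i) →+ (W →+ Tens R M (Tens R (TensorRing R M) W)) from
      tlift R (AddMonoidHom.mk' (fun m => AddMonoidHom.mk' (fun s =>
          (tmk R (B := Tens R (TensorRing R M) W) m).comp
            (tmk R (A := TensorRing R M) (B := W) (TensorRing.of i s)))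
          (fun s s' => by
            ext w
            change tmk R m (tmk R (TensorRing.of i (s + s')) w) = _
            rw [map_add, map_add, AddMonoidHom.add_apply]
            exact map_add (tmk R (B := Tens R (TensorRing R M) W) m) _ _))
        (fun m m' => by
          ext s w
          change tmk R (B := Tens R (TensorRing R M) W) (m + m') _ = _
          rw [map_add]; rfl))
      (fun r m s => by
        ext w
        change tmk R (B := Tens R (TensorRing R M) W) (op r • m) (tmk R (TensorRing.of i s) w) =
          tmk R (B := Tens R (TensorRing R M) W) m (tmk R (TensorRing.of i (r • s)) w)
        rw [tmk_smul, (TensorRing.of i).map_smul, smul_tmk]))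

/-- The map `T → Hom(W, M ⊗ (T ⊗ W))` splitting off the first tensor factor. -/
def split : TensorRing R M →+ (W →+ Tens R M (Tens R (TensorRing R M) W)) :=
  TensorRing.fold splitPow

theorem split_ofBase (r : R) (w : W) : split (TensorRing.ofBase (M := M) r) w = 0 := by
  rw [split, TensorRing.ofBase, TensorRing.fold_of]; rfl

theorem split_ofM_mul (m : M) (t : TensorRing R M) (w : W) :
    split (TensorRing.ofM m * t) w = tmk R (B := Tens R (TensorRing R M) W) m (tmk R t w) := by
  rw [TensorRing.ofM_mul]
  induction t using TensorRing.induction_on with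
  | h0 =>
    simp only [map_zero, AddMonoidHom.zero_apply]
  | hof i s => rw [TensorRing.leftMul_of, split, TensorRing.fold_of]; rfl
  | ha x y hx hy =>
    simp only [map_add, AddMonoidHom.add_apply, hx, hy]

variable (R M W) in
/-- The additive retraction of the action of `M` on `T ⊗ W`. -/
def indRetr : Tens R (TensorRing R M) W →+ Tens R M (Tens R (TensorRing R M) W) :=
  tlift R (A := TensorRing R M) (B := W) split (fun r t w => by
    induction t using TensorRing.induction_mul with
    | hb s =>
      rw [TensorRing.op_smul_eq, TensorRing.ofBase_mul, TensorRing.smul_ofBase, split_ofBase,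
        split_ofBase]
    | hm m t ih =>
      rw [TensorRing.op_smul_eq, mul_assoc, split_ofM_mul, split_ofM_mul]
      exact congrArg (tmk R (B := Tens R (TensorRing R M) W) m) (tmk_smul R r t w)
    | ha x y hx hy => rw [smul_add, map_add, map_add, AddMonoidHom.add_apply, hx, hy]; rfl)

theorem indRetr_u (z : Tens R M (Tens R (TensorRing R M) W)) : indRetr R M W (indU R M W z) = z := by
  induction z using tens_induction R with
  | h0 => simp
  | hm m z =>
    induction z using tens_induction R (A := TensorRing R M) (B := W) with
    | h0 => simp
    | hm t w => exact split_ofM_mul m t w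
    | ha x y hx hy => simp only [map_add, hx, hy]
  | ha x y hx hy => rw [map_add, map_add, hx, hy]

/-- T = R ⊕ (M ⊗ T): a tensor either has degree zero or allows its first factor to be split off.
Hence T ⊗ W decomposes into M ⊗ (T ⊗ W) and W, which gives exactness in `ind_ses`. -/
theorem u_indRetr (z : Tens R (TensorRing R M) W) :
    indU R M W (indRetr R M W z) + indUnit R M W (indCounit R M W z) = z := by
  induction z using tens_induction R (A := TensorRing R M) (B := W) with
  | h0 => simp
  | hm t w =>
    change indU R M W (split t w) + tmk R (1 : TensorRing R M) (degZero t • w) =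
      tmk R t w
    induction t using TensorRing.induction_mul with
    | hb r =>
      rw [split_ofBase, degZero_ofBase, map_zero, zero_add, ← tmk_smul, TensorRing.op_smul_eq,
        one_mul]
    | hm m t ih =>
      rw [split_ofM_mul, degZero_ofM_mul, zero_smul, map_zero, add_zero]; rfl
    | ha x y hx hy =>
      rw [map_add split, map_add degZero, AddMonoidHom.add_apply, map_add (indU R M W), add_smul,
        map_add, map_add, AddMonoidHom.add_apply, ← hx, ← hy]
      exact add_add_add_comm _ _ _ _
  | ha x y hx hy =>
    simp only [map_add]
    rw [add_add_add_comm, hx, hy]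

variable (R M W) in
/-- The induced module `T_R(M) ⊗_R W`. -/
def ind : LPair R M where
  X := Tens R (TensorRing R M) W
  u := { indU R M W with map_smul' := indU_smul }

theorem ind_u_injective : Function.Injective (ind R M W).u :=
  Function.LeftInverse.injective (g := indRetr R M W) indRetr_u

theorem ind_ses : IsSES (ind R M W).u (indCounit R M W) where
  inj := ind_u_injective
  exact := by
    intro (z : Tens R (TensorRing R M) W)
    refine ⟨fun hz => ⟨indRetr R M W z, ?_⟩, fun ⟨w, hw⟩ => hw ▸ indCounit_u w⟩
    have := u_indRetr (R := R) (M := M) (W := W) z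
    have hz' : indUnit R M W (indCounit R M W z) = 0 :=
      (congrArg (indUnit R M W) hz).trans (map_zero _)
    rwa [hz', add_zero] at this
  surj w := ⟨_, indCounit_unit w⟩

/-- The action of `T_R(M)` on `X`, as a map `T_R(M) ⊗_R W → X` for a linear map `W → X`. -/
def actTens (p : LPair R M) (f : W →ₗ[R] p.X) : Tens R (TensorRing R M) W →+ p.X :=
  tlift R (AddMonoidHom.mk' (fun t => (TensorRing.act p.u t).comp f.toAddMonoidHom)
      (fun t t' => by ext w; simp))
    (fun r t w => by
      change TensorRing.act p.u (t * TensorRing.ofBase r) (f w) = TensorRing.act p.u t (f (r • w))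
      rw [TensorRing.mul_def, TensorRing.act_act, TensorRing.act_ofBase, f.map_smul])

theorem actTens_tmk (p : LPair R M) (f : W →ₗ[R] p.X) (t : TensorRing R M) (w : W) :
    actTens p f (tmk R t w) = TensorRing.act p.u t (f w) := rfl

theorem actTens_smul (p : LPair R M) (f : W →ₗ[R] p.X) (r : R) (z : Tens R (TensorRing R M) W) :
    actTens p f (r • z) = r • actTens p f z := by
  induction z using tens_induction R with
  | h0 => simp
  | hm t w => rw [smul_tmk, actTens_tmk, actTens_tmk, TensorRing.act_smul]; rfl
  | ha x y hx hy => rw [smul_add, map_add, map_add, hx, hy, smul_add]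

theorem actTens_u (p : LPair R M) (f : W →ₗ[R] p.X) (m : M) (z : Tens R (TensorRing R M) W) :
    actTens p f (indU R M W (tmk R m z)) = p.u (tmk R m (actTens p f z)) := by
  induction z using tens_induction R with
  | h0 => simp
  | hm t w =>
    rw [indU_tmk, actTens_tmk, actTens_tmk, TensorRing.ofM_mul, TensorRing.act_leftMul]
  | ha x y hx hy => simp only [map_add, hx, hy]

/-- The universal property of the induced module. -/
def indLift {p : LPair R M} (f : W →ₗ[R] p.X) : (ind R M W).Mod →ₗ[TensorRing R M] p.Mod :=
  ofRes (p := ind R M W) { actTens p f with map_smul' := actTens_smul p f } (actTens_u p f)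

theorem indLift_unit {p : LPair R M} (f : W →ₗ[R] p.X) (w : W) :
    res (indLift f) (indUnit R M W w) = f w :=
  (TensorRing.act_ofBase p.u 1 (f w)).trans (one_smul R _)

theorem res_tmk {p : LPair R M} (φ : (ind R M W).Mod →ₗ[TensorRing R M] p.Mod)
    (t : TensorRing R M) (w : W) :
    res φ (tmk R t w) = TensorRing.act p.u t (res φ (indUnit R M W w)) := by
  induction t using TensorRing.induction_mul with
  | hb r =>
    rw [TensorRing.act_ofBase]
    refine Eq.trans (congrArg (res φ) ?_) ((res φ).map_smul r _)
    change _ = tmk R (r • (1 : TensorRing R M)) w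
    rw [TensorRing.smul_eq, mul_one]
  | hm m t ih =>
    rw [TensorRing.ofM_mul, TensorRing.act_leftMul, ← ih]
    refine Eq.trans ?_ (res_u φ (tmk R (B := (ind R M W).X) m (tmk R t w)))
    exact congrArg (res φ) ((congrArg (fun s => tmk R s w) (TensorRing.ofM_mul m t)).symm)
  | ha x y hx hy =>
    rw [map_add (TensorRing.act p.u), AddMonoidHom.add_apply, ← hx, ← hy]
    exact (congrArg (res φ) (DFunLike.congr_fun (map_add (tmk R) x y) w)).trans
      ((res φ).map_add _ _)

theorem ind_ext {p : LPair R M} {φ ψ : (ind R M W).Mod →ₗ[TensorRing R M] p.Mod}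
    (h : ∀ w, res φ (indUnit R M W w) = res ψ (indUnit R M W w)) : φ = ψ := by
  have : (res φ).toAddMonoidHom = (res ψ).toAddMonoidHom :=
    tens_hom_ext R (A := TensorRing R M) (B := W) fun t w =>
      (res_tmk φ t w).trans ((congrArg _ (h w)).trans (res_tmk ψ t w).symm)
  exact LinearMap.ext fun x => DFunLike.congr_fun this x

/-- The cokernel of the action on the induced module. -/
def cInd : (ind R M W).C ≃ₗ[R] W :=
  (Submodule.quotEquivOfEq _ _ ind_ses.exact.linearMap_ker_eq.symm).trans
    ((indCounit R M W).quotKerEquivOfSurjective ind_ses.surj)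

/-- Hom_T(T ⊗ W, -) is Hom_R(W, -) after restriction to R, and restriction preserves surjections. -/
theorem ind_projective (hW : Module.Projective R W) :
    Module.Projective (TensorRing R M) (ind R M W).Mod := by
  refine Module.Projective.of_lifting_property fun {Q Y} _ _ _ _ f g hf => ?_
  obtain ⟨p, ⟨e⟩⟩ := exists_lpair (R := R) (M := M) Q
  obtain ⟨q, ⟨e'⟩⟩ := exists_lpair (R := R) (M := M) Y
  let f' : p.Mod →ₗ[TensorRing R M] q.Mod := e'.symm.toLinearMap ∘ₗ f ∘ₗ e.toLinearMap
  let g' : (ind R M W).Mod →ₗ[TensorRing R M] q.Mod := e'.symm.toLinearMap ∘ₗ g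
  obtain ⟨h, hh⟩ := Module.projective_lifting_property (res f') (res g' ∘ₗ indUnit R M W)
    (e'.symm.surjective.comp (hf.comp e.surjective))
  refine ⟨e.toLinearMap ∘ₗ indLift h, ?_⟩
  have : f' ∘ₗ indLift h = g' := ind_ext fun w =>
    (congrArg (res f') (indLift_unit h w)).trans (LinearMap.congr_fun hh w)
  refine LinearMap.ext fun x => e'.symm.injective ?_
  exact LinearMap.congr_fun this x

end LPair
end Induced

/-! ### Iterated tensor products and acyclicity -/

section Iterate

variable (R : Type u) [Ring R] (M : Type u) [AddCommGroup M] [Module R M] [Module Rᵐᵒᵖ M]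
  [SMulCommClass R Rᵐᵒᵖ M]

/-- `M ⊗ -` on bundled modules. -/
def tF (X : ModuleCat.{u} R) : ModuleCat.{u} R := ModuleCat.of R (Tens R M X)

/-- `Tor_n(M, X) = 0` for `n ≥ 1`. -/
def Acyc (X : Type u) [AddCommGroup X] [Module R X] : Prop := ∀ n, EV R (n + 1) X (Ch M)

/-- `Tor_n(M, M^{⊗ i} ⊗ X) = 0` for `n ≥ 1` and `i ≥ 0`. -/
def HAcyc (X : Type u) [AddCommGroup X] [Module R X] : Prop :=
  ∀ i, Acyc R M ((tF R M)^[i] (ModuleCat.of R X))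

/-- `M^{⊗ k} ⊗ X = 0`. -/
def NilAt (k : ℕ) (X : Type u) [AddCommGroup X] [Module R X] : Prop :=
  Subsingleton ((tF R M)^[k] (ModuleCat.of R X))

variable {R M} {X Y Z : Type u} [AddCommGroup X] [Module R X] [AddCommGroup Y] [Module R Y]
  [AddCommGroup Z] [Module R Z]

theorem HAcyc.acyc (h : HAcyc R M X) : Acyc R M X := h 0

theorem HAcyc.tens (h : HAcyc R M X) : HAcyc R M (Tens R M X) := fun i => h (i + 1)

theorem Acyc.retract (h : IsRetract R X Y) (hY : Acyc R M Y) : Acyc R M X :=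
  fun n => (hY n).retract_fst h

theorem IsRetract.iterate (h : IsRetract R X Y) (i : ℕ) :
    IsRetract R ((tF R M)^[i] (ModuleCat.of R X)) ((tF R M)^[i] (ModuleCat.of R Y)) := by
  induction i generalizing X Y with
  | zero => exact h
  | succ i ih => exact ih (h.tM (M := M))

theorem HAcyc.retract (h : IsRetract R X Y) (hY : HAcyc R M Y) : HAcyc R M X :=
  fun i => (hY i).retract (h.iterate i)

theorem HAcyc.left {f : X →ₗ[R] Y} {g : Y →ₗ[R] Z} (h : IsSES f g) (hY : HAcyc R M Y)
    (hZ : HAcyc R M Z) : HAcyc R M X := by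
  intro i
  induction i generalizing X Y Z with
  | zero => exact fun n => EV.fst_left h (hY 0 n) (hZ 0 (n + 1))
  | succ i ih => exact ih (h.tM (hZ 0 0)) hY.tens hZ.tens

/-- Nilpotency drives the induction. Applying M ⊗ - gives a sequence of the same kind for M ⊗ X,
whose nilpotency index is one less, and X is an extension of Z by M ⊗ X. -/
theorem acyc_of_ses {u : Tens R M X →ₗ[R] X} {π : X →ₗ[R] Z} (h : IsSES u π) (hZ : HAcyc R M Z)
    {k : ℕ} (hk : NilAt R M k X) : Acyc R M X := by
  induction k generalizing X Z with
  | zero =>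
    have : Subsingleton X := hk
    exact fun n => EV.of_subsingleton_fst _
  | succ k ih =>
    have h1 : Acyc R M (Tens R M X) := ih (h.tM (hZ 0 0)) hZ.tens hk
    exact fun n => EV.fst_mid h (h1 n) (hZ 0 n)

/-- A map that is injective on the submodule M ⊗ X and on the quotient G is injective. On M ⊗ X the
map is M ⊗ f, so the argument recurses until M^{⊗k} ⊗ X = 0; acyclicity of H and K keeps every
sequence involved exact. -/
theorem injective_of_ses {G H K : Type u} [AddCommGroup G] [Module R G] [AddCommGroup H]
    [Module R H] [AddCommGroup K] [Module R K] {u : Tens R M X →ₗ[R] X} {π : X →ₗ[R] G}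
    {v : Tens R M Y →ₗ[R] Y} {ρ : Y →ₗ[R] H} (hX : IsSES u π) (hY : IsSES v ρ)
    {f : X →ₗ[R] Y} {g : G →ₗ[R] H} {g' : H →ₗ[R] K} (hg : IsSES g g')
    (hu : f ∘ₗ u = v ∘ₗ tM M f) (hρ : ρ ∘ₗ f = g ∘ₗ π) (hH : HAcyc R M H) (hK : HAcyc R M K)
    {k : ℕ} (hk : NilAt R M k X) : Function.Injective f := by
  induction k generalizing X Y G H K with
  | zero =>
    have : Subsingleton X := hk
    exact Function.injective_of_subsingleton _
  | succ k ih =>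
    have h1 : Function.Injective (tM M f) :=
      ih (hX.tM ((hH.left hg hK) 0 0)) (hY.tM (hH 0 0)) (hg.tM (hK 0 0))
        (by rw [← tM_comp, hu, tM_comp]) (by rw [← tM_comp, hρ, tM_comp]) hH.tens hK.tens hk
    refine (injective_iff_map_eq_zero f).2 fun x hx => ?_
    have h2 : π x = 0 := hg.inj (by
      rw [map_zero, ← LinearMap.comp_apply, ← hρ, LinearMap.comp_apply, hx, map_zero])
    obtain ⟨z, rfl⟩ := (hX.exact x).1 h2
    have h3 : tM M f z = 0 := hY.inj (by
      rw [map_zero, ← LinearMap.comp_apply, ← hu, LinearMap.comp_apply, hx])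
    rw [(injective_iff_map_eq_zero _).1 h1 z h3, map_zero]

/-- Nakayama's lemma in this setting: X is a quotient of M ⊗ X, hence of every M^{⊗k} ⊗ X. -/
theorem subsingleton_of_surjective {u : Tens R M X →ₗ[R] X} (hu : Function.Surjective u)
    {k : ℕ} (hk : NilAt R M k X) : Subsingleton X := by
  induction k generalizing X with
  | zero => exact hk
  | succ k ih =>
    have : Subsingleton (Tens R M X) := ih (u := tM M u) (tmapR_surjective hu) hk
    exact hu.subsingleton

/-! ### Associativity and nilpotency -/

end Iterate

section Assoc

attribute [local instance] tensRightModule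

section

variable {R : Type u} [Ring R] {A : Type u} [AddCommGroup A] [Module Rᵐᵒᵖ A]
  {B : Type u} [AddCommGroup B] [Module R B] [Module Rᵐᵒᵖ B]
  [SMulCommClass R Rᵐᵒᵖ B] {X : Type u} [AddCommGroup X] [Module R X]

theorem op_smul_tmk (r : R) (a : A) (b : B) : op r • tmk R a b = tmk R a (op r • b) := rfl

variable (R A B X) in
/-- `a ⊗ b ↦ (x ↦ a ⊗ (b ⊗ x))`. -/
def assocAux : Tens R A B →+ X →+ Tens R A (Tens R B X) :=
  tlift R (AddMonoidHom.mk' (fun a => AddMonoidHom.mk' (fun b => (tmk R a).comp (tmk R b))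
      (fun b b' => by ext x; simp)) (fun a a' => by ext b x; simp))
    (fun r a b => by
      ext x
      change tmk R (op r • a) (tmk R b x) = tmk R a (tmk R (r • b) x)
      rw [tmk_smul, smul_tmk])

theorem assocAux_smul (r : R) (z : Tens R A B) (x : X) :
    assocAux R A B X (op r • z) x = assocAux R A B X z (r • x) := by
  induction z using tens_induction R with
  | h0 => rw [smul_zero, map_zero]; rfl
  | hm a b => exact congrArg (tmk R a) (tmk_smul R r b x)
  | ha a b ha hb =>
    have h : op r • (a + b) = op r • a + op r • b := smul_add (A := Tens R A B) (op r) a b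
    rw [h, map_add, map_add]
    exact congrArg₂ (· + ·) ha hb

variable (R A B X) in
/-- `(A ⊗ B) ⊗ X → A ⊗ (B ⊗ X)`. -/
def assocHom : Tens R (Tens R A B) X →+ Tens R A (Tens R B X) :=
  tlift R (assocAux R A B X) assocAux_smul

variable (R A B X) in
/-- `A ⊗ (B ⊗ X) → (A ⊗ B) ⊗ X`. -/
def assocInv : Tens R A (Tens R B X) →+ Tens R (Tens R A B) X :=
  tlift R (AddMonoidHom.mk' (fun a => tlift R ((tmk R).comp (tmk R a)) (fun r b x => by
      change tmk R (tmk R a (op r • b)) x = tmk R (tmk R a b) (r • x)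
      rw [← op_smul_tmk, tmk_smul]))
    (fun a a' => tens_hom_ext R fun b x => by simp))
    (fun r a z => by
      induction z using tens_induction R with
      | h0 => simp
      | hm b x =>
        change tmk R (tmk R (op r • a) b) x = tmk R (tmk R a (r • b)) x
        rw [tmk_smul]
      | ha a b ha hb => rw [smul_add, map_add, map_add, ha, hb])

theorem assocInv_assocHom (z : Tens R (Tens R A B) X) :
    assocInv R A B X (assocHom R A B X z) = z := by
  induction z using tens_induction R with
  | h0 => simp
  | hm z x =>
    induction z using tens_induction R with
    | h0 => simp
    | hm m b => rfl
    | ha a b ha hb => simp only [map_add, AddMonoidHom.add_apply, ha, hb]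
  | ha a b ha hb => rw [map_add, map_add, ha, hb]

theorem assocHom_assocInv (z : Tens R A (Tens R B X)) :
    assocHom R A B X (assocInv R A B X z) = z := by
  induction z using tens_induction R with
  | h0 => simp
  | hm m z =>
    induction z using tens_induction R with
    | h0 => simp
    | hm b x => rfl
    | ha a b ha hb => simp only [map_add, ha, hb]
  | ha a b ha hb => rw [map_add, map_add, ha, hb]

/-- `g ⊗ B` as a right linear map, for a bimodule `B`. -/
def tmapLR {A' : Type u} [AddCommGroup A'] [Module Rᵐᵒᵖ A'] (g : A →ₗ[Rᵐᵒᵖ] A') (B : Type u)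
    [AddCommGroup B] [Module R B] [Module Rᵐᵒᵖ B] [SMulCommClass R Rᵐᵒᵖ B] :
    Tens R A B →ₗ[Rᵐᵒᵖ] Tens R A' B :=
  { tmapL R g B with
    map_smul' := fun r z => by
      change tmapL R g B (r • z) = r • tmapL R g B z
      induction z using tens_induction R with
      | h0 => simp
      | hm a b => rfl
      | ha x y hx hy =>
        have h : r • (x + y) = r • x + r • y := smul_add (A := Tens R A B) r x y
        have h' := smul_add (A := Tens R A' B) r (tmapL R g B x) (tmapL R g B y)
        rw [h, map_add, map_add, hx, hy, h'] }

/-- By associativity - ⊗ (B ⊗ X) is (- ⊗ B) ⊗ X; the bimodule structure on B makes - ⊗ B land in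
right modules, where flatness of X applies. -/
theorem IsFlatL.tens (hB : IsFlatL R B) (hX : IsFlatL R X) : IsFlatL R (Tens R B X) := by
  intro A A' _ _ _ _ g hg
  have h := hX _ _ (tmapLR g B) (hB A A' g hg)
  have hc : ∀ z, assocInv R A' B X (tmapL R g (Tens R B X) z) =
      tmapL R (tmapLR g B) X (assocInv R A B X z) := by
    have : (assocInv R A' B X).comp (tmapL R g (Tens R B X)) =
        (tmapL R (tmapLR g B) X).comp (assocInv R A B X) := by
      refine tens_hom_ext R fun a z => ?_
      induction z using tens_induction R with
      | h0 => simp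
      | hm b x => rfl
      | ha x y hx hy => rw [map_add, map_add, map_add, hx, hy]
    exact DFunLike.congr_fun this
  intro z w hzw
  have := h ((hc z).symm.trans ((congrArg _ hzw).trans (hc w)))
  rw [← assocHom_assocInv z, this, assocHom_assocInv]

end

variable {R : Type u} [Ring R] {M : Type u} [AddCommGroup M] [Module R M] [Module Rᵐᵒᵖ M]
  [SMulCommClass R Rᵐᵒᵖ M]

section

variable {B : Type u} [AddCommGroup B] [Module R B] [Module Rᵐᵒᵖ B]
  [SMulCommClass R Rᵐᵒᵖ B] {X : Type u} [AddCommGroup X] [Module R X]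

instance tensRightSMulCommClass : SMulCommClass R Rᵐᵒᵖ (Tens R M B) where
  smul_comm r s z := by
    induction z using tens_induction R with
    | h0 => simp
    | hm a b => rfl
    | ha x y hx hy => rw [smul_add, smul_add, smul_add, smul_add, hx, hy]

variable (R M B X) in
/-- Associativity of the tensor product. -/
def assoc : Tens R (Tens R M B) X ≃ₗ[R] Tens R M (Tens R B X) where
  toFun := assocHom R M B X
  invFun := assocInv R M B X
  map_add' := map_add _
  map_smul' r z := by
    induction z using tens_induction R with
    | h0 => simp
    | hm z x =>
      induction z using tens_induction R with
      | h0 => simp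
      | hm m b => rfl
      | ha a b ha hb => simp only [map_add, AddMonoidHom.add_apply, smul_add, ha, hb]
    | ha a b ha hb => rw [smul_add, map_add, map_add, ha, hb, smul_add]
  left_inv := assocInv_assocHom
  right_inv := assocHom_assocInv

end

variable {X : Type u} [AddCommGroup X] [Module R X]

variable (R X) in
/-- `R ⊗ X = X`. -/
def baseTens : Tens R R X ≃ₗ[R] X where
  toFun := tlift R (AddMonoidHom.mk' (fun r => DistribSMul.toAddMonoidHom X r)
    (fun r s => by ext x; simp [add_smul])) (fun r s x => by simp [mul_smul])
  invFun := tmk R (1 : R)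
  map_add' := map_add _
  map_smul' r z := by
    induction z using tens_induction R with
    | h0 => simp
    | hm s x => rw [smul_tmk]; simp [mul_smul]
    | ha a b ha hb => rw [smul_add, map_add, map_add, ha, hb, smul_add]
  left_inv z := by
    induction z using tens_induction R with
    | h0 => simp
    | hm s x =>
      change tmk R 1 (s • x) = _
      rw [← tmk_smul]; simp
    | ha a b ha hb => rw [map_add, map_add, ha, hb]
  right_inv x := one_smul R x

/-- Connects the tensor powers in `CondT` and `IsNilpotentBim` with iterates of M ⊗ -, the form in
which the inductions run. -/
theorem nonempty_powTens (i : ℕ) :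
    Nonempty (Tens R (TPow R M i) X ≃ₗ[R] ((tF R M)^[i] (ModuleCat.of R X) : ModuleCat R)) := by
  induction i with
  | zero => exact ⟨baseTens R X⟩
  | succ i ih =>
    rw [Function.iterate_succ_apply']
    obtain ⟨e⟩ := ih
    exact ⟨(assoc R M (TPow R M i) X).trans (tMEquiv e)⟩

variable (X) in
theorem IsNilpotentBim.nilAt {N : ℕ} (hN : IsNilpotentBim R M N) : NilAt R M (N + 1) X := by
  obtain ⟨e⟩ := nonempty_powTens (R := R) (M := M) (X := X) (N + 1)
  have : Subsingleton (TPow R M (N + 1)) := hN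
  have h : ∀ z : Tens R (TPow R M (N + 1)) X, z = 0 := fun z => by
    induction z using tens_induction R with
    | h0 => rfl
    | hm a b => rw [Subsingleton.elim a 0, map_zero]; rfl
    | ha x y hx hy => rw [hx, hy, add_zero]
  have : Subsingleton (Tens R (TPow R M (N + 1)) X) := ⟨fun a b => (h a).trans (h b).symm⟩
  exact e.symm.injective.subsingleton

theorem CondT.hAcyc (h : CondT R M) (hX : Module.Projective R X) : HAcyc R M X := by
  rintro (_ | i)
  -- `CondT` speaks only of i ≥ 1; for i = 0 the module is X itself, which is projective.
  · exact fun n => EV.of_projective hX n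
  · obtain ⟨e⟩ := nonempty_powTens (R := R) (M := M) (X := X) (i + 1)
    refine Acyc.retract e.symm.isRetract ?_
    exact ev_of_tor fun n hn => h X hX (i + 1) n (by omega) hn

end Assoc

/-! ### Extensions of left modules over the tensor ring -/

section LeftExt

variable {R : Type u} [Ring R] {M : Type u} [AddCommGroup M] [Module R M] [Module Rᵐᵒᵖ M]
  [SMulCommClass R Rᵐᵒᵖ M]

namespace LPair

variable {p q s : LPair R M} {W W' : Type u} [AddCommGroup W] [Module R W] [AddCommGroup W']
  [Module R W']

/-- The pair `(M ⊗ X, M ⊗ u)`. -/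
def tens (p : LPair R M) : LPair R M where
  X := Tens R M p.X
  u := tM M p.u

/-- The action `u : M ⊗ X → X` as a map of `T_R(M)`-modules. -/
def uMap (p : LPair R M) : p.tens.Mod →ₗ[TensorRing R M] p.Mod :=
  ofRes (p := p.tens) (q := p) p.u fun _ _ => rfl

theorem ses_u (hp : Function.Injective p.u) : IsSES p.u (LinearMap.range p.u).mkQ :=
  IsSES.coker hp

theorem ses_uMap {π : p.X →ₗ[R] W} (h : IsSES p.u π) :
    ∃ ψ : p.Mod →ₗ[TensorRing R M] (triv R M W).Mod, IsSES p.uMap ψ :=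
  ⟨ofRes (q := triv R M W) π fun _ _ => h.exact.apply_apply_eq_zero _, h.inj, h.exact, h.surj⟩

theorem isRetract_triv (h : IsRetract R W W') :
    IsRetract (TensorRing R M) (triv R M W).Mod (triv R M W').Mod := by
  obtain ⟨i, r, hr⟩ := h
  refine ⟨ofRes (p := triv R M W) (q := triv R M W') i fun _ _ => map_zero i,
    ofRes (p := triv R M W') (q := triv R M W) r fun _ _ => map_zero r, ?_⟩
  exact LinearMap.ext fun x => LinearMap.congr_fun hr x

/-- 0 → M ⊗ X → X → W → 0 is a sequence of T-modules with zero action on W. Iterating it filters `p`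
with layers M^{⊗i} ⊗ W, and nilpotency makes the filtration finite. -/
theorem ev_of_filtration {X : Type u} [AddCommGroup X] [Module (TensorRing R M) X] {n : ℕ}
    {π : p.X →ₗ[R] W} (h : IsSES p.u π) (hW : HAcyc R M W) {k : ℕ} (hk : NilAt R M k p.X)
    (hX : ∀ i, EV (TensorRing R M) n X
      (triv R M ((tF R M)^[i] (ModuleCat.of R W) : ModuleCat R)).Mod) :
    EV (TensorRing R M) n X p.Mod := by
  induction k generalizing p W with
  | zero =>
    have : Subsingleton p.Mod := hk
    exact EV.of_subsingleton_snd n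
  | succ k ih =>
    obtain ⟨ψ, hψ⟩ := ses_uMap h
    exact EV.snd_mid hψ (ih (p := p.tens) (h.tM (hW 0 0)) hW.tens hk fun i => hX (i + 1)) (hX 0)

theorem exists_presentation (p : LPair R M) : ∃ (L : Type u) (_ : AddCommGroup L) (_ : Module R L)
    (K : LPair R M) (f : K.Mod →ₗ[TensorRing R M] (ind R M L).Mod)
    (g : (ind R M L).Mod →ₗ[TensorRing R M] p.Mod), Module.Projective R L ∧ IsSES f g := by
  obtain ⟨g, hg⟩ := exists_surjective_finsupp R p.X
  have hs : Function.Surjective (indLift g) := fun x => by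
    obtain ⟨w, rfl⟩ := hg x
    exact ⟨_, indLift_unit g w⟩
  obtain ⟨K, ⟨e⟩⟩ := exists_lpair (R := R) (M := M) (LinearMap.ker (indLift g))
  exact ⟨_, _, _, K, _, _, inferInstance, (IsSES.ker hs).congr_left e⟩

theorem ev_ind_of_projective (hW : Module.Projective R W) {Y : Type u} [AddCommGroup Y]
    [Module (TensorRing R M) Y] (n : ℕ) : EV (TensorRing R M) (n + 1) (ind R M W).Mod Y :=
  EV.of_projective (ind_projective hW) n

theorem ev_cInd (hW : Module.Projective R W) (n : ℕ) : EV R (n + 1) (ind R M W).C W' :=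
  (EV.of_projective hW n).retract_fst cInd.isRetract

theorem extend_c {φ : p.Mod →ₗ[TensorRing R M] q.Mod} {ψ : q.Mod →ₗ[TensorRing R M] s.Mod}
    (h : IsSES φ ψ) (hs : EV (TensorRing R M) 1 s.Mod (triv R M W).Mod) (χ : p.C →ₗ[R] W) :
    ∃ χ' : q.C →ₗ[R] W, χ' ∘ₗ cMap φ = χ := by
  obtain ⟨f, hf⟩ := EV.extend h hs (toTriv χ)
  obtain ⟨χ', rfl⟩ := exists_toTriv f
  exact ⟨χ', toTriv_injective hf⟩

/-- For a presentation of p by an induced module with kernel K, the kernel of u embeds in that of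
K.C → (ind R M L).C. An embedding of K.C into an injective module extends over the target, so that
kernel is zero. -/
theorem u_injective_of_ev
    (h : ∀ (V : Type u) [AddCommGroup V] [Module R V], Module.Injective R V →
      EV (TensorRing R M) 1 p.Mod (triv R M V).Mod) : Function.Injective p.u := by
  obtain ⟨L, _, _, K, f, g, -, hs⟩ := p.exists_presentation
  refine u_injective_right hs ind_u_injective ?_
  obtain ⟨V, _, _, j, hV, hj⟩ := exists_injective_embedding R K.C
  obtain ⟨χ, hχ⟩ := extend_c hs (h V hV) j
  have : Function.Injective (χ ∘ₗ cMap f) := hχ ▸ hj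
  exact Function.Injective.of_comp this

theorem ev_c_of_ev (hp : Function.Injective p.u)
    (h : EV (TensorRing R M) 1 p.Mod (triv R M W).Mod) : EV R 1 p.C W := by
  obtain ⟨L, _, _, K, f, g, hL, hs⟩ := p.exists_presentation
  exact EV.of_extend (ses_cMap hs hp) (ev_cInd hL 0) (extend_c hs h)

variable {N : ℕ}

theorem acyc_of_hAcyc (hN : IsNilpotentBim R M N) {π : p.X →ₗ[R] W} (h : IsSES p.u π)
    (hW : HAcyc R M W) : Acyc R M p.X :=
  acyc_of_ses h hW (hN.nilAt _)

/-- Since u is injective, a presentation of p gives a short exact sequence of cokernels with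
projective middle term, and maps to (W, 0) are maps of cokernels to W. Both hypotheses on p pass to
its syzygy, so dimension shifting runs in parallel over T and R. -/
theorem ev_triv_iff (hN : IsNilpotentBim R M N)
    (hP : ∀ (L : Type u) [AddCommGroup L] [Module R L], Module.Projective R L → HAcyc R M L)
    (hp : Function.Injective p.u) (ha : Acyc R M p.X) (n : ℕ) :
    EV (TensorRing R M) (n + 1) p.Mod (triv R M W).Mod ↔ EV R (n + 1) p.C W := by
  induction n generalizing p with
  | zero =>
    refine ⟨ev_c_of_ev hp, fun h => ?_⟩
    obtain ⟨L, _, _, K, f, g, hL, hs⟩ := p.exists_presentation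
    refine EV.of_extend hs (ev_ind_of_projective hL 0) fun φ => ?_
    obtain ⟨χ, rfl⟩ := exists_toTriv φ
    obtain ⟨χ', rfl⟩ := EV.extend (ses_cMap hs hp) h χ
    exact ⟨toTriv χ', rfl⟩
  | succ n ih =>
    obtain ⟨L, _, _, K, f, g, hL, hs⟩ := p.exists_presentation
    -- Tor_1(M, X) = 0 keeps M ⊗ K.X → M ⊗ (T ⊗ L) injective, and the action on T ⊗ L is injective.
    have hK : Function.Injective K.u :=
      u_injective_left (φ := f) ind_u_injective ((ses_res hs).tM (ha 0)).inj
    have haK : Acyc R M K.X := fun m =>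
      EV.fst_left (ses_res hs) (acyc_of_hAcyc hN ind_ses (hP L hL) m) (ha (m + 1))
    have hc := ses_cMap hs hp
    constructor
    · intro h
      exact EV.fst_right hc ((ih hK haK).1 (EV.fst_left hs (ev_ind_of_projective hL n) h))
        (ev_cInd hL (n + 1))
    · intro h
      exact EV.fst_right hs ((ih hK haK).2 (EV.fst_left hc (ev_cInd hL n) h))
        (ev_ind_of_projective hL (n + 1))

/-- Syzygies lower the bound k on Tor(M, X) to zero. One more is needed, hence k + 1: an acyclic X
may have a noninjective action, but its syzygy has an injective one, and then `ev_triv_iff` leads to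
Ext_R into an injective module. -/
theorem ev_triv_of_injective (hN : IsNilpotentBim R M N)
    (hP : ∀ (L : Type u) [AddCommGroup L] [Module R L], Module.Projective R L → HAcyc R M L)
    {k : ℕ} (hk : ∀ n, k ≤ n → EV R (n + 1) p.X (Ch M)) (hW : Module.Injective R W) (n : ℕ)
    (hn : k + 1 ≤ n) : EV (TensorRing R M) (n + 1) p.Mod (triv R M W).Mod := by
  induction k generalizing p n with
  | zero =>
    obtain ⟨n, rfl⟩ : ∃ m, n = m + 1 := ⟨n - 1, by omega⟩
    obtain ⟨L, _, _, K, f, g, hL, hs⟩ := p.exists_presentation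
    have ha : Acyc R M p.X := fun m => hk m (Nat.zero_le _)
    have hK : Function.Injective K.u :=
      u_injective_left (φ := f) ind_u_injective ((ses_res hs).tM (ha 0)).inj
    have haK : Acyc R M K.X := fun m =>
      EV.fst_left (ses_res hs) (acyc_of_hAcyc hN ind_ses (hP L hL) m) (ha (m + 1))
    exact EV.fst_right hs ((ev_triv_iff hN hP hK haK n).2 (EV.of_injective hW n))
      (ev_ind_of_projective hL (n + 1))
  | succ k ih =>
    obtain ⟨n, rfl⟩ : ∃ m, n = m + 1 := ⟨n - 1, by omega⟩
    obtain ⟨L, _, _, K, f, g, hL, hs⟩ := p.exists_presentation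
    refine EV.fst_right hs (ih (fun m hm => ?_) n (by omega)) (ev_ind_of_projective hL (n + 1))
    exact EV.fst_left (ses_res hs) (acyc_of_hAcyc hN ind_ses (hP L hL) m) (hk (m + 1) (by omega))

/-- The functor `T_R(M) ⊗ -` on maps. -/
def indMap (f : W →ₗ[R] W') : (ind R M W).Mod →ₗ[TensorRing R M] (ind R M W').Mod :=
  indLift (p := ind R M W') (indUnit R M W' ∘ₗ f)

theorem res_counit (φ : p.Mod →ₗ[TensorRing R M] q.Mod) : res φ ∘ₗ p.u = q.u ∘ₗ tM M (res φ) :=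
  LinearMap.ext (res_u φ)

theorem counit_indLift {π : p.X →ₗ[R] W'} (hπ : π ∘ₗ p.u = 0) (f : W →ₗ[R] p.X) :
    π ∘ₗ res (indLift f) = (π ∘ₗ f) ∘ₗ indCounit R M W := by
  have h : ofRes (q := triv R M W') π (fun m x => LinearMap.congr_fun hπ _) ∘ₗ indLift f =
      ofRes (p := ind R M W) (q := triv R M W') ((π ∘ₗ f) ∘ₗ indCounit R M W)
        (fun m x => (congrArg (π ∘ₗ f) (indCounit_u _)).trans (map_zero _)) :=
    ind_ext fun w => (congrArg π (indLift_unit f w)).trans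
      (congrArg (π ∘ₗ f) (indCounit_unit w).symm)
  exact LinearMap.ext fun x => LinearMap.congr_fun h x

/-- The action of M on the cokernel of φ is surjective, so that cokernel is zero by
`subsingleton_of_surjective`. -/
theorem surjective_of_cMap (hN : IsNilpotentBim R M N) {φ : p.Mod →ₗ[TensorRing R M] q.Mod}
    (h : Function.Surjective (cMap φ)) : Function.Surjective φ := by
  obtain ⟨c, ⟨e⟩⟩ := exists_lpair (R := R) (M := M) (q.Mod ⧸ LinearMap.range φ)
  let ψ : q.Mod →ₗ[TensorRing R M] c.Mod := e.symm.toLinearMap ∘ₗ (LinearMap.range φ).mkQ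
  have hψ : Function.Surjective (res ψ) :=
    e.symm.surjective.comp (Submodule.mkQ_surjective (LinearMap.range φ))
  have h0 : ∀ x, res ψ (res φ x) = 0 := fun x => by
    have : (LinearMap.range φ).mkQ (φ x) = 0 :=
      (Submodule.Quotient.mk_eq_zero _).2 ⟨x, rfl⟩
    exact (congrArg e.symm this).trans (map_zero _)
  have hc : Function.Surjective c.u := by
    intro y
    obtain ⟨y, rfl⟩ := hψ y
    obtain ⟨x, hx⟩ := h ((LinearMap.range q.u).mkQ y)
    obtain ⟨x, rfl⟩ := Submodule.mkQ_surjective _ x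
    rw [cMap_mkQ, ← sub_eq_zero, ← map_sub, mkQ_eq_zero] at hx
    obtain ⟨z, hz⟩ := hx
    refine ⟨-tM M (res ψ) z, ?_⟩
    rw [map_neg, ← res_u, hz, map_sub, h0, zero_sub, neg_neg]
  have : Subsingleton c.X := subsingleton_of_surjective hc (hN.nilAt _)
  intro y
  have hy : e.symm ((LinearMap.range φ).mkQ y) = e.symm 0 := Subsingleton.elim (α := c.X) _ _
  have := e.symm.injective hy
  rwa [Submodule.mkQ_apply, Submodule.Quotient.mk_eq_zero] at this

/-- The section σ extends to a T-linear map T ⊗ W → X that is the identity on cokernels; nilpotency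
makes such a map injective and surjective. -/
theorem nonempty_ind_equiv (hN : IsNilpotentBim R M N) {π : p.X →ₗ[R] W} (h : IsSES p.u π)
    (hW : HAcyc R M W) (σ : W →ₗ[R] p.X) (hσ : π ∘ₗ σ = LinearMap.id) :
    Nonempty ((ind R M W).Mod ≃ₗ[TensorRing R M] p.Mod) := by
  have h1 : π ∘ₗ res (indLift σ) = LinearMap.id ∘ₗ indCounit R M W := by
    rw [counit_indLift (LinearMap.ext fun x => h.exact.apply_apply_eq_zero x), hσ]
  have hK : HAcyc R M PUnit.{u + 1} := hW.retract ⟨0, 0, Subsingleton.elim _ _⟩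
  -- The identity of W, with cokernel zero, plays the role of the map of cokernels in
  -- `injective_of_ses`.
  have hid : IsSES (LinearMap.id : W →ₗ[R] W) (0 : W →ₗ[R] PUnit.{u + 1}) :=
    ⟨fun _ _ h => h, fun x => ⟨fun _ => ⟨x, rfl⟩, fun _ => rfl⟩, fun _ => ⟨0, rfl⟩⟩
  have hinj : Function.Injective (res (indLift σ)) :=
    injective_of_ses ind_ses h hid (res_counit (indLift σ)) h1 hW hK (hN.nilAt _)
  have hsurj : Function.Surjective (indLift σ) := by
    refine surjective_of_cMap hN fun y => ?_
    obtain ⟨y, rfl⟩ := Submodule.mkQ_surjective _ y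
    refine ⟨(LinearMap.range (ind R M W).u).mkQ (indUnit R M W (π y)), ?_⟩
    refine (congrArg (LinearMap.range p.u).mkQ (indLift_unit σ (π y))).trans ?_
    rw [← sub_eq_zero, ← map_sub, mkQ_eq_zero]
    refine (h.exact _).1 ?_
    rw [map_sub, ← LinearMap.comp_apply, hσ, LinearMap.id_apply, sub_self]
  exact ⟨LinearEquiv.ofBijective (indLift σ) ⟨hinj, hsurj⟩⟩

/-- The kernel of T ⊗ W → (W, 0) is therefore induced from M ⊗ W, so (W, 0) has a two-term
resolution by induced modules. -/
theorem tens_ind_equiv (hN : IsNilpotentBim R M N) (hW : HAcyc R M W) :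
    Nonempty ((ind R M (Tens R M W)).Mod ≃ₗ[TensorRing R M] (ind R M W).tens.Mod) :=
  nonempty_ind_equiv hN (p := (ind R M W).tens) (ind_ses.tM (hW 0 0)) hW.tens (tM M (indUnit R M W))
    ((tM_comp _ _).symm.trans ((congrArg (tM M) (LinearMap.ext indCounit_unit)).trans tM_id))

theorem res_indMap (f : W →ₗ[R] W') (z : Tens R (TensorRing R M) W) :
    res (indMap f) z = tmapR R (TensorRing R M) f z := by
  have : (res (indMap f)).toAddMonoidHom = tmapR R (TensorRing R M) f :=
    tens_hom_ext R (A := TensorRing R M) (B := W) fun t w =>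
      (res_tmk (p := ind R M W') LinearMap.id t (f w)).symm
  exact DFunLike.congr_fun this z

/-- Acyclicity enters only for injectivity, through `injective_of_ses`; the rest is right exactness
of the tensor product. -/
theorem ses_indMap (hN : IsNilpotentBim R M N) {A B C : Type u} [AddCommGroup A] [Module R A]
    [AddCommGroup B] [Module R B] [AddCommGroup C] [Module R C] {f : A →ₗ[R] B} {g : B →ₗ[R] C}
    (h : IsSES f g) (hB : HAcyc R M B) (hC : HAcyc R M C) :
    IsSES (indMap (M := M) f) (indMap (M := M) g) where
  inj := by
    refine injective_of_ses (R := R) (M := M) (f := res (indMap f)) ind_ses ind_ses h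
      (res_counit _) ?_ hB hC (hN.nilAt _)
    refine (counit_indLift (p := ind R M B) (LinearMap.ext indCounit_u) _).trans ?_
    exact LinearMap.ext fun x => indCounit_unit (f (indCounit R M A x))
  exact z := by
    have hz := tmapR_exact (A := TensorRing R M) h.exact h.surj z
    constructor
    · intro h1
      obtain ⟨w, hw⟩ := hz.1 ((res_indMap g z).symm.trans h1)
      exact ⟨w, (res_indMap f w).trans hw⟩
    · rintro ⟨w, hw⟩
      exact (res_indMap g z).trans (hz.2 ⟨w, (res_indMap f w).symm.trans hw⟩)
  surj z := by
    obtain ⟨w, hw⟩ := tmapR_surjective (A := TensorRing R M) h.surj z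
    exact ⟨w, (res_indMap g w).trans hw⟩

end LPair
end LeftExt

/-! ### Transfer of relative Gorenstein classes -/

section Transfer

theorem IsSES.congr_mid {S : Type u} [Ring S] {A B B' C : Type u} [AddCommGroup A] [Module S A]
    [AddCommGroup B] [Module S B] [AddCommGroup B'] [Module S B'] [AddCommGroup C] [Module S C]
    {f : A →ₗ[S] B} {g : B →ₗ[S] C} (h : IsSES f g) (e : B ≃ₗ[S] B') :
    IsSES ((e : B →ₗ[S] B') ∘ₗ f) (g ∘ₗ (e.symm : B' →ₗ[S] B)) where
  inj := e.injective.comp h.inj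
  exact y := by
    refine (h.exact (e.symm y)).trans ⟨fun ⟨x, hx⟩ => ⟨x, ?_⟩, fun ⟨x, hx⟩ => ⟨x, ?_⟩⟩
    · exact (congrArg e hx).trans (e.apply_symm_apply y)
    · exact ((congrArg e.symm hx).symm.trans (e.symm_apply_apply (f x))).symm
  surj := h.surj.comp e.symm.surjective

theorem IsSES.nonempty_equiv {S : Type u} [Ring S] {A B C A' B' C' : Type u} [AddCommGroup A]
    [Module S A] [AddCommGroup B] [Module S B] [AddCommGroup C] [Module S C] [AddCommGroup A']
    [Module S A'] [AddCommGroup B'] [Module S B'] [AddCommGroup C'] [Module S C']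
    {f : A →ₗ[S] B} {g : B →ₗ[S] C} {f' : A' →ₗ[S] B'} {g' : B' →ₗ[S] C'} (h : IsSES f g)
    (h' : IsSES f' g') (a : A ≃ₗ[S] A') (b : B ≃ₗ[S] B') (hab : ∀ x, b (f x) = f' (a x)) :
    Nonempty (C ≃ₗ[S] C') := by
  refine ⟨(g.quotKerEquivOfSurjective h.surj).symm.trans ((Submodule.Quotient.equiv _ _ b ?_).trans
    (g'.quotKerEquivOfSurjective h'.surj))⟩
  rw [h.exact.linearMap_ker_eq, h'.exact.linearMap_ker_eq]
  ext y
  constructor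
  · rintro ⟨_, ⟨x, rfl⟩, rfl⟩
    exact ⟨a x, (hab x).symm⟩
  · rintro ⟨x, rfl⟩
    exact ⟨f (a.symm x), ⟨_, rfl⟩, (hab _).trans (by simp)⟩

/-- Descending dimension shift: degree n at one member of the class follows from degree n + 1 at
another, and all large degrees are known. -/
theorem forall_of_shift {α : Type*} {c : α → Prop} {P : ℕ → α → Prop}
    (h : ∀ a, c a → ∃ b, c b ∧ ∀ n, P (n + 1) b → P n a) {k : ℕ}
    (hk : ∀ n, k ≤ n → ∀ a, c a → P n a) (n : ℕ) (a : α) (ha : c a) : P n a := by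
  suffices ∀ j n a, c a → k ≤ n + j → P n a from this k n a ha (Nat.le_add_left _ _)
  intro j
  induction j with
  | zero => exact fun n a ha hn => hk n hn a ha
  | succ j ih =>
    intro n a ha hn
    obtain ⟨b, hb, hP⟩ := h a ha
    exact hP n (ih (n + 1) b hb (by omega))

variable {R : Type u} [Ring R] {M : Type u} [AddCommGroup M] [Module R M] [Module Rᵐᵒᵖ M]
  [SMulCommClass R Rᵐᵒᵖ M]

/-- Vanishing of Tor(M, -) in high degrees is shifted down along a coresolution by acyclic modules.
The tensored coresolution is again one of this kind, which takes care of the iterates. -/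
theorem acyc_iterate_of_class {k : ℕ}
    (hk : ∀ n, k ≤ n → ∀ (Y : Type u) [AddCommGroup Y] [Module R Y], EV R (n + 1) Y (Ch M))
    (c : ModuleCat.{u} R → Prop)
    (hc : ∀ X, c X → ∃ (P X' : ModuleCat.{u} R) (f : X →ₗ[R] P) (g : P →ₗ[R] X'),
      IsSES f g ∧ HAcyc R M P ∧ c X') (i : ℕ) (X : ModuleCat.{u} R) (hX : c X) :
    Acyc R M ((tF R M)^[i] X) := by
  have h0 : ∀ (c : ModuleCat.{u} R → Prop), (∀ X, c X → ∃ (P X' : ModuleCat.{u} R)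
      (f : X →ₗ[R] P) (g : P →ₗ[R] X'), IsSES f g ∧ HAcyc R M P ∧ c X') →
      ∀ X : ModuleCat.{u} R, c X → Acyc R M X := by
    intro c hc X hX n
    refine forall_of_shift (P := fun n (X : ModuleCat.{u} R) => EV R (n + 1) X (Ch M)) (c := c)
      ?_ (fun n hn X _ => hk n hn X) n X hX
    intro X hX
    obtain ⟨P, X', f, g, hs, hP, hX'⟩ := hc X hX
    exact ⟨X', hX', fun n hn => EV.fst_left hs (hP.acyc n) hn⟩
  induction i generalizing c X with
  | zero => exact h0 c hc X hX
  | succ i ih =>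
    refine ih (fun Y => ∃ X, c X ∧ Y = tF R M X) ?_ (tF R M X) ⟨X, hX, rfl⟩
    rintro _ ⟨X, hX, rfl⟩
    obtain ⟨P, X', f, g, hs, hP, hX'⟩ := hc X hX
    exact ⟨tF R M P, tF R M X', tM M f, tM M g, hs.tM (h0 c hc X' hX' 0), hP.tens, X', hX', rfl⟩

theorem Gor.hAcyc {𝒬 𝒲 : ∀ (X : Type u) [AddCommGroup X] [Module R X], Prop} {k : ℕ}
    (hk : ∀ n, k ≤ n → ∀ (Y : Type u) [AddCommGroup Y] [Module R Y], EV R (n + 1) Y (Ch M))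
    (hQ : ∀ (H : Type u) [AddCommGroup H] [Module R H], 𝒬 H → HAcyc R M H)
    {G : Type u} [AddCommGroup G] [Module R G] (hG : Gor R 𝒬 𝒲 G) : HAcyc R M G := by
  intro i
  refine acyc_iterate_of_class hk (fun X => Gor R 𝒬 𝒲 X) (fun X hX => ?_) i (ModuleCat.of R G) hG
  obtain ⟨P, _, _, G', _, _, f, g, hs, hP, hG⟩ := hX.step
  exact ⟨ModuleCat.of R P, ModuleCat.of R G', f, g, hs, hQ P hP, hG⟩

namespace LPair

variable {p : LPair R M} {N : ℕ}

theorem ses_toTriv (hp : Function.Injective p.u) :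
    IsSES p.uMap (toTriv (LinearMap.id : p.C →ₗ[R] p.C)) :=
  ⟨(ses_u hp).inj, (ses_u hp).exact, (ses_u hp).surj⟩

/-- The obstruction to lifting p → (q.C, 0) along q → (q.C, 0) lies in Ext^1_T(p, M ⊗ q). That
module is filtered by (M^{⊗(i+1)} ⊗ q.C, 0), and `ev_triv_iff` brings each layer back to R. -/
theorem exists_lift (hN : IsNilpotentBim R M N)
    (hP : ∀ (L : Type u) [AddCommGroup L] [Module R L], Module.Projective R L → HAcyc R M L)
    (hp : Function.Injective p.u) (hc : HAcyc R M p.C) {q : LPair R M}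
    (hq : Function.Injective q.u) (hqc : HAcyc R M q.C) (f : p.C →ₗ[R] q.C)
    (hev : ∀ i, EV R 1 p.C ((tF R M)^[i + 1] (ModuleCat.of R q.C) : ModuleCat R)) :
    ∃ φ : p.Mod →ₗ[TensorRing R M] q.Mod, cMap φ = f := by
  have hev' : EV (TensorRing R M) 1 p.Mod q.tens.Mod :=
    ev_of_filtration (p := q.tens) ((ses_u hq).tM (hqc 0 0)) hqc.tens (hN.nilAt _) fun i =>
      (ev_triv_iff hN hP hp (acyc_of_hAcyc hN (ses_u hp) hc) 0).2 (hev i)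
  obtain ⟨φ, hφ⟩ := EV.lift (ses_toTriv hq) hev' (toTriv f)
  rw [toTriv_comp] at hφ
  exact ⟨φ, toTriv_injective hφ⟩

theorem injective_of_cMap (hN : IsNilpotentBim R M N) {q : LPair R M}
    (hp : Function.Injective p.u) (hq : Function.Injective q.u)
    {φ : p.Mod →ₗ[TensorRing R M] q.Mod} {G' : Type u} [AddCommGroup G'] [Module R G']
    {g : q.C →ₗ[R] G'} (hs : IsSES (cMap φ) g) (hH : HAcyc R M q.C) (hG' : HAcyc R M G') :
    Function.Injective φ :=
  injective_of_ses (f := res φ) (ses_u hp) (ses_u hq) hs (res_counit φ) rfl hH hG' (hN.nilAt _)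

/-- The map p.C → H lifts to p → T ⊗ H, which is injective because it is so on cokernels. By the
snake lemma its cokernel has injective action, and the cokernel of that action is H modulo p.C. -/
theorem exists_embedding (hN : IsNilpotentBim R M N)
    (hP : ∀ (L : Type u) [AddCommGroup L] [Module R L], Module.Projective R L → HAcyc R M L)
    (hp : Function.Injective p.u) (hc : HAcyc R M p.C) {H G' : Type u} [AddCommGroup H]
    [Module R H] [AddCommGroup G'] [Module R G'] {f : p.C →ₗ[R] H} {g : H →ₗ[R] G'}
    (hs : IsSES f g) (hH : HAcyc R M H) (hG' : HAcyc R M G')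
    (hev : ∀ i, EV R 1 p.C ((tF R M)^[i + 1] (ModuleCat.of R H) : ModuleCat R)) :
    ∃ (p' : LPair R M) (φ : p.Mod →ₗ[TensorRing R M] (ind R M H).Mod)
      (ψ : (ind R M H).Mod →ₗ[TensorRing R M] p'.Mod), IsSES φ ψ ∧ Function.Injective p'.u ∧
        Nonempty (p'.C ≃ₗ[R] G') := by
  have hr : IsRetract R (ind R M H).C H := cInd.isRetract
  obtain ⟨φ, h3⟩ := exists_lift hN hP hp hc ind_u_injective (hH.retract hr)
    ((cInd (R := R) (M := M) (W := H)).symm.toLinearMap ∘ₗ f)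
    fun i => (hev i).retract_snd (hr.iterate (i + 1))
  have hs' := hs.congr_mid (cInd (R := R) (M := M) (W := H)).symm
  rw [← h3] at hs'
  have hinj : Function.Injective φ :=
    injective_of_cMap hN hp ind_u_injective hs' (hH.retract hr) hG'
  obtain ⟨p', ⟨e⟩⟩ := exists_lpair (R := R) (M := M) ((ind R M H).Mod ⧸ LinearMap.range φ)
  have hses' := (IsSES.coker hinj).congr_right e.symm
  have hp' := u_injective_right hses' ind_u_injective hs'.inj
  exact ⟨p', φ, _, hses', hp', (ses_cMap hses' hp').nonempty_equiv hs' (LinearEquiv.refl R _)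
    (LinearEquiv.refl R _) fun _ => rfl⟩

variable {𝒬 𝒲 : ∀ (X : Type u) [AddCommGroup X] [Module R X], Prop}
  {𝒬T 𝒲T : ∀ (X : Type u) [AddCommGroup X] [Module (TensorRing R M) X], Prop}

/-- `exists_embedding` closes the class of such pairs under the step of `Gor`. `h2` asks for one
suitable step over R instead of taking an arbitrary one, because in the flat case the embedding has
to be chosen. -/
theorem gor_of_cokernel (hN : IsNilpotentBim R M N)
    (hP : ∀ (L : Type u) [AddCommGroup L] [Module R L], Module.Projective R L → HAcyc R M L)
    (h1 : ∀ (G : Type u) [AddCommGroup G] [Module R G], Gor R 𝒬 𝒲 G → HAcyc R M G)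
    (h2 : ∀ (G : Type u) [AddCommGroup G] [Module R G], Gor R 𝒬 𝒲 G →
      ∃ (H : Type u) (_ : AddCommGroup H) (_ : Module R H) (G' : Type u) (_ : AddCommGroup G')
        (_ : Module R G') (f : G →ₗ[R] H) (g : H →ₗ[R] G'), IsSES f g ∧ HAcyc R M H ∧
        𝒬T (ind R M H).Mod ∧ Gor R 𝒬 𝒲 G' ∧
        ∀ i, EV R 1 G ((tF R M)^[i + 1] (ModuleCat.of R H) : ModuleCat R))
    (h3 : ∀ p : LPair R M, Function.Injective p.u → Acyc R M p.X → Gor R 𝒬 𝒲 p.C →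
      ∀ (W : Type u) [AddCommGroup W] [Module (TensorRing R M) W], 𝒲T W →
        ∀ n, EV (TensorRing R M) (n + 1) p.Mod W)
    (hp : Function.Injective p.u) (hc : Gor R 𝒬 𝒲 p.C) : Gor (TensorRing R M) 𝒬T 𝒲T p.Mod := by
  refine ⟨fun X _ _ => ∃ p : LPair R M, Nonempty (X ≃ₗ[TensorRing R M] p.Mod) ∧
    Function.Injective p.u ∧ Gor R 𝒬 𝒲 p.C, ⟨p, ⟨LinearEquiv.refl _ _⟩, hp, hc⟩, ?_⟩
  rintro X _ _ ⟨p, ⟨e⟩, hp, hc⟩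
  refine ⟨fun W _ _ hW n => (h3 p hp (acyc_of_hAcyc hN (ses_u hp) (h1 _ hc)) hc W hW n).retract_fst
    e.isRetract, ?_⟩
  obtain ⟨H, _, _, G', _, _, f, g, hs, hH, hHT, hG', hev⟩ := h2 p.C hc
  obtain ⟨p', φ, ψ, hs', hp', ⟨e'⟩⟩ := exists_embedding hN hP hp (h1 _ hc) hs hH (h1 _ hG') hev
  exact ⟨_, _, _, _, _, _, _, _, hs'.congr_left e, hHT, p', ⟨LinearEquiv.refl _ _⟩, hp',
    hG'.congr e'⟩

theorem exists_gor_step (hQ : ∀ (X Y : Type u) [AddCommGroup X] [Module (TensorRing R M) X]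
      [AddCommGroup Y] [Module (TensorRing R M) Y], (X ≃ₗ[TensorRing R M] Y) → 𝒬T Y → 𝒬T X)
    (hp : Gor (TensorRing R M) 𝒬T 𝒲T p.Mod) :
    ∃ (q p' : LPair R M) (f : p.Mod →ₗ[TensorRing R M] q.Mod)
      (g : q.Mod →ₗ[TensorRing R M] p'.Mod), IsSES f g ∧ 𝒬T q.Mod ∧
        Gor (TensorRing R M) 𝒬T 𝒲T p'.Mod := by
  obtain ⟨P, _, _, G', _, _, f, g, hs, hP, hG⟩ := hp.step
  obtain ⟨q, ⟨e⟩⟩ := exists_lpair (R := R) (M := M) P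
  obtain ⟨p', ⟨e'⟩⟩ := exists_lpair (R := R) (M := M) G'
  exact ⟨q, p', _, _, (hs.congr_mid e.symm).congr_right e'.symm, hQ _ _ e hP, hG.congr e'⟩

/-- `hk` gives vanishing in high degrees, and shifting along the coresolution of p yields
injectivity of u and acyclicity of X. The cokernels of the actions then form a coresolution over R,
and `ev_triv_iff` carries over the orthogonality. -/
theorem cokernel_of_gor (hN : IsNilpotentBim R M N)
    (hP : ∀ (L : Type u) [AddCommGroup L] [Module R L], Module.Projective R L → HAcyc R M L)
    {k : ℕ}
    (hk : ∀ n, k ≤ n → ∀ (Y : Type u) [AddCommGroup Y] [Module R Y], EV R (n + 1) Y (Ch M))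
    (hQ : ∀ (X Y : Type u) [AddCommGroup X] [Module (TensorRing R M) X]
      [AddCommGroup Y] [Module (TensorRing R M) Y], (X ≃ₗ[TensorRing R M] Y) → 𝒬T Y → 𝒬T X)
    (h1 : ∀ q : LPair R M, 𝒬T q.Mod → ∀ (V : Type u) [AddCommGroup V] [Module R V],
      Module.Injective R V → ∀ n, EV (TensorRing R M) (n + 1) q.Mod (triv R M V).Mod)
    (h2 : ∀ q : LPair R M, 𝒬T q.Mod → Function.Injective q.u → 𝒬 q.C)
    (h3 : ∀ (H : Type u) [AddCommGroup H] [Module R H], 𝒬 H → HAcyc R M H)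
    (h4 : ∀ (X : Type u) [AddCommGroup X] [Module (TensorRing R M) X],
      Gor (TensorRing R M) 𝒬T 𝒲T X → ∀ (W : Type u) [AddCommGroup W] [Module R W], 𝒲 W →
        ∀ n, EV (TensorRing R M) (n + 1) X (triv R M W).Mod)
    (hp : Gor (TensorRing R M) 𝒬T 𝒲T p.Mod) : Function.Injective p.u ∧ Gor R 𝒬 𝒲 p.C := by
  have hu : ∀ p : LPair R M, Gor (TensorRing R M) 𝒬T 𝒲T p.Mod → Function.Injective p.u := by
    refine fun p hp => u_injective_of_ev fun V _ _ hV => ?_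
    refine forall_of_shift (c := fun p : LPair R M => Gor (TensorRing R M) 𝒬T 𝒲T p.Mod)
      (P := fun n (p : LPair R M) => EV (TensorRing R M) (n + 1) p.Mod (triv R M V).Mod) ?_
      (fun n hn p _ => ev_triv_of_injective hN hP (fun n hn => hk n hn p.X) hV n hn) 0 p hp
    intro p hp
    obtain ⟨q, p', f, g, hs, hq, hp'⟩ := exists_gor_step hQ hp
    exact ⟨p', hp', fun n hn => EV.fst_left hs (h1 q hq V hV n) hn⟩
  have huq : ∀ q : LPair R M, 𝒬T q.Mod → Function.Injective q.u := fun q hq =>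
    u_injective_of_ev fun V _ _ hV => h1 q hq V hV 0
  have ha : ∀ p : LPair R M, Gor (TensorRing R M) 𝒬T 𝒲T p.Mod → Acyc R M p.X := by
    intro p hp n
    refine forall_of_shift (c := fun p : LPair R M => Gor (TensorRing R M) 𝒬T 𝒲T p.Mod)
      (P := fun n (p : LPair R M) => EV R (n + 1) p.X (Ch M)) ?_ (fun n hn p _ => hk n hn p.X) n p hp
    intro p hp
    obtain ⟨q, p', f, g, hs, hq, hp'⟩ := exists_gor_step hQ hp
    exact ⟨p', hp', fun n hn => EV.fst_left (ses_res hs)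
      (acyc_of_hAcyc hN (ses_u (huq q hq)) (h3 _ (h2 q hq (huq q hq))) n) hn⟩
  refine ⟨hu p hp, fun G _ _ => ∃ p : LPair R M, Gor (TensorRing R M) 𝒬T 𝒲T p.Mod ∧
    Nonempty (G ≃ₗ[R] p.C), ⟨p, hp, ⟨LinearEquiv.refl _ _⟩⟩, ?_⟩
  rintro G _ _ ⟨p, hp, ⟨e⟩⟩
  refine ⟨fun W _ _ hW n => ((ev_triv_iff hN hP (hu p hp) (ha p hp) n).1
    (h4 _ hp W hW n)).retract_fst e.isRetract, ?_⟩
  obtain ⟨q, p', f, g, hs, hq, hp'⟩ := exists_gor_step hQ hp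
  exact ⟨q.C, _, _, p'.C, _, _, _, _, (ses_cMap hs (hu p' hp')).congr_left e,
    h2 q hq (huq q hq), p', hp', ⟨LinearEquiv.refl _ _⟩⟩

end LPair
end Transfer

/-! ### Finite projective dimension -/

section Pd

/-- `X` has projective dimension at most `n`. -/
def PdLE (S : Type u) [Ring S] (n : ℕ) (X : Type u) [AddCommGroup X] [Module S X] : Prop :=
  ∀ m, n ≤ m → ∀ (Y : Type u) [AddCommGroup Y] [Module S Y], EV S (m + 1) X Y

variable {S : Type u} [Ring S] {X P K : Type u} [AddCommGroup X] [Module S X]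
  [AddCommGroup P] [Module S P] [AddCommGroup K] [Module S K] {n : ℕ}

theorem projective_of_ev (h : ∀ (Y : Type u) [AddCommGroup Y] [Module S Y], EV S 1 X Y) :
    Module.Projective S X := by
  obtain ⟨g, hg⟩ := exists_surjective_finsupp S X
  obtain ⟨s, hs⟩ := EV.lift (IsSES.ker hg) (h _) LinearMap.id
  exact Module.Projective.of_split s g hs

theorem PdLE.left {f : K →ₗ[S] P} {g : P →ₗ[S] X} (h : IsSES f g) (hP : Module.Projective S P)
    (hX : PdLE S (n + 1) X) : PdLE S n K :=
  fun m hm Y _ _ => EV.fst_left h (EV.of_projective hP m) (hX (m + 1) (by omega) Y)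

theorem PdLE.right {f : K →ₗ[S] P} {g : P →ₗ[S] X} (h : IsSES f g) (hP : PdLE S (n + 1) P)
    (hK : PdLE S n K) : PdLE S (n + 1) X := by
  rintro (_ | m) hm Y _ _
  · omega
  · exact EV.fst_right h (hK m (by omega) Y) (hP (m + 1) hm Y)

theorem PdLE.mono {n' : ℕ} (hX : PdLE S n X) (h : n ≤ n') : PdLE S n' X :=
  fun m hm Y _ _ => hX m (h.trans hm) Y

theorem PdLE.retract (h : IsRetract S X P) (hP : PdLE S n P) : PdLE S n X :=
  fun m hm Y _ _ => (hP m hm Y).retract_fst h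

theorem IsSES.finsupp (ι : Type u) {f : K →ₗ[S] P} {g : P →ₗ[S] X} (h : IsSES f g) :
    IsSES (Finsupp.mapRange.linearMap (α := ι) f) (Finsupp.mapRange.linearMap (α := ι) g) where
  inj := Finsupp.mapRange_injective _ (map_zero f) h.inj
  exact x := by
    constructor
    · intro hx
      have h1 : ∀ i, ∃ k, f k = x i := fun i => (h.exact _).1 (DFunLike.congr_fun hx i)
      choose k hk using h1
      classical
      refine ⟨Finsupp.onFinset x.support (fun i => if x i = 0 then 0 else k i) fun i hi => ?_, ?_⟩
      · exact Finsupp.mem_support_iff.2 fun h0 => hi (by simp [h0])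
      · ext i
        by_cases h0 : x i = 0
        · simp [h0]
        · simp [h0, hk]
    · rintro ⟨k, rfl⟩
      ext i
      exact h.exact.apply_apply_eq_zero _
  surj := Finsupp.mapRange_surjective _ (map_zero g) h.surj

theorem EV.finsupp {Y : Type u} [AddCommGroup Y] [Module S Y] (ι : Type u) (h : EV S (n + 1) X Y) :
    EV S (n + 1) (ι →₀ X) Y := by
  induction n generalizing X with
  | zero =>
    obtain ⟨g, hg⟩ := exists_surjective_finsupp S X
    have hs := IsSES.ker hg
    refine EV.of_extend (hs.finsupp ι) (EV.of_projective inferInstance 0) fun φ => ?_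
    -- The extension problem for a direct sum is solved on each summand separately.
    have h1 : ∀ i, ∃ ψ : (X →₀ S) →ₗ[S] Y, ψ ∘ₗ (LinearMap.ker g).subtype = φ ∘ₗ Finsupp.lsingle i :=
      fun i => EV.extend hs h _
    choose ψ hψ using h1
    refine ⟨Finsupp.lsum ℕ ψ, Finsupp.lhom_ext fun i x => ?_⟩
    refine Eq.trans ?_ (LinearMap.congr_fun (hψ i) x)
    simp
  | succ n ih =>
    obtain ⟨g, hg⟩ := exists_surjective_finsupp S X
    have hs := IsSES.ker hg
    exact EV.fst_right (hs.finsupp ι) (ih (EV.fst_left hs (EV.of_projective inferInstance n) h))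
      (EV.of_projective inferInstance (n + 1))

theorem PdLE.finsupp (ι : Type u) (hX : PdLE S n X) : PdLE S n (ι →₀ X) :=
  fun m hm Y _ _ => (hX m hm Y).finsupp ι

theorem Module.Projective.isRetract_finsupp (hX : Module.Projective S X) :
    IsRetract S X (X →₀ S) := by
  obtain ⟨g, hg⟩ := exists_surjective_finsupp S X
  obtain ⟨s, hs⟩ := Module.projective_lifting_property g LinearMap.id hg
  exact ⟨s, g, hs⟩

theorem Gor.ev_of_pdLE {𝒬 : ∀ (X : Type u) [AddCommGroup X] [Module S X], Prop}
    (hX : Gor S 𝒬 (fun X _ _ => Module.Projective S X) X) (hP : PdLE S n P) (m : ℕ) :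
    EV S (m + 1) X P := by
  induction n generalizing P m with
  | zero => exact hX.ev (projective_of_ev (hP 0 le_rfl)) m
  | succ n ih =>
    obtain ⟨g, hg⟩ := exists_surjective_finsupp S P
    have hs := IsSES.ker hg
    have hF : Module.Projective S (P →₀ S) := inferInstance
    exact EV.snd_right hs (hX.ev hF m) (ih (hP.left hs hF) (m + 1))

end Pd

/-! ### Projective dimension of M ⊗ X -/

section TensPd

variable {R : Type u} [Ring R] {M : Type u} [AddCommGroup M] [Module R M] [Module Rᵐᵒᵖ M]
  [SMulCommClass R Rᵐᵒᵖ M] {k n : ℕ} {X : Type u} [AddCommGroup X] [Module R X]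

variable (R M) in
/-- `M ⊗ R^{(ι)} → M^{(ι)}`. -/
def tensFinsupp (ι : Type u) : Tens R M (ι →₀ R) →+ (ι →₀ M) :=
  tlift R (AddMonoidHom.mk' (fun m => AddMonoidHom.mk'
      (fun f : ι →₀ R => f.mapRange (fun r => op r • m) (by simp))
      (fun f g => by ext i; simp [add_smul])) (fun m m' => by ext f i; simp))
    (fun r m f => by ext i; simp [mul_smul])

variable (R M) in
/-- `M^{(ι)} → M ⊗ R^{(ι)}`. -/
def finsuppTens (ι : Type u) : (ι →₀ M) →+ Tens R M (ι →₀ R) :=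
  Finsupp.liftAddHom fun i => (tmk R).flip (Finsupp.single i 1)

theorem finsuppTens_tensFinsupp (ι : Type u) (z : Tens R M (ι →₀ R)) :
    finsuppTens R M ι (tensFinsupp R M ι z) = z := by
  have : (finsuppTens R M ι).comp (tensFinsupp R M ι) = AddMonoidHom.id _ := by
    refine tens_hom_ext R fun m f => ?_
    induction f using Finsupp.induction_linear with
    | zero => simp
    | add f g hf hg => rw [map_add, map_add, hf, hg, map_add]
    | single i r =>
      have : tensFinsupp R M ι (tmk R m (Finsupp.single i r)) = Finsupp.single i (op r • m) :=
        Finsupp.mapRange_single (hf := by simp) ..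
      rw [AddMonoidHom.comp_apply, this, finsuppTens, Finsupp.liftAddHom_apply_single,
        AddMonoidHom.flip_apply, tmk_smul]
      simp
  exact DFunLike.congr_fun this z

theorem isRetract_tens_finsupp (ι : Type u) : IsRetract R (Tens R M (ι →₀ R)) (ι →₀ M) := by
  refine ⟨{ tensFinsupp R M ι with map_smul' := fun r z => ?_ },
    { finsuppTens R M ι with map_smul' := fun r z => ?_ },
    LinearMap.ext (finsuppTens_tensFinsupp ι)⟩
  · change tensFinsupp R M ι (r • z) = r • tensFinsupp R M ι z
    induction z using tens_induction R with
    | h0 => simp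
    | hm m f =>
      ext i
      exact (smul_comm r (op (f i)) m).symm
    | ha x y hx hy => rw [smul_add, map_add, map_add, hx, hy, smul_add]
  · change finsuppTens R M ι (r • z) = r • finsuppTens R M ι z
    induction z using Finsupp.induction_linear with
    | zero => simp
    | add f g hf hg => rw [smul_add, map_add, map_add, hf, hg, smul_add]
    | single i m =>
      rw [Finsupp.smul_single, finsuppTens, Finsupp.liftAddHom_apply_single,
        Finsupp.liftAddHom_apply_single]
      rfl

/-- For projective P, the module M ⊗ P is a summand of a direct sum of copies of M. Acyclicity keeps
M ⊗ - exact along a projective resolution of X. -/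
theorem pdLE_tens (hM : PdLE R k M) (hX : PdLE R n X) (ha : Acyc R M X) :
    PdLE R (k + n) (Tens R M X) := by
  have hproj : ∀ (P : Type u) [AddCommGroup P] [Module R P], Module.Projective R P →
      PdLE R k (Tens R M P) := fun P _ _ hP =>
    ((hM.finsupp P).retract (isRetract_tens_finsupp P)).retract
      (Module.Projective.isRetract_finsupp hP).tM
  induction n generalizing X with
  | zero => exact hproj X (projective_of_ev (hX 0 le_rfl))
  | succ n ih =>
    obtain ⟨g, hg⟩ := exists_surjective_finsupp R X
    have hs := IsSES.ker hg
    have hF : Module.Projective R (X →₀ R) := inferInstance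
    exact PdLE.right (hs.tM (ha 0)) ((hproj _ hF).mono (Nat.le_add_right k (n + 1))) (ih (hX.left hs hF)
      fun m => EV.fst_left hs (EV.of_projective hF m) (ha (m + 1)))

theorem exists_pdLE_iterate (hM : PdLE R k M) (hX : PdLE R n X) (ha : HAcyc R M X) (i : ℕ) :
    ∃ n, PdLE R n ((tF R M)^[i] (ModuleCat.of R X)) := by
  induction i generalizing n X with
  | zero => exact ⟨n, hX⟩
  | succ i ih => exact ih (pdLE_tens hM hX ha.acyc) ha.tens

end TensPd

/-! ### Gorenstein projective modules -/

section GorensteinProjective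

variable {R : Type u} [Ring R] {M : Type u} [AddCommGroup M] [Module R M] [Module Rᵐᵒᵖ M]
  [SMulCommClass R Rᵐᵒᵖ M] {N k n : ℕ} {p : LPair R M}

open LPair

/-- Induction stays exact along a projective resolution of W, since all syzygies remain acyclic, and
it sends projectives to projectives; X is orthogonal to these. -/
theorem ev_ind_of_pdLE (hN : IsNilpotentBim R M N)
    (hP : ∀ (L : Type u) [AddCommGroup L] [Module R L], Module.Projective R L → HAcyc R M L)
    {X W : Type u} [AddCommGroup X] [Module (TensorRing R M) X] [AddCommGroup W] [Module R W]
    (hX : Gor (TensorRing R M) (fun X _ _ => Module.Projective (TensorRing R M) X)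
      (fun X _ _ => Module.Projective (TensorRing R M) X) X) (hW : PdLE R n W) (ha : HAcyc R M W)
    (m : ℕ) : EV (TensorRing R M) (m + 1) X (ind R M W).Mod := by
  induction n generalizing W m with
  | zero => exact hX.ev (ind_projective (projective_of_ev (hW 0 le_rfl))) m
  | succ n ih =>
    obtain ⟨g, hg⟩ := exists_surjective_finsupp R W
    have hs := IsSES.ker hg
    have hF : Module.Projective R (W →₀ R) := inferInstance
    exact EV.snd_right (ses_indMap hN hs (hP _ hF) ha) (hX.ev (ind_projective hF) m)
      (ih (hW.left hs hF) ((hP _ hF).left hs ha) (m + 1))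

theorem exists_isRetract_ind {Q : Type u} [AddCommGroup Q] [Module (TensorRing R M) Q]
    (hQ : Module.Projective (TensorRing R M) Q) : ∃ (L : Type u) (_ : AddCommGroup L)
      (_ : Module R L), Module.Projective R L ∧
        IsRetract (TensorRing R M) Q (ind R M L).Mod := by
  obtain ⟨q, ⟨e⟩⟩ := exists_lpair (R := R) (M := M) Q
  obtain ⟨L, _, _, K, f, g, hL, hs⟩ := q.exists_presentation
  obtain ⟨s, h⟩ := Module.projective_lifting_property (e.toLinearMap ∘ₗ g) LinearMap.id
    (e.surjective.comp hs.surj)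
  exact ⟨L, _, _, hL, s, _, h⟩

theorem gp_iff_phi (hN : IsNilpotentBim R M N) (hT : CondT R M) (hM : PdLE R k M)
    (hk : ∀ m, n ≤ m → ∀ (Y : Type u) [AddCommGroup Y] [Module R Y], EV R (m + 1) Y (Ch M)) :
    GP (TensorRing R M) p.Mod ↔ Function.Injective p.u ∧ GP R p.C := by
  have hP : ∀ (L : Type u) [AddCommGroup L] [Module R L], Module.Projective R L → HAcyc R M L :=
    fun L _ _ hL => hT.hAcyc hL
  have hpd : ∀ (G : Type u) [AddCommGroup G] [Module R G],
      Gor R (fun X _ _ => Module.Projective R X) (fun X _ _ => Module.Projective R X) G →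
      ∀ (L : Type u) [AddCommGroup L] [Module R L], Module.Projective R L → ∀ i m,
        EV R (m + 1) G ((tF R M)^[i] (ModuleCat.of R L) : ModuleCat R) := by
    intro G _ _ hG L _ _ hL i m
    obtain ⟨d, hd⟩ := exists_pdLE_iterate hM (n := 0) (X := L)
      (fun m _ Y _ _ => EV.of_projective hL m) (hP L hL) i
    exact hG.ev_of_pdLE hd m
  rw [gp_iff, gp_iff]
  constructor
  · refine cokernel_of_gor hN hP hk (fun X Y _ _ _ _ e hY => Module.Projective.of_equiv e.symm)
      (fun q hq V _ _ hV m => EV.of_projective hq m)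
      (fun q hq hu => projective_of_ev fun Y _ _ => ev_c_of_ev hu (EV.of_projective hq 0))
      (fun H _ _ hH => hP H hH) ?_
    intro X _ _ hX W _ _ hW m
    have hPW := hP W hW
    obtain ⟨ψ, hψ⟩ := ses_uMap (p := ind R M W) ind_ses
    obtain ⟨e⟩ := tens_ind_equiv hN hPW
    have hd : PdLE R k (Tens R M W) :=
      pdLE_tens (n := 0) hM (fun m _ Y _ _ => EV.of_projective hW m) hPW.acyc
    -- In 0 → T ⊗ (M ⊗ W) → T ⊗ W → (W, 0) → 0 the middle term is projective, and M ⊗ W has finite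
    -- projective dimension, so Ext from X into the left term vanishes as well.
    exact EV.snd_right hψ (hX.ev (ind_projective hW) m)
      ((ev_ind_of_pdLE hN hP hX hd hPW.tens (m + 1)).retract_snd e.symm.isRetract)
  · rintro ⟨hu, hc⟩
    refine gor_of_cokernel hN hP (fun G _ _ hG => hG.hAcyc hk fun H _ _ hH => hP H hH) ?_ ?_ hu hc
    · intro G _ _ hG
      obtain ⟨P, _, _, G', _, _, f, g, hs, hP', hG'⟩ := hG.step
      exact ⟨P, _, _, G', _, _, f, g, hs, hP P hP', ind_projective hP', hG',
        fun i => hpd G hG P hP' (i + 1) 0⟩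
    · intro q hq ha hG W _ _ hW m
      -- A projective T-module is a summand of some T ⊗ L, with layers M^{⊗i} ⊗ L of finite
      -- projective dimension; Gorenstein projective R-modules are orthogonal to these.
      obtain ⟨L, _, _, hL, hr⟩ := exists_isRetract_ind hW
      exact (ev_of_filtration ind_ses (hP L hL) (hN.nilAt _) fun i =>
        (ev_triv_iff hN hP hq ha m).2 (hpd _ hG L hL i m)).retract_snd hr

end GorensteinProjective

/-! ### Gorenstein flat modules and characters -/

section FlatCharacters

theorem Ch.factor_of_exact {A B C : Type u} [AddCommGroup A] [AddCommGroup B] [AddCommGroup C]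
    {f : A →+ B} {g : B →+ C} (h : Function.Exact f g) (c : B →+ AddCircle (1 : ℚ))
    (hc : ∀ a, c (f a) = 0) : ∃ d : C →+ AddCircle (1 : ℚ), d.comp g = c := by
  have h' : Function.Exact f g.rangeRestrict := fun b => by
    rw [← h b]
    exact Subtype.ext_iff
  obtain ⟨d, hd⟩ := Ch.factor h' g.rangeRestrict_surjective c hc
  obtain ⟨e, he⟩ := Ch.extend g.range.subtype Subtype.val_injective d
  refine ⟨e, ?_⟩
  rw [← hd, ← he]
  rfl

theorem injective_of_ev {S : Type u} [Ring S] {Y : Type u} [AddCommGroup Y] [Module S Y]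
    (h : ∀ (X : Type u) [AddCommGroup X] [Module S X], EV S 1 X Y) : Module.Injective S Y where
  out X Z _ _ _ _ f hf g := by
    obtain ⟨ψ, hψ⟩ := EV.extend (IsSES.coker hf) (h _) g
    exact ⟨ψ, LinearMap.congr_fun hψ⟩

theorem injective_of_isRetract {S : Type u} [Ring S] {Y Z : Type u} [AddCommGroup Y] [Module S Y]
    [AddCommGroup Z] [Module S Z] (h : IsRetract S Y Z) (hZ : Module.Injective S Z) :
    Module.Injective S Y :=
  injective_of_ev fun _ _ _ => (EV.of_injective hZ 0).retract_snd h

theorem isRetract_of_injective {S : Type u} [Ring S] {Y Z : Type u} [AddCommGroup Y] [Module S Y]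
    [AddCommGroup Z] [Module S Z] (hY : Module.Injective S Y) {f : Y →ₗ[S] Z}
    (hf : Function.Injective f) : IsRetract S Y Z := by
  obtain ⟨r, hr⟩ := hY.out f hf LinearMap.id
  exact ⟨f, r, LinearMap.ext hr⟩

variable {R : Type u} [Ring R] {A A' : Type u} [AddCommGroup A] [Module Rᵐᵒᵖ A] [AddCommGroup A']
  [Module Rᵐᵒᵖ A'] {B B' B'' : Type u} [AddCommGroup B] [Module R B] [AddCommGroup B'] [Module R B']
  [AddCommGroup B''] [Module R B'']

theorem isFlatL_of_ev (h : ∀ (A : Type u) [AddCommGroup A] [Module Rᵐᵒᵖ A], EV R 1 B (Ch A)) :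
    IsFlatL R B :=
  isFlatL_iff.2 (injective_of_ev fun A _ _ => (ev_ch_iff 0).1 (h A))

theorem IsRetract.rCh (h : IsRetract R B B') : IsRetract Rᵐᵒᵖ (Ch B) (Ch B') := by
  obtain ⟨i, r, hr⟩ := h
  exact ⟨TR.rCh r, TR.rCh i, LinearMap.ext fun c => Ch.ext fun b =>
    congrArg c (LinearMap.congr_fun hr b)⟩

theorem IsRetract.lCh (h : IsRetract Rᵐᵒᵖ A A') : IsRetract R (Ch A) (Ch A') := by
  obtain ⟨i, r, hr⟩ := h
  exact ⟨TR.lCh r, TR.lCh i, LinearMap.ext fun c => Ch.ext fun b =>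
    congrArg c (LinearMap.congr_fun hr b)⟩

theorem IsFlatL.retract (h : IsRetract R B B') (hB : IsFlatL R B') : IsFlatL R B :=
  isFlatL_iff.2 (injective_of_isRetract h.rCh (isFlatL_iff.1 hB))

/-- The evaluation map `B → B⁺⁺` of a left module. -/
def toBidualL : B →ₗ[R] Ch (Ch B) where
  toFun b := AddMonoidHom.mk' (fun c : Ch B => c b) (fun _ _ => rfl)
  map_add' a a' := by ext c; exact map_add c a a'
  map_smul' r a := rfl

theorem toBidualL_injective : Function.Injective (toBidualL (R := R) (B := B)) := by
  refine (injective_iff_map_eq_zero _).2 fun a ha => ?_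
  by_contra hne
  obtain ⟨c, hc⟩ := Ch.exists_ne_zero hne
  exact hc (DFunLike.congr_fun ha c)

/-- A triangle identity: the dual of A → A⁺⁺ splits A⁺ → A⁺⁺⁺. -/
theorem isRetract_ch_bidual : IsRetract R (Ch A) (Ch (Ch (Ch A))) :=
  ⟨toBidualL, lCh toBidual, rfl⟩

/-- For a free cover L → A⁺ the composite A → A⁺⁺ → L⁺ is injective, and injectivity of A splits it.
-/
theorem exists_isRetract_ch (hA : Module.Injective Rᵐᵒᵖ A) :
    ∃ (L : Type u) (_ : AddCommGroup L) (_ : Module R L), Module.Projective R L ∧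
      IsRetract Rᵐᵒᵖ A (Ch L) := by
  obtain ⟨g, hg⟩ := exists_surjective_finsupp R (Ch A)
  exact ⟨Ch A →₀ R, _, _, inferInstance, isRetract_of_injective hA (f := rCh g ∘ₗ toBidual)
    ((IsSES.ker hg).rCh.inj.comp toBidual_injective)⟩

/-- The character modules of injective right modules. -/
def IsChInj (R : Type u) [Ring R] (W : Type u) [AddCommGroup W] [Module R W] : Prop :=
  ∃ (E : Type u) (_ : AddCommGroup E) (_ : Module Rᵐᵒᵖ E), Module.Injective Rᵐᵒᵖ E ∧
    Nonempty (W ≃ₗ[R] Ch E)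

theorem IsFlatL.isChInj (h : IsFlatL R B) : IsChInj R (Ch (Ch B)) :=
  ⟨Ch B, _, _, isFlatL_iff.1 h, ⟨LinearEquiv.refl _ _⟩⟩

theorem IsChInj.exists_isRetract (h : IsChInj R B) : ∃ (L : Type u) (_ : AddCommGroup L)
    (_ : Module R L), Module.Projective R L ∧ IsRetract R B (Ch (Ch L)) := by
  obtain ⟨E, _, _, hE, ⟨e⟩⟩ := h
  obtain ⟨L, _, _, hL, hr⟩ := exists_isRetract_ch hE
  obtain ⟨i, r, h⟩ := hr.lCh
  exact ⟨L, _, _, hL, i ∘ₗ e.toLinearMap, e.symm.toLinearMap ∘ₗ r, LinearMap.ext fun x =>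
    (congrArg e.symm (LinearMap.congr_fun h (e x))).trans (e.symm_apply_apply x)⟩

theorem tmapR_exact_iff (f : B →ₗ[R] B') (g : B' →ₗ[R] B'') (hgf : g ∘ₗ f = 0) :
    Function.Exact (tmapR R A f) (tmapR R A g) ↔
      Function.Exact (fun φ : B'' →ₗ[R] Ch A => φ ∘ₗ g) (fun φ : B' →ₗ[R] Ch A => φ ∘ₗ f) := by
  constructor
  · intro h φ
    constructor
    · intro hφ
      obtain ⟨d, hd⟩ := Ch.factor_of_exact (f := tmapR R A f) h (tensChar φ) fun z => by
        have : (tensChar φ).comp (tmapR R A f) = 0 := tens_char_ext fun a b =>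
          DFunLike.congr_fun (LinearMap.congr_fun hφ b) a
        exact DFunLike.congr_fun this z
      refine ⟨charTens d, LinearMap.ext fun b => Ch.ext fun a => ?_⟩
      exact DFunLike.congr_fun hd (tmk R a b)
    · rintro ⟨ψ, rfl⟩
      change (ψ ∘ₗ g) ∘ₗ f = 0
      rw [LinearMap.comp_assoc, hgf, LinearMap.comp_zero]
  · intro h
    refine Ch.exact_of_factor _ _ (tens_hom_ext R fun a b => ?_) fun c hc => ?_
    · exact (congrArg (tmk R a) (LinearMap.congr_fun hgf b)).trans (map_zero _)
    · obtain ⟨ψ, hψ⟩ := (h (charTens c)).1 (LinearMap.ext fun b => Ch.ext fun a =>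
        DFunLike.congr_fun hc (tmk R a b))
      exact ⟨tensChar ψ, tens_char_ext fun a b =>
        DFunLike.congr_fun (LinearMap.congr_fun hψ b) a⟩

theorem isCompleteFlat_iff (F : Seq R) :
    F.IsCompleteFlat ↔ F.IsComplete (fun X _ _ => IsFlatL R X) (fun X _ _ => IsChInj R X) := by
  refine and_congr_right fun hF => and_congr_right fun _ => ⟨fun h W _ _ ⟨E, _, _, hE, ⟨e⟩⟩ n => ?_,
    fun h E _ _ hE n => ?_⟩
  · have h1 := (tmapR_exact_iff _ _ (hF n).linearMap_comp_eq_zero).1 (h E hE n)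
    intro φ
    constructor
    · intro hφ
      obtain ⟨ψ, hψ⟩ := (h1 (e.toLinearMap ∘ₗ φ)).1 (by
        change e.toLinearMap ∘ₗ (φ ∘ₗ F.d n) = 0
        rw [show φ ∘ₗ F.d n = 0 from hφ, LinearMap.comp_zero])
      refine ⟨e.symm.toLinearMap ∘ₗ ψ, LinearMap.ext fun x => ?_⟩
      exact (congrArg e.symm (LinearMap.congr_fun hψ x)).trans (e.symm_apply_apply _)
    · rintro ⟨ψ, rfl⟩
      change (ψ ∘ₗ F.d (n + 1)) ∘ₗ F.d n = 0
      rw [LinearMap.comp_assoc, (hF n).linearMap_comp_eq_zero, LinearMap.comp_zero]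
  · exact (tmapR_exact_iff _ _ (hF n).linearMap_comp_eq_zero).2
      (h (Ch E) ⟨E, _, _, hE, ⟨LinearEquiv.refl _ _⟩⟩ n)

/-- Exactness of E ⊗ F is exactness of Hom(F, Ch E), so this is an instance of `gor_iff`; the
orthogonality needed there holds because flat modules have no higher Ext into character modules. -/
theorem gf_iff : GF R B ↔ Gor R (fun X _ _ => IsFlatL R X) (fun X _ _ => IsChInj R X) B := by
  rw [gor_iff _ (fun _ _ _ h => isFlatL_of_projective h)]
  · simp only [GF, isCompleteFlat_iff]
  · rintro P _ _ W _ _ hP ⟨E, _, _, hE, ⟨e⟩⟩ n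
    exact (hP.ev n).retract_snd e.isRetract

end FlatCharacters

/-! ### Flat modules over the tensor ring -/

section FlatTensor

variable {R : Type u} [Ring R] {M : Type u} [AddCommGroup M] [Module R M] [Module Rᵐᵒᵖ M]
  [SMulCommClass R Rᵐᵒᵖ M] {W : Type u} [AddCommGroup W] [Module R W] {N : ℕ}

open LPair

theorem IsFlatL.iterate (hM : IsFlatL R M) (hW : IsFlatL R W) (i : ℕ) :
    IsFlatL R ((tF R M)^[i] (ModuleCat.of R W)) := by
  induction i generalizing W with
  | zero => exact hW
  | succ i ih => exact ih (hM.tens hW)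

theorem IsFlatL.hAcyc (hM : IsFlatL R M) (hW : IsFlatL R W) : HAcyc R M W :=
  fun i n => (hM.iterate hW i).ev n

theorem act_zero (t : TensorRing R M) (w : W) :
    TensorRing.act (0 : Tens R M W →ₗ[R] W) t w = degZero t • w := by
  induction t using TensorRing.induction_mul with
  | hb r => rw [TensorRing.act_ofBase, degZero_ofBase]
  | hm m t _ =>
    rw [degZero_ofM_mul, zero_smul, TensorRing.ofM_mul, TensorRing.act_leftMul]
    rfl
  | ha x y hx hy =>
    rw [map_add, map_add, AddMonoidHom.add_apply, hx, hy, add_smul]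

variable (R M W) in
/-- The bidual of a module on which `M` acts as zero. -/
def bidualTriv : (triv R M (Ch (Ch W))).Mod ≃ₗ[TensorRing R M] Ch (Ch (triv R M W).Mod) :=
  { AddEquiv.refl (Ch (Ch W)) with
    map_smul' := fun t c => by
      refine (act_zero t (W := Ch (Ch W)) c).trans ?_
      refine Ch.ext fun d => congrArg (show Ch (Ch W) from c) (Ch.ext fun w => ?_)
      exact congrArg (show Ch W from d) (act_zero t w).symm }

theorem isRetract_triv_bidual : IsRetract (TensorRing R M) (triv R M (Ch (Ch W))).Mod
    (Ch (Ch (triv R M W).Mod)) :=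
  (bidualTriv R M W).isRetract

theorem isRetract_bidual_triv : IsRetract (TensorRing R M) (Ch (Ch (triv R M W).Mod))
    (triv R M (Ch (Ch W))).Mod :=
  (bidualTriv R M W).symm.isRetract

/-- Degree one of the Eckmann–Shapiro isomorphism, valid because a free presentation of W stays
exact under induction. -/
theorem ev_ind_of_ev (hN : IsNilpotentBim R M N)
    (hP : ∀ (L : Type u) [AddCommGroup L] [Module R L], Module.Projective R L → HAcyc R M L)
    (hW : HAcyc R M W) {q : LPair R M} (h : EV R 1 W q.X) :
    EV (TensorRing R M) 1 (ind R M W).Mod q.Mod := by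
  obtain ⟨g, hg⟩ := exists_surjective_finsupp R W
  have hs := IsSES.ker hg
  have hF : Module.Projective R (W →₀ R) := inferInstance
  refine EV.of_extend (ses_indMap hN hs (hP _ hF) hW) (ev_ind_of_projective hF 0) fun φ => ?_
  obtain ⟨ψ, hψ⟩ := EV.extend hs h (res φ ∘ₗ indUnit R M _)
  refine ⟨indLift ψ, ind_ext fun w => ?_⟩
  refine (congrArg (res (indLift ψ)) (indLift_unit _ w)).trans ?_
  exact (indLift_unit ψ _).trans (LinearMap.congr_fun hψ w)

/-- Flatness is tested by Ext^1 into character modules of right T-modules; over R these are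
character modules of the restricted right modules. -/
theorem isFlatL_ind_of_hAcyc (hN : IsNilpotentBim R M N)
    (hP : ∀ (L : Type u) [AddCommGroup L] [Module R L], Module.Projective R L → HAcyc R M L)
    (hW : IsFlatL R W) (ha : HAcyc R M W) : IsFlatL (TensorRing R M) (ind R M W).Mod := by
  refine isFlatL_of_ev fun A _ _ => ?_
  obtain ⟨q, ⟨e⟩⟩ := exists_lpair (R := R) (M := M) (Ch A)
  let _ : Module Rᵐᵒᵖ A := Module.compHom A (TensorRing.baseHom R M).op
  have e' : q.X ≃ₗ[R] Ch A :=
    { e.toAddEquiv with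
      map_smul' := fun r x => (congrArg e (TensorRing.act_ofBase q.u r x).symm).trans
        (e.map_smul (TensorRing.ofBase (M := M) r) x) }
  exact (ev_ind_of_ev hN hP ha ((hW.ev 0).retract_snd e'.isRetract)).retract_snd e.symm.isRetract

theorem isFlatL_ind (hN : IsNilpotentBim R M N) (hM : IsFlatL R M) (hW : IsFlatL R W) :
    IsFlatL (TensorRing R M) (ind R M W).Mod :=
  isFlatL_ind_of_hAcyc hN (fun _ _ _ hL => hM.hAcyc (isFlatL_of_projective hL)) hW (hM.hAcyc hW)

/-- The filtration of `ev_of_filtration` after taking characters twice; its layers are double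
characters of the flat modules M^{⊗i} ⊗ W. -/
theorem ev_bidual_of_filtration {X : Type u} [AddCommGroup X] [Module (TensorRing R M) X] {n : ℕ}
    {p : LPair R M} {π : p.X →ₗ[R] W} (h : IsSES p.u π) (hM : IsFlatL R M) (hW : IsFlatL R W)
    {k : ℕ} (hk : NilAt R M k p.X)
    (hX : ∀ (V : Type u) [AddCommGroup V] [Module R V], IsFlatL R V →
      EV (TensorRing R M) n X (triv R M (Ch (Ch V))).Mod) :
    EV (TensorRing R M) n X (Ch (Ch p.Mod)) := by
  induction k generalizing p W with
  | zero =>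
    have : Subsingleton p.Mod := hk
    have : Subsingleton (Ch p.Mod) := ⟨fun c d => Ch.ext fun x => by
      rw [Subsingleton.elim x 0, map_zero, map_zero]⟩
    have : Subsingleton (Ch (Ch p.Mod)) := ⟨fun c d => Ch.ext fun x => by
      rw [Subsingleton.elim x 0, map_zero, map_zero]⟩
    exact EV.of_subsingleton_snd n
  | succ k ih =>
    obtain ⟨ψ, hψ⟩ := ses_uMap h
    exact EV.snd_mid hψ.rCh.lCh (ih (p := p.tens) (h.tM (hW.ev 0)) (hM.tens hW) hk)
      ((hX W hW).retract_snd isRetract_bidual_triv)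

end FlatTensor

/-! ### Finitely presented modules, coherence and biduals -/

section Theta

variable {R : Type u} [Ring R]

variable (R) in
/-- `A ⊗ I⁺ → Hom(A, I)⁺`. -/
def theta (A I : Type u) [AddCommGroup A] [Module Rᵐᵒᵖ A] [AddCommGroup I] [Module Rᵐᵒᵖ I] :
    Tens R A (Ch I) →+ ((A →ₗ[Rᵐᵒᵖ] I) →+ AddCircle (1 : ℚ)) :=
  tlift R (AddMonoidHom.mk' (fun a => AddMonoidHom.mk'
      (fun c : Ch I => AddMonoidHom.comp (show I →+ _ from c) (LinearMap.evalAddMonoidHom a))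
      (fun c d => by ext f; rfl))
    (fun a a' => by ext c f; exact (congrArg c (map_add f a a')).trans (map_add c _ _)))
    (fun r a c => by ext f; exact congrArg c (map_smul f (op r) a))

variable {A A' I : Type u} [AddCommGroup A] [Module Rᵐᵒᵖ A] [AddCommGroup A'] [Module Rᵐᵒᵖ A']
  [AddCommGroup I] [Module Rᵐᵒᵖ I]

theorem theta_tmapL (g : A →ₗ[Rᵐᵒᵖ] A') (z : Tens R A (Ch I)) (f : A' →ₗ[Rᵐᵒᵖ] I) :
    theta R A' I (tmapL R g (Ch I) z) f = theta R A I z (f ∘ₗ g) := by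
  induction z using tens_induction R with
  | h0 => simp
  | hm a c => rfl
  | ha x y hx hy => simp only [map_add, AddMonoidHom.add_apply, hx, hy]

theorem tmapL_surjective {g : A →ₗ[Rᵐᵒᵖ] A'} (hg : Function.Surjective g) (B : Type u)
    [AddCommGroup B] [Module R B] : Function.Surjective (tmapL R g B) := fun z => by
  induction z using tens_induction R with
  | h0 => exact ⟨0, map_zero _⟩
  | hm a b => obtain ⟨a, rfl⟩ := hg a; exact ⟨tmk R a b, rfl⟩
  | ha x y hx hy =>
    obtain ⟨x, rfl⟩ := hx
    obtain ⟨y, rfl⟩ := hy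
    exact ⟨x + y, map_add _ _ _⟩

section Free

variable {n : ℕ}

/-- The inverse of `theta` for a finite free module. -/
def thetaInv (χ : ((Fin n → Rᵐᵒᵖ) →ₗ[Rᵐᵒᵖ] I) →+ AddCircle (1 : ℚ)) :
    Tens R (Fin n → Rᵐᵒᵖ) (Ch I) :=
  ∑ i, tmk R (Pi.single i 1) (AddMonoidHom.mk' (fun x : I =>
      χ ((LinearMap.proj i : (Fin n → Rᵐᵒᵖ) →ₗ[Rᵐᵒᵖ] Rᵐᵒᵖ).smulRight x))
    (fun x y => by rw [← map_add]; congr 1; ext; simp) : Ch I)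

theorem theta_thetaInv (χ : ((Fin n → Rᵐᵒᵖ) →ₗ[Rᵐᵒᵖ] I) →+ AddCircle (1 : ℚ)) :
    theta R (Fin n → Rᵐᵒᵖ) I (thetaInv χ) = χ := by
  ext f
  rw [thetaInv, map_sum, AddMonoidHom.finsetSum_apply]
  have : f = ∑ i, (LinearMap.proj i : (Fin n → Rᵐᵒᵖ) →ₗ[Rᵐᵒᵖ] Rᵐᵒᵖ).smulRight
      (f (Pi.single i 1)) := by
    ext i
    simp [Pi.single_apply]
  conv_rhs => rw [this, map_sum]
  rfl

theorem thetaInv_theta (z : Tens R (Fin n → Rᵐᵒᵖ) (Ch I)) :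
    thetaInv (theta R (Fin n → Rᵐᵒᵖ) I z) = z := by
  induction z using tens_induction R with
  | h0 =>
    rw [map_zero]
    exact Finset.sum_eq_zero fun i _ => (congrArg (tmk R _) (Ch.ext fun x => rfl)).trans (map_zero _)
  | hm v c =>
    have hv : v = ∑ i, op (v i).unop • (Pi.single i (1 : Rᵐᵒᵖ) : Fin n → Rᵐᵒᵖ) := by
      ext j
      simp [Pi.single_apply]
    conv_rhs => rw [hv, map_sum, AddMonoidHom.finsetSum_apply]
    refine Finset.sum_congr rfl fun i _ => ?_
    rw [tmk_smul]
    exact congrArg (tmk R _) (Ch.ext fun x => rfl)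
  | ha x y hx hy =>
    conv_rhs => rw [← hx, ← hy]
    rw [thetaInv, thetaInv, thetaInv, ← Finset.sum_add_distrib]
    refine Finset.sum_congr rfl fun i _ => ?_
    refine Eq.trans ?_ (map_add (tmk R (A := Fin n → Rᵐᵒᵖ) (B := Ch I) (Pi.single i 1)) _ _)
    exact congrArg _ (Ch.ext fun v => DFunLike.congr_fun (map_add (theta R _ I) x y) _)

end Free

/-- Hom(A, I) embeds in Hom(F, I) for a finite free cover F of A; a character extends along this
embedding, and `theta` is invertible for F. -/
theorem theta_surjective (hA : Module.Finite Rᵐᵒᵖ A) : Function.Surjective (theta R A I) := by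
  obtain ⟨n, g, hg⟩ := Module.Finite.exists_fin' Rᵐᵒᵖ A
  intro χ
  let G : (A →ₗ[Rᵐᵒᵖ] I) →+ ((Fin n → Rᵐᵒᵖ) →ₗ[Rᵐᵒᵖ] I) :=
    AddMonoidHom.mk' (fun f => f ∘ₗ g) fun _ _ => rfl
  have hG : Function.Injective G := fun f f' h => LinearMap.ext fun a => by
    obtain ⟨v, rfl⟩ := hg a
    exact LinearMap.congr_fun h v
  obtain ⟨χ', hχ'⟩ := Ch.extend G hG χ
  refine ⟨tmapL R g (Ch I) (thetaInv χ'), ?_⟩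
  ext f
  rw [theta_tmapL, theta_thetaInv, ← hχ']
  rfl

/-- A chase along K → F → A with F finite free: finite presentation makes K finitely generated, so
`theta` is surjective for K, and it is bijective for F. -/
theorem theta_injective (hA : Module.FinitePresentation Rᵐᵒᵖ A) :
    Function.Injective (theta R A I) := by
  obtain ⟨n, g, hg⟩ := Module.Finite.exists_fin' Rᵐᵒᵖ A
  have hK : Module.Finite Rᵐᵒᵖ (LinearMap.ker g) :=
    Module.Finite.iff_fg.2 (Module.FinitePresentation.fg_ker g hg)
  refine (injective_iff_map_eq_zero _).2 fun z hz => ?_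
  obtain ⟨z, rfl⟩ := tmapL_surjective hg (Ch I) z
  let G : (A →ₗ[Rᵐᵒᵖ] I) →+ ((Fin n → Rᵐᵒᵖ) →ₗ[Rᵐᵒᵖ] I) :=
    AddMonoidHom.mk' (fun f => f ∘ₗ g) fun _ _ => rfl
  let H : ((Fin n → Rᵐᵒᵖ) →ₗ[Rᵐᵒᵖ] I) →+ (LinearMap.ker g →ₗ[Rᵐᵒᵖ] I) :=
    AddMonoidHom.mk' (fun f => f ∘ₗ (LinearMap.ker g).subtype) fun _ _ => rfl
  have hGH : Function.Exact G H := fun f => by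
    constructor
    · intro hf
      exact exists_factor (LinearMap.exact_subtype_ker_map g) hg f (LinearMap.congr_fun hf)
    · rintro ⟨f, rfl⟩
      refine LinearMap.ext fun x => ?_
      exact (congrArg f (LinearMap.mem_ker.1 x.2)).trans (map_zero f)
  obtain ⟨χ, hχ⟩ := Ch.factor_of_exact hGH (theta R _ I z) fun f =>
    (theta_tmapL g z f).symm.trans (DFunLike.congr_fun hz f)
  obtain ⟨w, rfl⟩ := theta_surjective hK χ
  have h1 : tmapL R (LinearMap.ker g).subtype (Ch I) w = z := by
    rw [← thetaInv_theta z, ← thetaInv_theta (tmapL R _ (Ch I) w)]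
    congr 1
    rw [← hχ]
    ext f
    exact theta_tmapL _ w f
  rw [← h1]
  have : (tmapL R g (Ch I)).comp (tmapL R (LinearMap.ker g).subtype (Ch I)) = 0 :=
    tens_hom_ext R fun a c => by
      change tmk R (g a.1) c = 0
      rw [LinearMap.mem_ker.1 a.2, map_zero]
      rfl
  exact DFunLike.congr_fun this w

end Theta

/-! ### Tensor products and double character modules -/

section Bidual

variable {R : Type u} [Ring R] {M : Type u} [AddCommGroup M] [Module R M] [Module Rᵐᵒᵖ M]
  [SMulCommClass R Rᵐᵒᵖ M]

section

variable {A B : Type u} [AddCommGroup A] [Module Rᵐᵒᵖ A] [AddCommGroup B] [Module R B]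

variable (R A B) in
/-- `(A ⊗ B)⁺ = Hom(A, B⁺)`. -/
def chTens : Ch (Tens R A B) ≃+ (A →ₗ[Rᵐᵒᵖ] Ch B) where
  toFun c := flipR (charTens c)
  invFun f := tensChar (flipL f)
  left_inv _ := tens_char_ext fun _ _ => rfl
  right_inv _ := rfl
  map_add' _ _ := rfl

end

variable (M) in
/-- `M ⊗ B⁺⁺ → (M ⊗ B)⁺⁺`. -/
def tensBidual (B : Type u) [AddCommGroup B] [Module R B] :
    Tens R M (Ch (Ch B)) →ₗ[R] Ch (Ch (Tens R M B)) where
  toFun z := (theta R M (Ch B) z).comp (chTens R M B).toAddMonoidHom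
  map_add' z w := by rw [map_add]; rfl
  map_smul' r z := by
    induction z using tens_induction R with
    | h0 => rw [smul_zero, map_zero]; rfl
    | hm m c => rfl
    | ha x y hx hy =>
      rw [smul_add, map_add, map_add]
      exact congrArg₂ (fun a b : Ch (Ch (Tens R M B)) => a + b) hx hy

/-- This is `theta` for I = Ch B, rewritten with Hom(M, Ch B) = Ch (M ⊗ B). -/
theorem tensBidual_bijective (hM : Module.FinitePresentation Rᵐᵒᵖ M) (B : Type u) [AddCommGroup B]
    [Module R B] : Function.Bijective (tensBidual (R := R) M B) := by
  constructor
  · intro z w h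
    refine theta_injective hM (AddMonoidHom.ext fun f => ?_)
    have := DFunLike.congr_fun h ((chTens R M B).symm f)
    exact this
  · intro c
    obtain ⟨z, hz⟩ := theta_surjective (A := M) (I := Ch B) inferInstance
      (AddMonoidHom.comp (show Ch (Tens R M B) →+ _ from c) (chTens R M B).symm.toAddMonoidHom)
    refine ⟨z, Ch.ext fun d => ?_⟩
    refine (DFunLike.congr_fun hz (chTens R M B d)).trans ?_
    exact congrArg c ((chTens R M B).symm_apply_apply d)

theorem IsRetract.trans {S : Type u} [Ring S] {X Y Z : Type u} [AddCommGroup X] [Module S X]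
    [AddCommGroup Y] [Module S Y] [AddCommGroup Z] [Module S Z] (h : IsRetract S X Y)
    (h' : IsRetract S Y Z) : IsRetract S X Z := by
  obtain ⟨i, r, hr⟩ := h
  obtain ⟨i', r', hr'⟩ := h'
  refine ⟨i' ∘ₗ i, r ∘ₗ r', LinearMap.ext fun x => ?_⟩
  exact (congrArg r (LinearMap.congr_fun hr' (i x))).trans (LinearMap.congr_fun hr x)

theorem isRetract_iterate_bidual (hM : Module.FinitePresentation Rᵐᵒᵖ M) (B : Type u)
    [AddCommGroup B] [Module R B] (i : ℕ) :
    IsRetract R ((tF R M)^[i] (ModuleCat.of R (Ch (Ch B))) : ModuleCat R)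
      (Ch (Ch ((tF R M)^[i] (ModuleCat.of R B) : ModuleCat R))) := by
  induction i generalizing B with
  | zero => exact (LinearEquiv.refl R (Ch (Ch B))).isRetract
  | succ i ih =>
    exact ((LinearEquiv.ofBijective _ (tensBidual_bijective hM B)).isRetract.iterate i).trans
      (ih (Tens R M B))

end Bidual

/-! ### Characters of injective modules over a coherent ring -/

section Coherent

variable {R : Type u} [Ring R]

variable (R) in
/-- `R` and `Rᵐᵒᵖ` are isomorphic right modules. -/
def opEquiv : R ≃ₗ[Rᵐᵒᵖ] Rᵐᵒᵖ :=
  { opAddEquiv with map_smul' := fun _ _ => rfl }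

theorem IsRightCoherent.finitePresentation (hR : IsRightCoherent R) (J : Ideal Rᵐᵒᵖ) (hJ : J.FG) :
    Module.FinitePresentation Rᵐᵒᵖ J := by
  have h := hR (Submodule.map (opEquiv R).symm.toLinearMap J) (Submodule.FG.map _ hJ)
  exact Module.FinitePresentation.of_equiv ((opEquiv R).symm.submoduleMap J).symm

theorem exists_fg_tens (J : Ideal Rᵐᵒᵖ) {B : Type u} [AddCommGroup B] [Module R B]
    (z : Tens R J B) : ∃ (J' : Ideal Rᵐᵒᵖ) (h : J' ≤ J) (w : Tens R J' B), J'.FG ∧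
      tmapL R (Submodule.inclusion h) B w = z := by
  induction z using tens_induction R with
  | h0 => exact ⟨⊥, bot_le, 0, Submodule.fg_bot, map_zero _⟩
  | hm a b =>
    refine ⟨Ideal.span {a.1}, (Ideal.span_singleton_le_iff_mem J).2 a.2,
      tmk R ⟨a.1, Ideal.mem_span_singleton_self a.1⟩ b, Submodule.fg_span_singleton _, rfl⟩
  | ha x y hx hy =>
    obtain ⟨J1, h1, w1, hf1, rfl⟩ := hx
    obtain ⟨J2, h2, w2, hf2, rfl⟩ := hy
    refine ⟨J1 ⊔ J2, sup_le h1 h2, tmapL R (Submodule.inclusion le_sup_left) B w1 +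
      tmapL R (Submodule.inclusion le_sup_right) B w2, Submodule.FG.sup hf1 hf2, ?_⟩
    have hc : ∀ (J1 J2 J3 : Ideal Rᵐᵒᵖ) (h : J1 ≤ J2) (h' : J2 ≤ J3) (w : Tens R J1 B),
        tmapL R (Submodule.inclusion h') B (tmapL R (Submodule.inclusion h) B w) =
          tmapL R (Submodule.inclusion (h.trans h')) B w := fun J1 J2 J3 h h' w => by
      have : (tmapL R (Submodule.inclusion h') B).comp (tmapL R (Submodule.inclusion h) B) =
          tmapL R (Submodule.inclusion (h.trans h')) B := tens_hom_ext R fun _ _ => rfl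
      exact DFunLike.congr_fun this w
    rw [map_add, hc, hc]

/-- By Baer's criterion only right ideals J matter, and an element killed by J ⊗ E⁺ → R ⊗ E⁺ comes
from a finitely generated J' ≤ J. Coherence makes J' finitely presented, so `theta` is injective
there, and its value is zero because every map J' → E extends to the whole ring. -/
theorem isFlatL_ch_of_injective (hR : IsRightCoherent R) {E : Type u} [AddCommGroup E]
    [Module Rᵐᵒᵖ E] (hE : Module.Injective Rᵐᵒᵖ E) : IsFlatL R (Ch E) := by
  refine isFlatL_iff.2 (Module.Baer.injective fun J g => ?_)
  have hinj : Function.Injective (tmapL R J.subtype (Ch E)) := by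
    refine (injective_iff_map_eq_zero _).2 fun z hz => ?_
    obtain ⟨J', h, w, hf, rfl⟩ := exists_fg_tens J z
    have hw : w = 0 := by
      refine theta_injective (hR.finitePresentation J' hf) ?_
      rw [map_zero]
      ext f
      obtain ⟨f', hf'⟩ := hE.out J'.subtype Subtype.val_injective f
      have h1 : f = f' ∘ₗ J'.subtype := LinearMap.ext fun x => (hf' x).symm
      have h2 : tmapL R J'.subtype (Ch E) w = 0 := by
        have : (tmapL R J.subtype (Ch E)).comp (tmapL R (Submodule.inclusion h) (Ch E)) =
          tmapL R J'.subtype (Ch E) := tens_hom_ext R fun _ _ => rfl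
        rw [← this]
        exact hz
      rw [h1, ← theta_tmapL, h2, map_zero]
      rfl
    rw [hw, map_zero]
  obtain ⟨ψ, hψ⟩ := (tmapL_injective_iff J.subtype).1 hinj g
  exact ⟨ψ, fun x hx => LinearMap.congr_fun hψ ⟨x, hx⟩⟩

theorem IsFlatL.bidual (hR : IsRightCoherent R) {B : Type u} [AddCommGroup B] [Module R B]
    (hB : IsFlatL R B) : IsFlatL R (Ch (Ch B)) :=
  isFlatL_ch_of_injective hR (isFlatL_iff.1 hB)

end Coherent

/-! ### The theorem for Gorenstein flat modules -/

section GorensteinFlat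

theorem exists_pushout {S : Type u} [Ring S] {A B C F G : Type u} [AddCommGroup A] [Module S A]
    [AddCommGroup B] [Module S B] [AddCommGroup C] [Module S C] [AddCommGroup F] [Module S F]
    [AddCommGroup G] [Module S G] {a : A →ₗ[S] B} {b : B →ₗ[S] C} {f : A →ₗ[S] F} {g : F →ₗ[S] G}
    (hab : IsSES a b) (hfg : IsSES f g) : ∃ (D : Type u) (_ : AddCommGroup D) (_ : Module S D)
      (i : F →ₗ[S] D) (j : B →ₗ[S] D) (c : D →ₗ[S] C) (d : D →ₗ[S] G),
      IsSES i c ∧ IsSES j d := by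
  let K := LinearMap.range (f.prod (-a))
  have hK : ∀ y z, K.mkQ (y, z) = 0 ↔ ∃ x, f x = y ∧ -a x = z := fun y z => by
    rw [← LinearMap.mem_ker, Submodule.ker_mkQ]
    exact exists_congr fun x => Prod.ext_iff
  have hadd : ∀ y z, K.mkQ (y, z) = K.mkQ (y, 0) + K.mkQ (0, z) := fun y z => by
    rw [← map_add, Prod.mk_add_mk, add_zero, zero_add]
  have hfa : ∀ x, K.mkQ (f x, 0) = K.mkQ (0, a x) := fun x => by
    rw [← sub_eq_zero, ← map_sub]
    exact (hK _ _).2 ⟨x, by simp, by simp⟩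
  refine ⟨(F × B) ⧸ K, _, _, K.mkQ ∘ₗ LinearMap.inl S F B, K.mkQ ∘ₗ LinearMap.inr S F B,
    K.liftQ (b ∘ₗ LinearMap.snd S F B) ?_, K.liftQ (g ∘ₗ LinearMap.fst S F B) ?_,
    ⟨?_, fun x => ⟨fun h => ?_, ?_⟩, fun z => ?_⟩, ⟨?_, fun x => ⟨fun h => ?_, ?_⟩, fun z => ?_⟩⟩
  · rintro _ ⟨x, rfl⟩
    simp [hab.exact.apply_apply_eq_zero]
  · rintro _ ⟨x, rfl⟩
    simp [hfg.exact.apply_apply_eq_zero]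
  · refine (injective_iff_map_eq_zero _).2 fun y hy => ?_
    obtain ⟨x, rfl, hx⟩ := (hK y 0).1 hy
    rw [hab.inj (a₁ := x) (a₂ := 0) (by rw [map_zero]; exact neg_eq_zero.1 hx), map_zero]
  · obtain ⟨⟨y, z⟩, rfl⟩ := K.mkQ_surjective x
    obtain ⟨x, rfl⟩ := (hab.exact z).1 h
    refine ⟨y + f x, ?_⟩
    change K.mkQ (y + f x, 0) = _
    rw [hadd y, ← hfa, ← map_add, Prod.mk_add_mk, add_zero]
  · rintro ⟨y, rfl⟩
    exact map_zero b
  · obtain ⟨y, rfl⟩ := hab.surj z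
    exact ⟨K.mkQ (0, y), rfl⟩
  · refine (injective_iff_map_eq_zero _).2 fun y hy => ?_
    obtain ⟨x, hx, rfl⟩ := (hK 0 y).1 hy
    rw [hfg.inj (a₁ := x) (a₂ := 0) (by rw [map_zero]; exact hx), map_zero, neg_zero]
  · obtain ⟨⟨y, z⟩, rfl⟩ := K.mkQ_surjective x
    obtain ⟨x, rfl⟩ := (hfg.exact y).1 h
    refine ⟨a x + z, ?_⟩
    change K.mkQ (0, a x + z) = _
    rw [hadd (f x), hfa, ← map_add, Prod.mk_add_mk, add_zero]
  · rintro ⟨y, rfl⟩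
    exact map_zero g
  · obtain ⟨y, rfl⟩ := hfg.surj z
    exact ⟨K.mkQ (y, 0), rfl⟩

theorem exists_third_iso {S : Type u} [Ring S] {G F C H : Type u} [AddCommGroup G] [Module S G]
    [AddCommGroup F] [Module S F] [AddCommGroup C] [Module S C] [AddCommGroup H] [Module S H]
    {f : G →ₗ[S] F} {g : F →ₗ[S] C} (h : IsSES f g) {j : F →ₗ[S] H} (hj : Function.Injective j) :
    ∃ (a : C →ₗ[S] H ⧸ LinearMap.range (j ∘ₗ f))
      (b : (H ⧸ LinearMap.range (j ∘ₗ f)) →ₗ[S] H ⧸ LinearMap.range j), IsSES a b := by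
  have hjf := IsSES.coker (f := j ∘ₗ f) (hj.comp h.inj)
  have hjs := IsSES.coker hj
  obtain ⟨a, ha⟩ := exists_factor h.exact h.surj ((LinearMap.range (j ∘ₗ f)).mkQ ∘ₗ j)
    fun x => hjf.exact.apply_apply_eq_zero x
  obtain ⟨b, hb⟩ := exists_factor hjf.exact hjf.surj (LinearMap.range j).mkQ
    fun x => hjs.exact.apply_apply_eq_zero (f x)
  have ha' : ∀ y, a (g y) = (LinearMap.range (j ∘ₗ f)).mkQ (j y) := LinearMap.congr_fun ha
  have hb' : ∀ y, b ((LinearMap.range (j ∘ₗ f)).mkQ y) = (LinearMap.range j).mkQ y :=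
    LinearMap.congr_fun hb
  refine ⟨a, b, ?_, fun x => ⟨fun hx => ?_, ?_⟩, fun x => ?_⟩
  · refine (injective_iff_map_eq_zero _).2 fun c hc => ?_
    obtain ⟨y, rfl⟩ := h.surj c
    rw [ha'] at hc
    obtain ⟨x, hx⟩ := (hjf.exact _).1 hc
    rw [← hj hx]
    exact h.exact.apply_apply_eq_zero x
  · obtain ⟨y, rfl⟩ := hjf.surj x
    rw [hb'] at hx
    obtain ⟨z, rfl⟩ := (hjs.exact _).1 hx
    exact ⟨g z, ha' z⟩
  · rintro ⟨c, rfl⟩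
    obtain ⟨y, rfl⟩ := h.surj c
    rw [ha', hb']
    exact hjs.exact.apply_apply_eq_zero y
  · obtain ⟨y, rfl⟩ := hjs.surj x
    exact ⟨_, hb' y⟩

section Base

variable {R : Type u} [Ring R] {A B C : Type u} [AddCommGroup A] [Module R A] [AddCommGroup B]
  [Module R B] [AddCommGroup C] [Module R C]

theorem IsFlatL.mid {f : A →ₗ[R] B} {g : B →ₗ[R] C} (h : IsSES f g) (hA : IsFlatL R A)
    (hC : IsFlatL R C) : IsFlatL R B :=
  isFlatL_of_ev fun _ _ _ => EV.fst_mid h (hA.ev 0) (hC.ev 0)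

theorem IsChInj.ev (hB : IsChInj R B) (hA : IsFlatL R A) (n : ℕ) : EV R (n + 1) A B := by
  obtain ⟨E, _, _, -, ⟨e⟩⟩ := hB
  exact (hA.ev n).retract_snd e.isRetract

/-- Push out an embedding A → F along A → B. The pushout is an extension of the flat module C by the
flat module F, it contains B, and its quotient by B is F/A. -/
theorem gor_of_flat_quotient {f : A →ₗ[R] B} {g : B →ₗ[R] C} (h : IsSES f g)
    (hA : Gor R (fun X _ _ => IsFlatL R X) (fun X _ _ => IsChInj R X) A) (hC : IsFlatL R C) :
    Gor R (fun X _ _ => IsFlatL R X) (fun X _ _ => IsChInj R X) B := by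
  obtain ⟨F, _, _, G, _, _, a, b, hs, hF, hG⟩ := hA.step
  obtain ⟨D, _, _, i, j, c, d, hi, hj⟩ := exists_pushout h hs
  exact Gor.intro hj (fun W _ _ hW n => EV.fst_mid h (hA.ev hW n) (hW.ev hC n))
    (IsFlatL.mid hi hF hC) hG

/-- B → B⁺⁺ is pure: its dual is split by `toBidual`. Hence the dual of the cokernel is injective.
-/
theorem isFlatL_bidual_quotient (hR : IsRightCoherent R) (hB : IsFlatL R B) :
    IsFlatL R (Ch (Ch B) ⧸ LinearMap.range (toBidualL (R := R) (B := B))) := by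
  have hs := (IsSES.coker (toBidualL_injective (R := R) (B := B))).rCh
  refine isFlatL_iff.2 (injective_of_ev fun X _ _ => EV.of_lift hs
    (EV.of_injective (isFlatL_iff.1 (hB.bidual hR)) 0) fun φ => ⟨toBidual ∘ₗ φ, rfl⟩)

/-- An embedding into a flat F is continued to F⁺⁺, the character module of an injective module and
so within reach of the orthogonality. The new cokernel is an extension of the flat module F⁺⁺/F by
the old one. -/
theorem exists_bidual_embedding (hR : IsRightCoherent R)
    (hB : Gor R (fun X _ _ => IsFlatL R X) (fun X _ _ => IsChInj R X) B) :
    ∃ (F : Type u) (_ : AddCommGroup F) (_ : Module R F) (G : Type u) (_ : AddCommGroup G)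
      (_ : Module R G) (f : B →ₗ[R] Ch (Ch F)) (g : Ch (Ch F) →ₗ[R] G), IsSES f g ∧ IsFlatL R F ∧
      Gor R (fun X _ _ => IsFlatL R X) (fun X _ _ => IsChInj R X) G := by
  obtain ⟨F, _, _, G, _, _, f, g, hs, hF, hG⟩ := hB.step
  obtain ⟨a, b, hab⟩ := exists_third_iso hs (toBidualL_injective (R := R) (B := F))
  exact ⟨F, _, _, _, _, _, _, _, IsSES.coker (f := toBidualL ∘ₗ f)
    ((toBidualL_injective (R := R)).comp hs.inj), hF,
    gor_of_flat_quotient hab hG (isFlatL_bidual_quotient hR hF)⟩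

end Base

variable {R : Type u} [Ring R] {M : Type u} [AddCommGroup M] [Module R M] [Module Rᵐᵒᵖ M]
  [SMulCommClass R Rᵐᵒᵖ M] {N k : ℕ} {p : LPair R M}

open LPair

theorem gf_iff_phi (hN : IsNilpotentBim R M N) (hR : IsRightCoherent R) (hM : IsFlatL R M)
    (hfp : Module.FinitePresentation Rᵐᵒᵖ M) (hpd : PdLE Rᵐᵒᵖ k M) :
    GF (TensorRing R M) p.Mod ↔ Function.Injective p.u ∧ GF R p.C := by
  have hP : ∀ (L : Type u) [AddCommGroup L] [Module R L], Module.Projective R L → HAcyc R M L :=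
    fun L _ _ hL => hM.hAcyc (isFlatL_of_projective hL)
  -- Ext(Y, Ch M) and Ext(M, Ch Y) vanish together, so the projective dimension of M on the right
  -- supplies the bound.
  have hk : ∀ n, k ≤ n → ∀ (Y : Type u) [AddCommGroup Y] [Module R Y], EV R (n + 1) Y (Ch M) :=
    fun n hn Y _ _ => (ev_ch_iff n).2 (hpd n hn (Ch Y))
  rw [gf_iff, gf_iff]
  constructor
  · refine cokernel_of_gor hN hP hk (fun X Y _ _ _ _ e hY => hY.retract e.isRetract)
      (fun q hq V _ _ hV n => ?_) (fun q hq hu => ?_) (fun H _ _ hH => hM.hAcyc hH) ?_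
    · exact ((hq.ev n).retract_snd isRetract_triv_bidual).retract_snd
        (isRetract_triv (isRetract_of_injective hV toBidualL_injective))
    · exact isFlatL_of_ev fun A _ _ => (ev_c_of_ev hu ((hq.ev 0).retract_snd
        isRetract_triv_bidual)).retract_snd isRetract_ch_bidual
    · intro X _ _ hX W _ _ hW n
      obtain ⟨L, _, _, hL, hr⟩ := hW.exists_isRetract
      have hL' := isFlatL_of_projective hL
      obtain ⟨ψ, hψ⟩ := ses_uMap (p := ind R M L) ind_ses
      obtain ⟨e⟩ := tens_ind_equiv hN (hP L hL)
      have h2 := (isFlatL_ind hN hM (hM.tens hL')).retract e.symm.isRetract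
      -- Double characters of 0 → T ⊗ (M ⊗ L) → T ⊗ L → (L, 0) → 0: the first two terms are flat
      -- before dualizing, so X is orthogonal to their double characters.
      exact ((EV.snd_right hψ.rCh.lCh (hX.ev (isFlatL_ind hN hM hL').isChInj n)
        (hX.ev h2.isChInj (n + 1))).retract_snd isRetract_triv_bidual).retract_snd
        (isRetract_triv hr)
  · rintro ⟨hu, hc⟩
    refine gor_of_cokernel hN hP (fun G _ _ hG => hG.hAcyc hk fun H _ _ hH => hM.hAcyc hH)
      ?_ ?_ hu hc
    · intro G _ _ hG
      obtain ⟨F, _, _, G', _, _, f, g, hs, hF, hG'⟩ := exists_bidual_embedding hR hG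
      have hF' := hF.bidual hR
      -- Finite presentation of M makes M^{⊗(i+1)} ⊗ F⁺⁺ a summand of (M^{⊗(i+1)} ⊗ F)⁺⁺, and the
      -- latter is the character module of an injective module.
      exact ⟨_, _, _, G', _, _, f, g, hs, hM.hAcyc hF', isFlatL_ind hN hM hF', hG', fun i =>
        (hG.ev (hM.iterate hF (i + 1)).isChInj 0).retract_snd (isRetract_iterate_bidual hfp F (i + 1))⟩
    · intro q hq ha hG W _ _ hW n
      obtain ⟨L, _, _, hL, hr⟩ := hW.exists_isRetract
      obtain ⟨L', _, _, hL', hr'⟩ := exists_isRetract_ind hL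
      exact ((ev_bidual_of_filtration ind_ses hM (isFlatL_of_projective hL') (hN.nilAt _)
        fun V _ _ hV => (ev_triv_iff hN hP hq ha n).2 (hG.ev hV.isChInj n)).retract_snd
          hr'.rCh.lCh).retract_snd hr

end GorensteinFlat

/-! ### Right modules over the tensor ring -/

section Right

variable {R : Type u} [Ring R] {M : Type u} [AddCommGroup M] [Module R M] [Module Rᵐᵒᵖ M]
  [SMulCommClass R Rᵐᵒᵖ M]

section HomMap

variable {Y Y' Y'' : Type u} [AddCommGroup Y] [Module Rᵐᵒᵖ Y] [AddCommGroup Y'] [Module Rᵐᵒᵖ Y']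
  [AddCommGroup Y''] [Module Rᵐᵒᵖ Y'']

theorem HomR.ext {f g : HomR R M Y} (h : ∀ m, f.app m = g.app m) : f = g :=
  LinearMap.ext (f := f.app) (g := g.app) h

variable (M) in
/-- `Hom(M, f)`. -/
def hM (f : Y →ₗ[Rᵐᵒᵖ] Y') : HomR R M Y →ₗ[Rᵐᵒᵖ] HomR R M Y' where
  toFun g := f ∘ₗ g.app
  map_add' g h := HomR.ext fun m => map_add f (g.app m) (h.app m)
  map_smul' _ _ := rfl

theorem hM_comp (g : Y' →ₗ[Rᵐᵒᵖ] Y'') (f : Y →ₗ[Rᵐᵒᵖ] Y') : hM M (g ∘ₗ f) = hM M g ∘ₗ hM M f := rfl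

theorem IsRetract.hM (h : IsRetract Rᵐᵒᵖ Y Y') : IsRetract Rᵐᵒᵖ (HomR R M Y) (HomR R M Y') := by
  obtain ⟨i, r, hr⟩ := h
  exact ⟨TR.hM M i, TR.hM M r, LinearMap.ext fun g => HomR.ext fun m => LinearMap.congr_fun hr (g.app m)⟩

theorem hM_injective {f : Y →ₗ[Rᵐᵒᵖ] Y'} (hf : Function.Injective f) :
    Function.Injective (hM M f) := fun _ _ hgh =>
  HomR.ext fun m => hf (LinearMap.congr_fun (congrArg HomR.app hgh) m)

theorem hM_exact {f : Y →ₗ[Rᵐᵒᵖ] Y'} {g : Y' →ₗ[Rᵐᵒᵖ] Y''} (h : Function.Exact f g)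
    (hf : Function.Injective f) : Function.Exact (hM M f) (hM M g) := fun φ => by
  constructor
  · intro hφ
    have h1 : ∀ m, φ.app m ∈ LinearMap.range f := fun m =>
      (h _).1 (LinearMap.congr_fun (congrArg HomR.app hφ) m)
    let e := LinearEquiv.ofInjective f hf
    refine ⟨e.symm.toLinearMap ∘ₗ φ.app.codRestrict (LinearMap.range f) h1, HomR.ext fun m => ?_⟩
    exact congrArg Subtype.val (e.apply_symm_apply ⟨φ.app m, h1 m⟩)
  · rintro ⟨ψ, rfl⟩
    exact HomR.ext fun m => h.apply_apply_eq_zero _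

theorem IsSES.hM {f : Y →ₗ[Rᵐᵒᵖ] Y'} {g : Y' →ₗ[Rᵐᵒᵖ] Y''} (h : IsSES f g)
    (hY : EV Rᵐᵒᵖ 1 M Y) : IsSES (TR.hM M f) (TR.hM M g) where
  inj := hM_injective h.inj
  exact := hM_exact h.exact h.inj
  surj φ := EV.lift h hY φ.app

end HomMap

/-! ### The kernel of the action, and right modules with zero action -/

namespace RPair

variable {p q s : RPair R M}

/-- The `R`-linear map underlying a map of right `T_R(M)`-modules. -/
def res (φ : p.Mod →ₗ[(TensorRing R M)ᵐᵒᵖ] q.Mod) : p.Y →ₗ[Rᵐᵒᵖ] q.Y where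
  toFun y := φ y
  map_add' := φ.map_add
  map_smul' r y :=
    (congrArg φ (p.act_ofBase r.unop y).symm).trans
      ((φ.map_smul (op (TensorRing.ofBase (M := M) r.unop)) y).trans (q.act_ofBase r.unop (φ y)))

theorem res_v (φ : p.Mod →ₗ[(TensorRing R M)ᵐᵒᵖ] q.Mod) (y : p.Y) :
    q.v (res φ y) = hM M (res φ) (p.v y) :=
  HomR.ext fun m => (q.act_ofM m (φ y)).symm.trans
    ((φ.map_smul (op (TensorRing.ofM (R := R) m)) y).symm.trans (congrArg φ (p.act_ofM m y)))

/-- A right `R`-linear map that is compatible with the actions of `M` is right `T_R(M)`-linear. -/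
def ofRes (f : p.Y →ₗ[Rᵐᵒᵖ] q.Y) (h : ∀ y, q.v (f y) = hM M f (p.v y)) :
    p.Mod →ₗ[(TensorRing R M)ᵐᵒᵖ] q.Mod where
  toFun y := f y
  map_add' := f.map_add
  map_smul' t y := by
    have key : ∀ (t : TensorRing R M) (y : p.Y), f (p.act t y) = q.act t (f y) := by
      intro t
      induction t using TensorRing.induction_mul with
      | hb r => intro y; rw [act_ofBase, act_ofBase, map_smul]
      | hm m t ih =>
        intro y
        rw [act_mul, act_mul, ih, act_ofM, act_ofM, h]
        rfl
      | ha a b ha hb =>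
        intro x
        simp only [map_add, AddMonoidHom.add_apply, ha, hb]
    exact key t.unop y

theorem ses_res {φ : p.Mod →ₗ[(TensorRing R M)ᵐᵒᵖ] q.Mod}
    {ψ : q.Mod →ₗ[(TensorRing R M)ᵐᵒᵖ] s.Mod} (h : IsSES φ ψ) : IsSES (res φ) (res ψ) :=
  ⟨h.inj, h.exact, h.surj⟩

/-- The kernel of `v`. -/
abbrev K (p : RPair R M) : Type u := LinearMap.ker p.v

/-- The map induced on the kernels of the actions. -/
def kMap (φ : p.Mod →ₗ[(TensorRing R M)ᵐᵒᵖ] q.Mod) : p.K →ₗ[Rᵐᵒᵖ] q.K :=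
  (res φ).restrict fun y hy => by
    rw [LinearMap.mem_ker] at hy ⊢
    rw [res_v, hy, map_zero]

theorem kMap_val (φ : p.Mod →ₗ[(TensorRing R M)ᵐᵒᵖ] q.Mod) (y : p.K) :
    (kMap φ y).1 = res φ y.1 := rfl

theorem kMap_injective {φ : p.Mod →ₗ[(TensorRing R M)ᵐᵒᵖ] q.Mod} (h : Function.Injective φ) :
    Function.Injective (kMap φ) := fun _ _ hxy =>
  Subtype.ext (h (congrArg Subtype.val hxy))

theorem kMap_exact {φ : p.Mod →ₗ[(TensorRing R M)ᵐᵒᵖ] q.Mod}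
    {ψ : q.Mod →ₗ[(TensorRing R M)ᵐᵒᵖ] s.Mod} (h : IsSES φ ψ) :
    Function.Exact (kMap φ) (kMap ψ) := by
  have hr := ses_res h
  intro y
  constructor
  · intro hy
    obtain ⟨x, hx⟩ := (hr.exact y.1).1 (congrArg Subtype.val hy)
    refine ⟨⟨x, hM_injective hr.inj ?_⟩, Subtype.ext hx⟩
    rw [← res_v, hx, LinearMap.mem_ker.1 y.2, map_zero]
  · rintro ⟨x, rfl⟩
    exact Subtype.ext (hr.exact.apply_apply_eq_zero x.1)

/-- Dual of `LPair.cMap_injective`: the snake lemma places the obstruction in coker p.v. -/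
theorem kMap_surjective {φ : p.Mod →ₗ[(TensorRing R M)ᵐᵒᵖ] q.Mod}
    {ψ : q.Mod →ₗ[(TensorRing R M)ᵐᵒᵖ] s.Mod} (h : IsSES φ ψ) (hp : Function.Surjective p.v) :
    Function.Surjective (kMap ψ) := by
  have hr := ses_res h
  intro z
  obtain ⟨y, hy⟩ := hr.surj z.1
  have h1 : hM M (res ψ) (q.v y) = 0 := by rw [← res_v, hy, LinearMap.mem_ker.1 z.2]
  obtain ⟨w, hw⟩ := (hM_exact (M := M) hr.exact hr.inj _).1 h1
  obtain ⟨x, rfl⟩ := hp w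
  refine ⟨⟨y - res φ x, ?_⟩, Subtype.ext ?_⟩
  · rw [LinearMap.mem_ker, map_sub, res_v, hw, sub_self]
  · rw [kMap_val, map_sub, hr.exact.apply_apply_eq_zero x, hy, sub_zero]

theorem ses_kMap {φ : p.Mod →ₗ[(TensorRing R M)ᵐᵒᵖ] q.Mod}
    {ψ : q.Mod →ₗ[(TensorRing R M)ᵐᵒᵖ] s.Mod} (h : IsSES φ ψ) (hp : Function.Surjective p.v) :
    IsSES (kMap φ) (kMap ψ) :=
  ⟨kMap_injective h.inj, kMap_exact h, kMap_surjective h hp⟩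

theorem v_surjective_left {φ : p.Mod →ₗ[(TensorRing R M)ᵐᵒᵖ] q.Mod}
    {ψ : q.Mod →ₗ[(TensorRing R M)ᵐᵒᵖ] s.Mod} (h : IsSES φ ψ) (hq : Function.Surjective q.v)
    (hk : Function.Surjective (kMap ψ)) : Function.Surjective p.v := by
  have hr := ses_res h
  intro w
  obtain ⟨y, hy⟩ := hq (hM M (res φ) w)
  have h1 : s.v (res ψ y) = 0 := by
    rw [res_v, hy, (hM_exact (M := M) hr.exact hr.inj).apply_apply_eq_zero w]
  obtain ⟨z, hz⟩ := hk ⟨res ψ y, h1⟩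
  have h2 : res ψ (y - z.1) = 0 := by
    rw [map_sub, sub_eq_zero]
    exact (congrArg Subtype.val hz).symm
  obtain ⟨x, hx⟩ := (hr.exact _).1 h2
  refine ⟨x, hM_injective hr.inj ?_⟩
  rw [← res_v, hx, map_sub, LinearMap.mem_ker.1 z.2, sub_zero, hy]

theorem v_surjective_right {ψ : q.Mod →ₗ[(TensorRing R M)ᵐᵒᵖ] s.Mod}
    (hq : Function.Surjective q.v) (h : Function.Surjective (hM M (res ψ))) :
    Function.Surjective s.v := by
  intro z
  obtain ⟨w, rfl⟩ := h z
  obtain ⟨y, rfl⟩ := hq w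
  exact ⟨res ψ y, res_v ψ y⟩

variable (R M) in
/-- The right module `W` on which `M` acts as zero. -/
abbrev triv (W : Type u) [AddCommGroup W] [Module Rᵐᵒᵖ W] : RPair R M where
  Y := W
  v := 0

variable {W W' : Type u} [AddCommGroup W] [Module Rᵐᵒᵖ W] [AddCommGroup W'] [Module Rᵐᵒᵖ W']

/-- Maps from `W` to `ker v` are maps from `[W, 0]` to `[Y, v]`. -/
def ofTriv (χ : W →ₗ[Rᵐᵒᵖ] p.K) : (triv R M W).Mod →ₗ[(TensorRing R M)ᵐᵒᵖ] p.Mod :=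
  ofRes (p := triv R M W) ((LinearMap.ker p.v).subtype ∘ₗ χ) fun y =>
    (LinearMap.mem_ker.1 (χ y).2).trans (map_zero (hM M _)).symm

theorem exists_ofTriv (φ : (triv R M W).Mod →ₗ[(TensorRing R M)ᵐᵒᵖ] p.Mod) :
    ∃ χ : W →ₗ[Rᵐᵒᵖ] p.K, ofTriv χ = φ :=
  ⟨(res (p := triv R M W) φ).codRestrict _ fun y =>
    (res_v (p := triv R M W) φ y).trans (map_zero _), rfl⟩

theorem ofTriv_injective {χ χ' : W →ₗ[Rᵐᵒᵖ] p.K} (h : ofTriv χ = ofTriv χ') : χ = χ' :=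
  LinearMap.ext fun y => Subtype.ext (LinearMap.congr_fun h y)

theorem isRetract_triv (h : IsRetract Rᵐᵒᵖ W W') :
    IsRetract (TensorRing R M)ᵐᵒᵖ (triv R M W).Mod (triv R M W').Mod := by
  obtain ⟨i, r, hr⟩ := h
  refine ⟨ofRes (p := triv R M W) (q := triv R M W') i fun _ => (map_zero (hM M i)).symm,
    ofRes (p := triv R M W') (q := triv R M W) r fun _ => (map_zero (hM M r)).symm, ?_⟩
  exact LinearMap.ext fun x => LinearMap.congr_fun hr x

theorem ses_v (hp : Function.Surjective p.v) : IsSES (LinearMap.ker p.v).subtype p.v :=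
  IsSES.ker hp

end RPair

/-! ### Character modules of left modules over the tensor ring -/

section ChPair

variable {B : Type u} [AddCommGroup B] [Module R B]

variable (R M B) in
/-- `(M ⊗ B)⁺ = Hom(M, B⁺)` as right modules. -/
def chTensR : Ch (Tens R M B) ≃ₗ[Rᵐᵒᵖ] HomR R M (Ch B) :=
  { chTens R M B with map_smul' := fun _ _ => rfl }

/-- The character module of a left pair. -/
def LPair.ch (q : LPair R M) : RPair R M where
  Y := Ch q.X
  v := (chTensR R M q.X).toLinearMap ∘ₗ rCh q.u

theorem LPair.ch_act (q : LPair R M) (t : TensorRing R M) (c : Ch q.X) :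
    q.ch.act t c = (AddMonoidHom.comp (show q.X →+ _ from c) (TensorRing.act q.u t) : Ch q.X) := by
  induction t using TensorRing.induction_mul generalizing c with
  | hb r =>
    exact (q.ch.act_ofBase r c).trans
      (Ch.ext fun x => congrArg c (TensorRing.act_ofBase q.u r x).symm)
  | hm m t ih =>
    refine ((q.ch.act_mul (TensorRing.ofM m) t c).trans
      (congrArg (q.ch.act t) (q.ch.act_ofM m c))).trans ((ih _).trans (Ch.ext fun x => ?_))
    refine congrArg c (Eq.trans ?_ (congrArg (fun s => TensorRing.act q.u s x)
      (TensorRing.ofM_mul m t).symm))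
    exact (TensorRing.act_leftMul q.u m t x).symm
  | ha a b ha hb =>
    refine (DFunLike.congr_fun (map_add q.ch.act a b) c).trans
      ((congrArg₂ (fun d e : q.ch.Y => d + e) (ha c) (hb c)).trans (Ch.ext fun x => ?_))
    exact (map_add c _ _).symm.trans
      (congrArg c (DFunLike.congr_fun (map_add (TensorRing.act q.u) a b) x).symm)

/-- The right module of a character pair is the character module. -/
def LPair.chMod (q : LPair R M) : q.ch.Mod ≃ₗ[(TensorRing R M)ᵐᵒᵖ] Ch q.Mod :=
  { AddEquiv.refl (Ch q.X) with
    map_smul' := fun t c => q.ch_act t.unop c }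

variable (R M B) in
/-- Characters of a module on which `M` acts as zero. -/
def chTriv : (RPair.triv R M (Ch B)).Mod ≃ₗ[(TensorRing R M)ᵐᵒᵖ] Ch (LPair.triv R M B).Mod :=
  (show (RPair.triv R M (Ch B)).Mod ≃ₗ[(TensorRing R M)ᵐᵒᵖ] (LPair.triv R M B).ch.Mod from
    { RPair.ofRes (p := RPair.triv R M (Ch B)) (q := (LPair.triv R M B).ch)
        LinearMap.id (fun c => HomR.ext fun _ => Ch.ext fun _ => map_zero c) with
      invFun := fun c => c
      left_inv := fun _ => rfl
      right_inv := fun _ => rfl }).trans (LPair.triv R M B).chMod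

theorem LPair.ch_ses {q : LPair R M} {π : q.X →ₗ[R] B} (h : IsSES q.u π) :
    IsSES (rCh π : Ch B →ₗ[Rᵐᵒᵖ] q.ch.Y) q.ch.v :=
  h.rCh.congr_right (chTensR R M q.X)

end ChPair
end Right

/-! ### Iterates of `Hom(M, -)` and coacyclicity -/

section CoIterate

variable (R : Type u) [Ring R] (M : Type u) [AddCommGroup M] [Module R M] [Module Rᵐᵒᵖ M]
  [SMulCommClass R Rᵐᵒᵖ M]

/-- `Hom(M, -)` on bundled right modules. -/
def hF (Y : ModuleCat.{u} Rᵐᵒᵖ) : ModuleCat.{u} Rᵐᵒᵖ := ModuleCat.of Rᵐᵒᵖ (HomR R M Y)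

/-- `Ext^n(M, Y) = 0` for `n ≥ 1`. -/
def CAcyc (Y : Type u) [AddCommGroup Y] [Module Rᵐᵒᵖ Y] : Prop := ∀ n, EV Rᵐᵒᵖ (n + 1) M Y

/-- `Ext^n(M, Hom(M, -)^i Y) = 0` for `n ≥ 1` and `i ≥ 0`. -/
def HCAcyc (Y : Type u) [AddCommGroup Y] [Module Rᵐᵒᵖ Y] : Prop :=
  ∀ i, CAcyc R M ((hF R M)^[i] (ModuleCat.of Rᵐᵒᵖ Y))

/-- `Hom(M, -)^k Y = 0`. -/
def CNilAt (k : ℕ) (Y : Type u) [AddCommGroup Y] [Module Rᵐᵒᵖ Y] : Prop :=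
  Subsingleton ((hF R M)^[k] (ModuleCat.of Rᵐᵒᵖ Y))

variable {R M} {X Y Z : Type u} [AddCommGroup X] [Module Rᵐᵒᵖ X] [AddCommGroup Y] [Module Rᵐᵒᵖ Y]
  [AddCommGroup Z] [Module Rᵐᵒᵖ Z]

theorem HCAcyc.cAcyc (h : HCAcyc R M X) : CAcyc R M X := h 0

theorem HCAcyc.hom (h : HCAcyc R M X) : HCAcyc R M (HomR R M X) := fun i => h (i + 1)

theorem IsRetract.hIterate (h : IsRetract Rᵐᵒᵖ X Y) (i : ℕ) :
    IsRetract Rᵐᵒᵖ ((hF R M)^[i] (ModuleCat.of Rᵐᵒᵖ X)) ((hF R M)^[i] (ModuleCat.of Rᵐᵒᵖ Y)) := by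
  induction i generalizing X Y with
  | zero => exact h
  | succ i ih => exact ih (h.hM (M := M))

theorem HCAcyc.retract (h : IsRetract Rᵐᵒᵖ X Y) (hY : HCAcyc R M Y) : HCAcyc R M X :=
  fun i n => (hY i n).retract_snd (h.hIterate i)

theorem HCAcyc.right {f : X →ₗ[Rᵐᵒᵖ] Y} {g : Y →ₗ[Rᵐᵒᵖ] Z} (h : IsSES f g) (hX : HCAcyc R M X)
    (hY : HCAcyc R M Y) : HCAcyc R M Z := by
  intro i
  induction i generalizing X Y Z with
  | zero => exact fun n => EV.snd_right h (hY 0 n) (hX 0 (n + 1))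
  | succ i ih => exact ih (h.hM (hX 0 0)) hX.hom hY.hom

/-- Dual of `acyc_of_ses`: X is an extension of Hom(M, X) by Z, and applying Hom(M, -) lowers the
nilpotency index. -/
theorem cAcyc_of_ses {j : Z →ₗ[Rᵐᵒᵖ] X} {v : X →ₗ[Rᵐᵒᵖ] HomR R M X} (h : IsSES j v)
    (hZ : HCAcyc R M Z) {k : ℕ} (hk : CNilAt R M k X) : CAcyc R M X := by
  induction k generalizing X Z with
  | zero =>
    have : Subsingleton X := hk
    exact fun n => EV.of_subsingleton_snd _
  | succ k ih =>
    have h1 : CAcyc R M (HomR R M X) := ih (h.hM (hZ 0 0)) hZ.hom hk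
    exact fun n => EV.snd_mid h (hZ 0 n) (h1 n)

theorem surjective_of_ses {G H K : Type u} [AddCommGroup G] [Module Rᵐᵒᵖ G] [AddCommGroup H]
    [Module Rᵐᵒᵖ H] [AddCommGroup K] [Module Rᵐᵒᵖ K] {v : X →ₗ[Rᵐᵒᵖ] HomR R M X}
    {ι : G →ₗ[Rᵐᵒᵖ] X} {w : Y →ₗ[Rᵐᵒᵖ] HomR R M Y} {κ : H →ₗ[Rᵐᵒᵖ] Y} (hX : IsSES ι v)
    (hY : IsSES κ w) {f : Y →ₗ[Rᵐᵒᵖ] X} {g' : K →ₗ[Rᵐᵒᵖ] H} {g : H →ₗ[Rᵐᵒᵖ] G} (hg : IsSES g' g)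
    (hv : v ∘ₗ f = hM M f ∘ₗ w) (hκ : f ∘ₗ κ = ι ∘ₗ g) (hK : HCAcyc R M K) (hH : HCAcyc R M H)
    {k : ℕ} (hk : CNilAt R M k X) : Function.Surjective f := by
  induction k generalizing X Y G H K with
  | zero =>
    have : Subsingleton X := hk
    exact Function.surjective_to_subsingleton _
  | succ k ih =>
    have h1 : Function.Surjective (hM M f) :=
      ih (hX.hM ((hK.right hg hH) 0 0)) (hY.hM (hH 0 0)) (hg.hM (hK 0 0))
        (by rw [← hM_comp, hv, hM_comp]) (by rw [← hM_comp, hκ, hM_comp]) hK.hom hH.hom hk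
    intro x
    obtain ⟨z, hz⟩ := h1 (v x)
    obtain ⟨y, rfl⟩ := hY.surj z
    have h2 : v (x - f y) = 0 := by
      rw [map_sub, ← hz, sub_eq_zero]
      exact (LinearMap.congr_fun hv y).symm
    obtain ⟨a, ha⟩ := (hX.exact _).1 h2
    obtain ⟨b, rfl⟩ := hg.surj a
    refine ⟨y + κ b, ?_⟩
    rw [map_add, ← LinearMap.comp_apply f κ, hκ, LinearMap.comp_apply, ha, add_sub_cancel]

theorem exists_hIterate_injective {f : X →ₗ[Rᵐᵒᵖ] Y} (hf : Function.Injective f) (i : ℕ) :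
    ∃ g : ((hF R M)^[i] (ModuleCat.of Rᵐᵒᵖ X) : ModuleCat Rᵐᵒᵖ) →ₗ[Rᵐᵒᵖ]
      ((hF R M)^[i] (ModuleCat.of Rᵐᵒᵖ Y) : ModuleCat Rᵐᵒᵖ), Function.Injective g := by
  induction i generalizing X Y with
  | zero => exact ⟨f, hf⟩
  | succ i ih => exact ih (hM_injective (M := M) hf)

theorem nonempty_hIterate_equiv (e : X ≃ₗ[Rᵐᵒᵖ] Y) (i : ℕ) :
    Nonempty (((hF R M)^[i] (ModuleCat.of Rᵐᵒᵖ X) : ModuleCat Rᵐᵒᵖ) ≃ₗ[Rᵐᵒᵖ]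
      ((hF R M)^[i] (ModuleCat.of Rᵐᵒᵖ Y) : ModuleCat Rᵐᵒᵖ)) := by
  induction i generalizing X Y with
  | zero => exact ⟨e⟩
  | succ i ih =>
    exact ih (LinearEquiv.ofLinearMap (hM M e.toLinearMap) (hM M e.symm.toLinearMap)
      (LinearMap.ext fun g => HomR.ext fun m => e.apply_symm_apply _)
      (LinearMap.ext fun g => HomR.ext fun m => e.symm_apply_apply _))

variable (R M) in
-- Iterates Ch (M ⊗ B) ≅ Hom(M, Ch B); acyclicity and nilpotency for M ⊗ - thereby pass to Hom(M,
-- -).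
theorem nonempty_ch_iterate (B : Type u) [AddCommGroup B] [Module R B] (i : ℕ) :
    Nonempty (((hF R M)^[i] (ModuleCat.of Rᵐᵒᵖ (Ch B)) : ModuleCat Rᵐᵒᵖ) ≃ₗ[Rᵐᵒᵖ]
      Ch ((tF R M)^[i] (ModuleCat.of R B) : ModuleCat R)) := by
  induction i generalizing B with
  | zero => exact ⟨LinearEquiv.refl _ _⟩
  | succ i ih =>
    obtain ⟨e⟩ := nonempty_hIterate_equiv (M := M) (chTensR R M B).symm i
    obtain ⟨e'⟩ := ih (Tens R M B)
    exact ⟨e.trans e'⟩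

theorem HAcyc.ch {B : Type u} [AddCommGroup B] [Module R B] (hB : HAcyc R M B) :
    HCAcyc R M (Ch B) := fun i n => by
  obtain ⟨e⟩ := nonempty_ch_iterate R M B i
  exact ((ev_ch_iff n).1 (hB i n)).retract_snd e.isRetract

theorem Ch.subsingleton {B : Type u} [AddCommGroup B] [Subsingleton B] : Subsingleton (Ch B) :=
  ⟨fun c d => Ch.ext fun x => by rw [Subsingleton.elim x 0, map_zero, map_zero]⟩

variable (X) in
-- X embeds in its double character module, where nilpotency for M ⊗ - applies to Ch X; Hom(M, -)
-- preserves the embedding.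
theorem IsNilpotentBim.cNilAt {N : ℕ} (hN : IsNilpotentBim R M N) : CNilAt R M (N + 1) X := by
  obtain ⟨g, hg⟩ := exists_hIterate_injective (M := M) (toBidual_injective (R := R) (A := X)) (N + 1)
  obtain ⟨e⟩ := nonempty_ch_iterate R M (Ch X) (N + 1)
  have : Subsingleton ((tF R M)^[N + 1] (ModuleCat.of R (Ch X))) := hN.nilAt (Ch X)
  have : Subsingleton (Ch ((tF R M)^[N + 1] (ModuleCat.of R (Ch X)) : ModuleCat R)) :=
    Ch.subsingleton
  exact (e.injective.comp hg).subsingleton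

end CoIterate

/-! ### Finite injective dimension -/

section Id

/-- `V` has injective dimension at most `n`. -/
def IdLE (S : Type u) [Ring S] (n : ℕ) (V : Type u) [AddCommGroup V] [Module S V] : Prop :=
  ∀ m, n ≤ m → ∀ (X : Type u) [AddCommGroup X] [Module S X], EV S (m + 1) X V

section

variable {S : Type u} [Ring S] {V I C : Type u} [AddCommGroup V] [Module S V]
  [AddCommGroup I] [Module S I] [AddCommGroup C] [Module S C] {n : ℕ}

theorem IdLE.right {f : V →ₗ[S] I} {g : I →ₗ[S] C} (h : IsSES f g) (hI : Module.Injective S I)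
    (hV : IdLE S (n + 1) V) : IdLE S n C :=
  fun m hm X _ _ => EV.snd_right h (EV.of_injective hI m) (hV (m + 1) (by omega) X)

theorem IdLE.left {f : V →ₗ[S] I} {g : I →ₗ[S] C} (h : IsSES f g) (hI : IdLE S (n + 1) I)
    (hC : IdLE S n C) : IdLE S (n + 1) V := by
  rintro (_ | m) hm X _ _
  · omega
  · exact EV.snd_left h (hC m (by omega) X) (hI (m + 1) hm X)

theorem IdLE.mono {n' : ℕ} (hV : IdLE S n V) (h : n ≤ n') : IdLE S n' V :=
  fun m hm Y _ _ => hV m (h.trans hm) Y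

theorem IdLE.retract (h : IsRetract S V I) (hI : IdLE S n I) : IdLE S n V :=
  fun m hm X _ _ => (hI m hm X).retract_snd h

theorem GorI.ev_of_idLE {X : Type u} [AddCommGroup X] [Module S X] (hX : GorI S X)
    (hV : IdLE S n V) (m : ℕ) : EV S (m + 1) V X := by
  induction n generalizing V m with
  | zero => exact hX.ev (injective_of_ev (hV 0 le_rfl)) m
  | succ n ih =>
    obtain ⟨I, _, _, f, hI, hf⟩ := exists_injective_embedding S V
    have hs := IsSES.coker hf
    exact EV.fst_left hs (hX.ev hI m) (ih (hV.right hs hI) (m + 1))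

end

variable {R : Type u} [Ring R] {M : Type u} [AddCommGroup M] [Module R M] [Module Rᵐᵒᵖ M]
  [SMulCommClass R Rᵐᵒᵖ M] {k n : ℕ}

theorem idLE_ch_tens (hM : IdLE Rᵐᵒᵖ k (Ch M)) {L : Type u} [AddCommGroup L] [Module R L]
    (hL : Module.Projective R L) : IdLE Rᵐᵒᵖ k (Ch (Tens R M L)) := fun m hm X _ _ =>
  (ev_ch_iff m).1 (((((ev_ch_iff m).2 (hM m hm X)).finsupp L).retract_fst
    (isRetract_tens_finsupp L)).retract_fst (Module.Projective.isRetract_finsupp hL).tM)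

/-- An injective module is a summand of Ch L with L projective, so Hom(M, -) of it is a summand of
Ch (M ⊗ L), whose injective dimension is bounded by that of Ch M. Acyclicity of V keeps Hom(M, -)
exact along an injective coresolution. -/
theorem idLE_hom (hM : IdLE Rᵐᵒᵖ k (Ch M)) {V : Type u} [AddCommGroup V] [Module Rᵐᵒᵖ V]
    (hV : IdLE Rᵐᵒᵖ n V) (ha : CAcyc R M V) : IdLE Rᵐᵒᵖ (k + n) (HomR R M V) := by
  have hinj : ∀ (I : Type u) [AddCommGroup I] [Module Rᵐᵒᵖ I], Module.Injective Rᵐᵒᵖ I →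
      IdLE Rᵐᵒᵖ k (HomR R M I) := fun I _ _ hI => by
    obtain ⟨L, _, _, hL, hr⟩ := exists_isRetract_ch hI
    exact ((idLE_ch_tens hM hL).retract (chTensR R M L).symm.isRetract).retract hr.hM
  induction n generalizing V with
  | zero => exact hinj V (injective_of_ev (hV 0 le_rfl))
  | succ n ih =>
    obtain ⟨I, _, _, f, hI, hf⟩ := exists_injective_embedding Rᵐᵒᵖ V
    have hs := IsSES.coker hf
    exact IdLE.left (hs.hM (ha 0)) ((hinj I hI).mono (Nat.le_add_right k (n + 1)))
      (ih (hV.right hs hI) fun m => EV.snd_right hs (EV.of_injective hI m) (ha (m + 1)))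

theorem exists_idLE_iterate (hM : IdLE Rᵐᵒᵖ k (Ch M)) {V : Type u} [AddCommGroup V]
    [Module Rᵐᵒᵖ V] (hV : IdLE Rᵐᵒᵖ n V) (ha : HCAcyc R M V) (i : ℕ) :
    ∃ n, IdLE Rᵐᵒᵖ n ((hF R M)^[i] (ModuleCat.of Rᵐᵒᵖ V)) := by
  induction i generalizing n V with
  | zero => exact ⟨n, hV⟩
  | succ i ih => exact ih (idLE_hom hM hV ha.cAcyc) ha.hom

end Id

/-! ### Extensions of right modules over the tensor ring -/

section RightExt

variable {R : Type u} [Ring R] {M : Type u} [AddCommGroup M] [Module R M] [Module Rᵐᵒᵖ M]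
  [SMulCommClass R Rᵐᵒᵖ M] {N : ℕ}

theorem ev_ch_of_filtration {W : Type u} [AddCommGroup W] [Module R W] {X : Type u}
    [AddCommGroup X] [Module (TensorRing R M)ᵐᵒᵖ X] {n : ℕ} {q : LPair R M} {π : q.X →ₗ[R] W}
    (h : IsSES q.u π) (hW : HAcyc R M W) {k : ℕ} (hk : NilAt R M k q.X)
    (hX : ∀ i, EV (TensorRing R M)ᵐᵒᵖ n
      (RPair.triv R M (Ch ((tF R M)^[i] (ModuleCat.of R W) : ModuleCat R))).Mod X) :
    EV (TensorRing R M)ᵐᵒᵖ n (Ch q.Mod) X := by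
  induction k generalizing q W with
  | zero =>
    have : Subsingleton q.Mod := hk
    have : Subsingleton (Ch q.Mod) := Ch.subsingleton
    exact EV.of_subsingleton_fst n
  | succ k ih =>
    obtain ⟨ψ, hψ⟩ := LPair.ses_uMap h
    exact EV.fst_mid hψ.rCh ((hX 0).retract_fst (chTriv R M W).symm.isRetract)
      (ih (q := q.tens) (h.tM (hW 0 0)) hW.tens hk fun i => hX (i + 1))

theorem IsSES.nonempty_equiv_left {S : Type u} [Ring S] {A B C A' : Type u} [AddCommGroup A]
    [Module S A] [AddCommGroup B] [Module S B] [AddCommGroup C] [Module S C] [AddCommGroup A']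
    [Module S A'] {f : A →ₗ[S] B} {f' : A' →ₗ[S] B} {g : B →ₗ[S] C} (h : IsSES f g)
    (h' : IsSES f' g) : Nonempty (A ≃ₗ[S] A') :=
  ⟨((LinearEquiv.ofInjective f h.inj).trans (LinearEquiv.ofEq _ _ (h.exact.linearMap_ker_eq.symm.trans
    h'.exact.linearMap_ker_eq))).trans (LinearEquiv.ofInjective f' h'.inj).symm⟩

namespace RPair

variable {p q s : RPair R M} {W W' : Type u} [AddCommGroup W] [Module Rᵐᵒᵖ W] [AddCommGroup W']
  [Module Rᵐᵒᵖ W']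

/-- The kernel of `v` computed by an exact sequence. -/
def kEquiv {j : W →ₗ[Rᵐᵒᵖ] p.Y} (h : IsSES j p.v) : W ≃ₗ[Rᵐᵒᵖ] p.K :=
  (LinearEquiv.ofInjective j h.inj).trans (LinearEquiv.ofEq _ _ h.exact.linearMap_ker_eq.symm)

variable (R M) in
/-- The coinduced module of the character module of `L`. -/
abbrev coind (L : Type u) [AddCommGroup L] [Module R L] : RPair R M := (LPair.ind R M L).ch

section Coind

variable {L : Type u} [AddCommGroup L] [Module R L]

theorem coind_ses : IsSES (rCh (LPair.indCounit R M L) : Ch L →ₗ[Rᵐᵒᵖ] (coind R M L).Y)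
    (coind R M L).v :=
  (LPair.ind R M L).ch_ses LPair.ind_ses

theorem coind_injective (hL : Module.Projective R L) :
    Module.Injective (TensorRing R M)ᵐᵒᵖ (coind R M L).Mod :=
  injective_of_isRetract (LPair.ind R M L).chMod.isRetract
    (injective_ch_of_projective (LPair.ind_projective hL))

theorem ev_coind (hL : Module.Projective R L) {X : Type u} [AddCommGroup X]
    [Module (TensorRing R M)ᵐᵒᵖ X] (n : ℕ) :
    EV (TensorRing R M)ᵐᵒᵖ (n + 1) X (coind R M L).Mod :=
  EV.of_injective (coind_injective hL) n

theorem ev_kCoind (hL : Module.Projective R L) (n : ℕ) : EV Rᵐᵒᵖ (n + 1) W (coind R M L).K :=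
  (EV.of_injective (injective_ch_of_projective hL) n).retract_snd (kEquiv coind_ses).symm.isRetract

end Coind

/-- Dualize a presentation of Ch p and precompose with p → Ch (Ch p). Only characters of induced
modules are needed as coinduced modules. -/
theorem exists_copresentation (p : RPair R M) : ∃ (L : Type u) (_ : AddCommGroup L)
    (_ : Module R L) (C : RPair R M) (f : p.Mod →ₗ[(TensorRing R M)ᵐᵒᵖ] (coind R M L).Mod)
    (g : (coind R M L).Mod →ₗ[(TensorRing R M)ᵐᵒᵖ] C.Mod), Module.Projective R L ∧ IsSES f g := by
  obtain ⟨q, ⟨e⟩⟩ := exists_lpair (R := R) (M := M) (Ch p.Mod)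
  obtain ⟨L, _, _, K, f, g, hL, hs⟩ := q.exists_presentation
  have hs' := (hs.congr_right e).rCh
  let φ : p.Mod →ₗ[(TensorRing R M)ᵐᵒᵖ] (coind R M L).Mod :=
    (LPair.ind R M L).chMod.symm.toLinearMap ∘ₗ rCh (e.toLinearMap ∘ₗ g) ∘ₗ toBidual
  have hφ : Function.Injective φ :=
    (LPair.ind R M L).chMod.symm.injective.comp (hs'.inj.comp toBidual_injective)
  obtain ⟨C, ⟨e'⟩⟩ := exists_rpair (R := R) (M := M) ((coind R M L).Mod ⧸ LinearMap.range φ)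
  exact ⟨L, _, _, C, φ, _, hL, (IsSES.coker hφ).congr_right e'.symm⟩

theorem lift_k {φ : p.Mod →ₗ[(TensorRing R M)ᵐᵒᵖ] q.Mod}
    {ψ : q.Mod →ₗ[(TensorRing R M)ᵐᵒᵖ] s.Mod} (h : IsSES φ ψ)
    (hp : EV (TensorRing R M)ᵐᵒᵖ 1 (triv R M W).Mod p.Mod) (χ : W →ₗ[Rᵐᵒᵖ] s.K) :
    ∃ χ' : W →ₗ[Rᵐᵒᵖ] q.K, kMap ψ ∘ₗ χ' = χ := by
  obtain ⟨f, hf⟩ := EV.lift h hp (ofTriv χ)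
  obtain ⟨χ', rfl⟩ := exists_ofTriv f
  exact ⟨χ', ofTriv_injective hf⟩

theorem v_surjective_of_ev
    (h : ∀ (V : Type u) [AddCommGroup V] [Module Rᵐᵒᵖ V], Module.Projective Rᵐᵒᵖ V →
      EV (TensorRing R M)ᵐᵒᵖ 1 (triv R M V).Mod p.Mod) : Function.Surjective p.v := by
  obtain ⟨L, _, _, C, f, g, -, hs⟩ := p.exists_copresentation
  refine v_surjective_left hs coind_ses.surj ?_
  obtain ⟨j, hj⟩ := exists_surjective_finsupp Rᵐᵒᵖ C.K
  obtain ⟨χ, hχ⟩ := lift_k hs (h _ inferInstance) j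
  have : Function.Surjective (kMap g ∘ₗ χ) := hχ ▸ hj
  exact Function.Surjective.of_comp this

theorem ev_k_of_ev (hp : Function.Surjective p.v)
    (h : EV (TensorRing R M)ᵐᵒᵖ 1 (triv R M W).Mod p.Mod) : EV Rᵐᵒᵖ 1 W p.K := by
  obtain ⟨L, _, _, C, f, g, hL, hs⟩ := p.exists_copresentation
  exact EV.of_lift (ses_kMap hs hp) (ev_kCoind hL 0) (lift_k hs h)

theorem cAcyc_of_hCAcyc (hN : IsNilpotentBim R M N) {j : W →ₗ[Rᵐᵒᵖ] p.Y} (h : IsSES j p.v)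
    (hW : HCAcyc R M W) : CAcyc R M p.Y :=
  cAcyc_of_ses h hW (hN.cNilAt _)

theorem ev_triv_iff (hN : IsNilpotentBim R M N)
    (hP : ∀ (L : Type u) [AddCommGroup L] [Module R L], Module.Projective R L → HAcyc R M L)
    (hp : Function.Surjective p.v) (ha : CAcyc R M p.Y) (n : ℕ) :
    EV (TensorRing R M)ᵐᵒᵖ (n + 1) (triv R M W).Mod p.Mod ↔ EV Rᵐᵒᵖ (n + 1) W p.K := by
  induction n generalizing p with
  | zero =>
    refine ⟨ev_k_of_ev hp, fun h => ?_⟩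
    obtain ⟨L, _, _, C, f, g, hL, hs⟩ := p.exists_copresentation
    refine EV.of_lift hs (ev_coind hL 0) fun φ => ?_
    obtain ⟨χ, rfl⟩ := exists_ofTriv φ
    obtain ⟨χ', rfl⟩ := EV.lift (ses_kMap hs hp) h χ
    exact ⟨ofTriv χ', rfl⟩
  | succ n ih =>
    obtain ⟨L, _, _, C, f, g, hL, hs⟩ := p.exists_copresentation
    have hC : Function.Surjective C.v :=
      v_surjective_right (ψ := g) coind_ses.surj ((ses_res hs).hM (ha 0)).surj
    have haC : CAcyc R M C.Y := fun m =>
      EV.snd_right (ses_res hs) (cAcyc_of_hCAcyc hN coind_ses (hP L hL).ch m) (ha (m + 1))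
    have hk := ses_kMap hs hp
    constructor
    · intro h
      exact EV.snd_left hk ((ih hC haC).1 (EV.snd_right hs (ev_coind hL n) h))
        (ev_kCoind hL (n + 1))
    · intro h
      exact EV.snd_left hs ((ih hC haC).2 (EV.snd_right hk (ev_kCoind hL n) h))
        (ev_coind hL (n + 1))

/-- Dual of `LPair.ev_triv_of_injective`; again one extra cosyzygy is spent on making the action
surjective, hence k + 1. -/
theorem ev_triv_of_projective (hN : IsNilpotentBim R M N)
    (hP : ∀ (L : Type u) [AddCommGroup L] [Module R L], Module.Projective R L → HAcyc R M L)
    {k : ℕ} (hk : ∀ n, k ≤ n → EV Rᵐᵒᵖ (n + 1) M p.Y) (hW : Module.Projective Rᵐᵒᵖ W) (n : ℕ)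
    (hn : k + 1 ≤ n) : EV (TensorRing R M)ᵐᵒᵖ (n + 1) (triv R M W).Mod p.Mod := by
  induction k generalizing p n with
  | zero =>
    obtain ⟨n, rfl⟩ : ∃ m, n = m + 1 := ⟨n - 1, by omega⟩
    obtain ⟨L, _, _, C, f, g, hL, hs⟩ := p.exists_copresentation
    have ha : CAcyc R M p.Y := fun m => hk m (Nat.zero_le _)
    have hC : Function.Surjective C.v :=
      v_surjective_right (ψ := g) coind_ses.surj ((ses_res hs).hM (ha 0)).surj
    have haC : CAcyc R M C.Y := fun m =>
      EV.snd_right (ses_res hs) (cAcyc_of_hCAcyc hN coind_ses (hP L hL).ch m) (ha (m + 1))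
    exact EV.snd_left hs ((ev_triv_iff hN hP hC haC n).2 (EV.of_projective hW n))
      (ev_coind hL (n + 1))
  | succ k ih =>
    obtain ⟨n, rfl⟩ : ∃ m, n = m + 1 := ⟨n - 1, by omega⟩
    obtain ⟨L, _, _, C, f, g, hL, hs⟩ := p.exists_copresentation
    refine EV.snd_left hs (ih (fun m hm => ?_) n (by omega)) (ev_coind hL (n + 1))
    exact EV.snd_right (ses_res hs) (cAcyc_of_hCAcyc hN coind_ses (hP L hL).ch m)
      (hk (m + 1) (by omega))

theorem surjective_of_kMap (hN : IsNilpotentBim R M N) (hp : Function.Surjective p.v)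
    (hq : Function.Surjective q.v) {φ : q.Mod →ₗ[(TensorRing R M)ᵐᵒᵖ] p.Mod} {G' : Type u}
    [AddCommGroup G'] [Module Rᵐᵒᵖ G'] {g : G' →ₗ[Rᵐᵒᵖ] q.K} (hs : IsSES g (kMap φ))
    (hG' : HCAcyc R M G') (hq' : HCAcyc R M q.K) : Function.Surjective φ :=
  surjective_of_ses (f := res φ) (ses_v hp) (ses_v hq) hs (LinearMap.ext (res_v φ)) rfl hG' hq'
    (hN.cNilAt _)

/-- The action of M on Ch X is the dual of u, so the kernel of that action is the kernel of Ch X →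
Ch (M ⊗ X), here as a sequence of T-modules. -/
theorem ses_ch {q : LPair R M} (hq : Function.Injective q.u) :
    IsSES (ofTriv (p := q.ch) (LinearMap.id : q.ch.K →ₗ[Rᵐᵒᵖ] q.ch.K))
      (rCh q.uMap ∘ₗ q.chMod.toLinearMap) where
  inj := Subtype.val_injective
  exact y := by
    constructor
    · intro hy
      exact ⟨⟨y, (congrArg (chTensR R M q.X) hy).trans (map_zero (chTensR R M q.X))⟩, rfl⟩
    · rintro ⟨x, rfl⟩
      exact (chTensR R M q.X).injective
        ((LinearMap.mem_ker.1 x.2).trans (map_zero (chTensR R M q.X)).symm)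
  surj := (IsSES.coker (f := q.uMap) hq).rCh.surj.comp q.chMod.surjective

theorem exists_extend {q : LPair R M} (hq : Function.Injective q.u)
    (hev : EV (TensorRing R M)ᵐᵒᵖ 1 (Ch q.tens.Mod) p.Mod) (χ : q.ch.K →ₗ[Rᵐᵒᵖ] p.K) :
    ∃ ψ : q.ch.Mod →ₗ[(TensorRing R M)ᵐᵒᵖ] p.Mod, kMap ψ = χ := by
  obtain ⟨ψ, hψ⟩ := EV.extend (ses_ch hq) hev (ofTriv χ)
  exact ⟨ψ, ofTriv_injective hψ⟩

/-- Dual of `LPair.exists_embedding`. The obstruction to extending Ch L → p.K over the coinduced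
module lies in Ext^1(Ch (M ⊗ (T ⊗ L)), p), and is filtered by the characters of M^{⊗(i+1)} ⊗ L. -/
theorem exists_cover (hN : IsNilpotentBim R M N)
    (hP : ∀ (L : Type u) [AddCommGroup L] [Module R L], Module.Projective R L → HAcyc R M L)
    (hp : Function.Surjective p.v) (hk : HCAcyc R M p.K) {L G' : Type u} [AddCommGroup L]
    [Module R L] [AddCommGroup G'] [Module Rᵐᵒᵖ G'] (hL : Module.Projective R L)
    {f : G' →ₗ[Rᵐᵒᵖ] Ch L} {g : Ch L →ₗ[Rᵐᵒᵖ] p.K} (hs : IsSES f g) (hG' : HCAcyc R M G')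
    (hev : ∀ i, EV Rᵐᵒᵖ 1 (Ch ((tF R M)^[i] (ModuleCat.of R L) : ModuleCat R)) p.K) :
    ∃ (p' : RPair R M) (φ : p'.Mod →ₗ[(TensorRing R M)ᵐᵒᵖ] (coind R M L).Mod)
      (ψ : (coind R M L).Mod →ₗ[(TensorRing R M)ᵐᵒᵖ] p.Mod), IsSES φ ψ ∧
        Function.Surjective p'.v ∧ Nonempty (p'.K ≃ₗ[Rᵐᵒᵖ] G') := by
  have hev' : EV (TensorRing R M)ᵐᵒᵖ 1 (Ch (LPair.ind R M L).tens.Mod) p.Mod :=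
    ev_ch_of_filtration (q := (LPair.ind R M L).tens) (LPair.ind_ses.tM (hP L hL 0 0)) (hP L hL).tens
      (hN.nilAt _) fun i => (ev_triv_iff hN hP hp (cAcyc_of_hCAcyc hN (ses_v hp) hk) 0).2
        (hev (i + 1))
  let e : Ch L ≃ₗ[Rᵐᵒᵖ] (coind R M L).K := kEquiv coind_ses
  have hs' := hs.congr_mid e
  obtain ⟨ψ, hψ⟩ := exists_extend LPair.ind_u_injective hev' (g ∘ₗ e.symm.toLinearMap)
  rw [← hψ] at hs'
  have hsurj : Function.Surjective ψ :=
    surjective_of_kMap hN hp coind_ses.surj hs' hG' (HCAcyc.retract e.symm.isRetract (hP L hL).ch)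
  obtain ⟨p', ⟨e'⟩⟩ := exists_rpair (R := R) (M := M) (LinearMap.ker ψ)
  have hses := (IsSES.ker hsurj).congr_left e'
  have hp' : Function.Surjective p'.v := v_surjective_left hses coind_ses.surj hs'.surj
  exact ⟨p', _, ψ, hses, hp', (ses_kMap hses hp').nonempty_equiv_left hs'⟩

end RPair
end RightExt

/-! ### Gorenstein injective modules -/

section GorensteinInjective

theorem GorI.prod {S : Type u} [Ring S] {X J : Type u} [AddCommGroup X] [Module S X]
    [AddCommGroup J] [Module S J] (hX : GorI S X) (hJ : Module.Injective S J) :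
    GorI S (X × J) := by
  obtain ⟨P, _, _, G', _, _, f, g, hs, hP, hG'⟩ := hX.step
  have hsum : ∀ (Y : Type u) [AddCommGroup Y] [Module S Y],
      IsSES (LinearMap.inr S Y J) (LinearMap.fst S Y J) := fun Y _ _ =>
    ⟨LinearMap.inr_injective, Function.Exact.inr_fst, LinearMap.fst_surjective⟩
  refine GorI.intro (f := LinearMap.inl S P J ∘ₗ f) (g := g.prodMap LinearMap.id)
    ⟨LinearMap.inl_injective.comp hs.inj, fun y => ⟨fun hy => ?_, ?_⟩, fun x => ?_⟩
    (fun W _ _ hW n => EV.snd_mid (hsum X) (EV.of_injective hJ n) (hX.ev hW n))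
    (injective_of_ev fun W _ _ => EV.snd_mid (hsum P) (EV.of_injective hJ 0) (EV.of_injective hP 0))
    hG'
  · obtain ⟨x, hx⟩ := (hs.exact y.1).1 (congrArg Prod.fst hy)
    exact ⟨x, Prod.ext hx (congrArg Prod.snd hy).symm⟩
  · rintro ⟨x, rfl⟩
    exact Prod.ext (hs.exact.apply_apply_eq_zero x) rfl
  · obtain ⟨y, hy⟩ := hs.surj x.1
    exact ⟨(y, x.2), Prod.ext hy rfl⟩

variable {R : Type u} [Ring R]

/-- An injective cover H is a summand of some Ch L; adding the complement ker r both to H and to the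
kernel leaves G unchanged. The cover must be of the form Ch L because only such modules are
coinduced here. -/
theorem GorI.exists_ch_cover {G : Type u} [AddCommGroup G] [Module Rᵐᵒᵖ G] (hG : GorI Rᵐᵒᵖ G) :
    ∃ (L : Type u) (_ : AddCommGroup L) (_ : Module R L) (G' : Type u) (_ : AddCommGroup G')
      (_ : Module Rᵐᵒᵖ G') (f : G' →ₗ[Rᵐᵒᵖ] Ch L) (g : Ch L →ₗ[Rᵐᵒᵖ] G), Module.Projective R L ∧
        IsSES f g ∧ GorI Rᵐᵒᵖ G' := by
  obtain ⟨H, _, _, G', _, _, f, g, hs, hH, hG'⟩ := hG.step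
  obtain ⟨L, _, _, hL, i, r, hr⟩ := exists_isRetract_ch hH
  have hri : ∀ x, r (i x) = x := LinearMap.congr_fun hr
  have hJ : IsRetract Rᵐᵒᵖ (LinearMap.ker r) (Ch L) :=
    ⟨(LinearMap.ker r).subtype, (LinearMap.id - i ∘ₗ r).codRestrict (LinearMap.ker r)
      fun c => by simp [hri], LinearMap.ext fun c => Subtype.ext (by simp)⟩
  refine ⟨L, _, _, G' × LinearMap.ker r, _, _, (i ∘ₗ f).coprod (LinearMap.ker r).subtype, g ∘ₗ r,
    hL, ⟨?_, fun c => ⟨fun hc => ?_, ?_⟩, hs.surj.comp fun x => ⟨i x, hri x⟩⟩,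
    hG'.prod (injective_of_isRetract hJ (injective_ch_of_projective hL))⟩
  · refine (injective_iff_map_eq_zero _).2 fun ⟨x, z⟩ h => ?_
    have h' : i (f x) + z.1 = 0 := h
    have h1 : f x = 0 := by simpa [hri] using congrArg r h'
    have h2 : x = 0 := hs.inj (h1.trans (map_zero f).symm)
    rw [h1, map_zero, zero_add] at h'
    exact Prod.ext h2 (Subtype.ext h')
  · obtain ⟨x, hx⟩ := (hs.exact (r c)).1 hc
    exact ⟨(x, ⟨c - i (r c), by simp [hri]⟩), by simp [hx]⟩
  · rintro ⟨⟨x, z⟩, rfl⟩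
    have : r (i (f x) + z.1) = f x := by simp [hri]
    exact (congrArg g this).trans (hs.exact.apply_apply_eq_zero x)

variable {M : Type u} [AddCommGroup M] [Module R M] [Module Rᵐᵒᵖ M] [SMulCommClass R Rᵐᵒᵖ M]
  {N k n : ℕ} {p : RPair R M}

theorem cAcyc_iterate_of_class (hn : PdLE Rᵐᵒᵖ n M) (c : ModuleCat.{u} Rᵐᵒᵖ → Prop)
    (hc : ∀ X, c X → ∃ (P X' : ModuleCat.{u} Rᵐᵒᵖ) (f : X' →ₗ[Rᵐᵒᵖ] P) (g : P →ₗ[Rᵐᵒᵖ] X),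
      IsSES f g ∧ HCAcyc R M P ∧ c X') (i : ℕ) (X : ModuleCat.{u} Rᵐᵒᵖ) (hX : c X) :
    CAcyc R M ((hF R M)^[i] X) := by
  have h0 : ∀ (c : ModuleCat.{u} Rᵐᵒᵖ → Prop), (∀ X, c X → ∃ (P X' : ModuleCat.{u} Rᵐᵒᵖ)
      (f : X' →ₗ[Rᵐᵒᵖ] P) (g : P →ₗ[Rᵐᵒᵖ] X), IsSES f g ∧ HCAcyc R M P ∧ c X') →
      ∀ X : ModuleCat.{u} Rᵐᵒᵖ, c X → CAcyc R M X := by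
    intro c hc X hX m
    refine forall_of_shift (P := fun n (X : ModuleCat.{u} Rᵐᵒᵖ) => EV Rᵐᵒᵖ (n + 1) M X) (c := c)
      ?_ (fun n hn' X _ => hn n hn' X) m X hX
    intro X hX
    obtain ⟨P, X', f, g, hs, hP, hX'⟩ := hc X hX
    exact ⟨X', hX', fun n hn => EV.snd_right hs (hP.cAcyc n) hn⟩
  induction i generalizing c X with
  | zero => exact h0 c hc X hX
  | succ i ih =>
    refine ih (fun Y => ∃ X, c X ∧ Y = hF R M X) ?_ (hF R M X) ⟨X, hX, rfl⟩
    rintro _ ⟨X, hX, rfl⟩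
    obtain ⟨P, X', f, g, hs, hP, hX'⟩ := hc X hX
    exact ⟨hF R M P, hF R M X', hM M f, hM M g, hs.hM (h0 c hc X' hX' 0), hP.hom, X', hX', rfl⟩

theorem hCAcyc_of_injective
    (hP : ∀ (L : Type u) [AddCommGroup L] [Module R L], Module.Projective R L → HAcyc R M L)
    {J : Type u} [AddCommGroup J] [Module Rᵐᵒᵖ J] (hJ : Module.Injective Rᵐᵒᵖ J) :
    HCAcyc R M J := by
  obtain ⟨L, _, _, hL, hr⟩ := exists_isRetract_ch hJ
  exact HCAcyc.retract hr (hP L hL).ch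

theorem GorI.hCAcyc
    (hP : ∀ (L : Type u) [AddCommGroup L] [Module R L], Module.Projective R L → HAcyc R M L)
    (hn : PdLE Rᵐᵒᵖ n M) {G : Type u} [AddCommGroup G] [Module Rᵐᵒᵖ G] (hG : GorI Rᵐᵒᵖ G) :
    HCAcyc R M G := by
  intro i
  refine cAcyc_iterate_of_class hn (fun X => GorI Rᵐᵒᵖ X) (fun X hX => ?_) i
    (ModuleCat.of Rᵐᵒᵖ G) hG
  obtain ⟨P, _, _, G', _, _, f, g, hs, hJ, hG⟩ := hX.step
  exact ⟨ModuleCat.of Rᵐᵒᵖ P, ModuleCat.of Rᵐᵒᵖ G', f, g, hs, hCAcyc_of_injective hP hJ, hG⟩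

theorem GorI.ev_ch_iterate
    (hP : ∀ (L : Type u) [AddCommGroup L] [Module R L], Module.Projective R L → HAcyc R M L)
    (hM : IdLE Rᵐᵒᵖ k (Ch M)) {G L : Type u} [AddCommGroup G] [Module Rᵐᵒᵖ G] [AddCommGroup L]
    [Module R L] (hG : GorI Rᵐᵒᵖ G) (hL : Module.Projective R L) (i m : ℕ) :
    EV Rᵐᵒᵖ (m + 1) (Ch ((tF R M)^[i] (ModuleCat.of R L) : ModuleCat R)) G := by
  obtain ⟨d, hd⟩ := exists_idLE_iterate hM (n := 0) (V := Ch L)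
    (fun m _ Y _ _ => EV.of_injective (injective_ch_of_projective hL) m) (hP L hL).ch i
  obtain ⟨e⟩ := nonempty_ch_iterate R M L i
  exact (hG.ev_of_idLE hd m).retract_fst e.symm.isRetract

namespace RPair

theorem gorI_of_kernel (hN : IsNilpotentBim R M N)
    (hP : ∀ (L : Type u) [AddCommGroup L] [Module R L], Module.Projective R L → HAcyc R M L)
    (hM : IdLE Rᵐᵒᵖ k (Ch M)) (hn : PdLE Rᵐᵒᵖ n M) (hp : Function.Surjective p.v)
    (hc : GorI Rᵐᵒᵖ p.K) : GorI (TensorRing R M)ᵐᵒᵖ p.Mod := by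
  refine ⟨fun X _ _ => ∃ p : RPair R M, Nonempty (p.Mod ≃ₗ[(TensorRing R M)ᵐᵒᵖ] X) ∧
    Function.Surjective p.v ∧ GorI Rᵐᵒᵖ p.K, ⟨p, ⟨LinearEquiv.refl _ _⟩, hp, hc⟩, ?_⟩
  rintro X _ _ ⟨p, ⟨e⟩, hp, hc⟩
  have ha := hc.hCAcyc hP hn
  constructor
  · intro W _ _ hW m
    -- An injective right T-module is a summand of Ch Q with Q projective, hence of Ch (T ⊗ L),
    -- which is filtered by characters of the modules (M^{⊗i} ⊗ L, 0).
    obtain ⟨Q, _, _, hQ, hr⟩ := exists_isRetract_ch hW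
    obtain ⟨L, _, _, hL, hr'⟩ := exists_isRetract_ind hQ
    refine (((EV.retract_snd e.symm.isRetract ?_).retract_fst hr'.rCh).retract_fst hr)
    exact ev_ch_of_filtration LPair.ind_ses (hP L hL) (hN.nilAt _) fun i =>
      (ev_triv_iff hN hP hp (cAcyc_of_hCAcyc hN (ses_v hp) ha) m).2 (hc.ev_ch_iterate hP hM hL i m)
  · obtain ⟨L, _, _, G', _, _, f, g, hL, hs, hG'⟩ := hc.exists_ch_cover
    obtain ⟨p', φ, ψ, hs', hp', ⟨e'⟩⟩ := exists_cover hN hP hp ha hL hs (hG'.hCAcyc hP hn)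
      fun i => hc.ev_ch_iterate hP hM hL i 0
    exact ⟨_, _, _, _, _, _, _, _, hs'.congr_right e, coind_injective hL, p',
      ⟨LinearEquiv.refl _ _⟩, hp', hG'.congr e'.symm⟩

/-- Induction on the injective dimension of Ch W. In dimension zero W is flat by Lambek's criterion,
so T ⊗ W is flat and its character module is injective. -/
theorem ev_ch_ind (hN : IsNilpotentBim R M N)
    (hP : ∀ (L : Type u) [AddCommGroup L] [Module R L], Module.Projective R L → HAcyc R M L)
    {X W : Type u} [AddCommGroup X] [Module (TensorRing R M)ᵐᵒᵖ X] [AddCommGroup W] [Module R W]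
    (hX : GorI (TensorRing R M)ᵐᵒᵖ X) (hW : IdLE Rᵐᵒᵖ n (Ch W)) (ha : HAcyc R M W) (m : ℕ) :
    EV (TensorRing R M)ᵐᵒᵖ (m + 1) (Ch (LPair.ind R M W).Mod) X := by
  induction n generalizing W m with
  | zero =>
    exact hX.ev (isFlatL_iff.1 (isFlatL_ind_of_hAcyc hN hP
      (isFlatL_iff.2 (injective_of_ev (hW 0 le_rfl))) ha)) m
  | succ n ih =>
    obtain ⟨g, hg⟩ := exists_surjective_finsupp R W
    have hs := IsSES.ker hg
    have hF : Module.Projective R (W →₀ R) := inferInstance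
    exact EV.fst_left (LPair.ses_indMap hN hs (hP _ hF) ha).rCh
      (hX.ev (injective_ch_of_projective (LPair.ind_projective hF)) m)
      (ih (hW.right hs.rCh (injective_ch_of_projective hF)) ((hP _ hF).left hs ha) (m + 1))

/-- Reduces to the characters of (L, 0) with L projective, and then dualizes the two-term resolution
of (L, 0) by T ⊗ L and T ⊗ (M ⊗ L). -/
theorem ev_triv_injective (hN : IsNilpotentBim R M N)
    (hP : ∀ (L : Type u) [AddCommGroup L] [Module R L], Module.Projective R L → HAcyc R M L)
    (hM : IdLE Rᵐᵒᵖ k (Ch M)) {X J : Type u} [AddCommGroup X] [Module (TensorRing R M)ᵐᵒᵖ X]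
    [AddCommGroup J] [Module Rᵐᵒᵖ J] (hX : GorI (TensorRing R M)ᵐᵒᵖ X)
    (hJ : Module.Injective Rᵐᵒᵖ J) (m : ℕ) :
    EV (TensorRing R M)ᵐᵒᵖ (m + 1) (triv R M J).Mod X := by
  obtain ⟨L, _, _, hL, hr⟩ := exists_isRetract_ch hJ
  refine EV.retract_fst (isRetract_triv hr) (EV.retract_fst (chTriv R M L).isRetract ?_)
  obtain ⟨ψ, hψ⟩ := LPair.ses_uMap (p := LPair.ind R M L) LPair.ind_ses
  obtain ⟨e⟩ := LPair.tens_ind_equiv hN (hP L hL)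
  exact EV.fst_left hψ.rCh (hX.ev (injective_ch_of_projective (LPair.ind_projective hL)) m)
    ((ev_ch_ind hN hP hX (idLE_ch_tens hM hL) (hP L hL).tens (m + 1)).retract_fst
      e.symm.isRetract.rCh)

theorem exists_gorI_step (hp : GorI (TensorRing R M)ᵐᵒᵖ p.Mod) :
    ∃ (q p' : RPair R M) (f : p'.Mod →ₗ[(TensorRing R M)ᵐᵒᵖ] q.Mod)
      (g : q.Mod →ₗ[(TensorRing R M)ᵐᵒᵖ] p.Mod), IsSES f g ∧
        Module.Injective (TensorRing R M)ᵐᵒᵖ q.Mod ∧ GorI (TensorRing R M)ᵐᵒᵖ p'.Mod := by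
  obtain ⟨P, _, _, G', _, _, f, g, hs, hJ, hG⟩ := hp.step
  obtain ⟨q, ⟨e⟩⟩ := exists_rpair (R := R) (M := M) P
  obtain ⟨p', ⟨e'⟩⟩ := exists_rpair (R := R) (M := M) G'
  exact ⟨q, p', _, _, (hs.congr_mid e.symm).congr_left e', injective_of_isRetract e.isRetract hJ,
    hG.congr e'.symm⟩

/-- Dual of `LPair.cokernel_of_gor`. Finite projective dimension of M on the right gives vanishing
in high degrees, hence surjectivity of v and Ext(M, Y) = 0; finite injective dimension of Ch M gives
the orthogonality to (J, 0). -/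
theorem kernel_of_gorI (hN : IsNilpotentBim R M N)
    (hP : ∀ (L : Type u) [AddCommGroup L] [Module R L], Module.Projective R L → HAcyc R M L)
    (hM : IdLE Rᵐᵒᵖ k (Ch M)) (hn : PdLE Rᵐᵒᵖ n M) (hp : GorI (TensorRing R M)ᵐᵒᵖ p.Mod) :
    Function.Surjective p.v ∧ GorI Rᵐᵒᵖ p.K := by
  have hv : ∀ p : RPair R M, GorI (TensorRing R M)ᵐᵒᵖ p.Mod → Function.Surjective p.v := by
    refine fun p hp => v_surjective_of_ev fun V _ _ hV => ?_
    refine forall_of_shift (c := fun p : RPair R M => GorI (TensorRing R M)ᵐᵒᵖ p.Mod)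
      (P := fun n (p : RPair R M) => EV (TensorRing R M)ᵐᵒᵖ (n + 1) (triv R M V).Mod p.Mod) ?_
      (fun m hm p _ => ev_triv_of_projective hN hP (fun m hm => hn m hm p.Y) hV m hm) 0 p hp
    intro p hp
    obtain ⟨q, p', f, g, hs, hq, hp'⟩ := exists_gorI_step hp
    exact ⟨p', hp', fun n hn => EV.snd_right hs (EV.of_injective hq n) hn⟩
  have hvq : ∀ q : RPair R M, Module.Injective (TensorRing R M)ᵐᵒᵖ q.Mod →
      Function.Surjective q.v := fun q hq => v_surjective_of_ev fun V _ _ hV => EV.of_injective hq 0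
  have hkq : ∀ q : RPair R M, Module.Injective (TensorRing R M)ᵐᵒᵖ q.Mod →
      Module.Injective Rᵐᵒᵖ q.K := fun q hq =>
    injective_of_ev fun X _ _ => ev_k_of_ev (hvq q hq) (EV.of_injective hq 0)
  have ha : ∀ p : RPair R M, GorI (TensorRing R M)ᵐᵒᵖ p.Mod → CAcyc R M p.Y := by
    intro p hp m
    refine forall_of_shift (c := fun p : RPair R M => GorI (TensorRing R M)ᵐᵒᵖ p.Mod)
      (P := fun n (p : RPair R M) => EV Rᵐᵒᵖ (n + 1) M p.Y) ?_ (fun m hm p _ => hn m hm p.Y) m p hp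
    intro p hp
    obtain ⟨q, p', f, g, hs, hq, hp'⟩ := exists_gorI_step hp
    exact ⟨p', hp', fun n hn => EV.snd_right (ses_res hs)
      (cAcyc_of_hCAcyc hN (ses_v (hvq q hq)) (hCAcyc_of_injective hP (hkq q hq)) n) hn⟩
  refine ⟨hv p hp, fun G _ _ => ∃ p : RPair R M, GorI (TensorRing R M)ᵐᵒᵖ p.Mod ∧
    Nonempty (p.K ≃ₗ[Rᵐᵒᵖ] G), ⟨p, hp, ⟨LinearEquiv.refl _ _⟩⟩, ?_⟩
  rintro G _ _ ⟨p, hp, ⟨e⟩⟩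
  refine ⟨fun W _ _ hW m => ((ev_triv_iff hN hP (hv p hp) (ha p hp) m).1
    (ev_triv_injective hN hP hM hp hW m)).retract_snd e.symm.isRetract, ?_⟩
  obtain ⟨q, p', f, g, hs, hq, hp'⟩ := exists_gorI_step hp
  exact ⟨q.K, _, _, p'.K, _, _, _, _, (ses_kMap hs (hv p' hp')).congr_right e,
    hkq q hq, p', hp', ⟨LinearEquiv.refl _ _⟩⟩

end RPair

theorem gi_iff_psi (hN : IsNilpotentBim R M N) (hT : CondT R M) (hM : IdLE Rᵐᵒᵖ k (Ch M))
    (hn : PdLE Rᵐᵒᵖ n M) :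
    GI (TensorRing R M)ᵐᵒᵖ p.Mod ↔ Function.Surjective p.v ∧ GI Rᵐᵒᵖ p.K := by
  have hP : ∀ (L : Type u) [AddCommGroup L] [Module R L], Module.Projective R L → HAcyc R M L :=
    fun L _ _ hL => hT.hAcyc hL
  rw [gi_iff, gi_iff]
  exact ⟨RPair.kernel_of_gorI hN hP hM hn, fun h => RPair.gorI_of_kernel hN hP hM hn h.1 h.2⟩

end GorensteinInjective

end TR

end

/-! ### The theorem -/

theorem theoremA (R : Type u) [Ring R] (M : Type u) [AddCommGroup M] [Module R M]
    [Module Rᵐᵒᵖ M] [SMulCommClass R Rᵐᵒᵖ M] (N : ℕ) (hN : TR.IsNilpotentBim R M N) :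
    (TR.CondT R M →
      projectiveDimension (ModuleCat.of R M) < ⊤ →
      (∃ n, TR.FlatDimLER R n M) →
      {p : TR.LPair R M | TR.GP (TR.TensorRing R M) p.Mod} =
        TR.Phi (fun X _ _ => TR.GP R X)) ∧
    (TR.CondT R M →
      (∃ n, TR.FlatDimLEL R n M) →
      projectiveDimension (ModuleCat.of Rᵐᵒᵖ M) < ⊤ →
      {p : TR.RPair R M | TR.GI (TR.TensorRing R M)ᵐᵒᵖ p.Mod} =
        TR.Psi (fun Y _ _ => TR.GI Rᵐᵒᵖ Y)) ∧
    (TR.IsRightCoherent R →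
      TR.IsFlatL R M →
      Module.FinitePresentation Rᵐᵒᵖ M →
      projectiveDimension (ModuleCat.of Rᵐᵒᵖ M) < ⊤ →
      {p : TR.LPair R M | TR.GF (TR.TensorRing R M) p.Mod} =
        TR.Phi (fun X _ _ => TR.GF R X)) := by
  refine ⟨fun hT hpd ⟨n, hn⟩ => ?_, fun hT ⟨n, hn⟩ hpd => ?_, fun hR hM hfp hpd => ?_⟩
  · obtain ⟨k, hk⟩ := TR.exists_ev_of_projectiveDimension_lt_top hpd
    exact Set.ext fun p => TR.gp_iff_phi hN hT (k := k) (n := n)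
      (fun m hm Y _ _ => hk (m + 1) (by omega) Y) fun m hm Y _ _ => hn.ev hm
  · obtain ⟨k, hk⟩ := TR.exists_ev_of_projectiveDimension_lt_top hpd
    -- The flat dimension of M on the left bounds the injective dimension of Ch M.
    exact Set.ext fun p => TR.gi_iff_psi hN hT (k := n) (n := k)
      (fun m hm Y _ _ => hn.ev hm) fun m hm Y _ _ => hk (m + 1) (by omega) Y
  · obtain ⟨k, hk⟩ := TR.exists_ev_of_projectiveDimension_lt_top hpd
    exact Set.ext fun p => TR.gf_iff_phi hN hR hM hfp (k := k)
      fun m hm Y _ _ => hk (m + 1) (by omega) Y
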